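/- Let $p$ be an odd prime, $\mathcal K$ a field of characteristic $p$, $n\ge 1$, $1\le k\le n$ and $q\in\mathcal K$. Let $\mathcal O=\mathcal O(2n+1;\underline 1)$ be the truncated divided power algebra over $\mathcal K$ with basis $x^{(\alpha)}$, $0\le\alpha\le\tau$, where $\alpha=(\alpha_{-n},\dots,\alpha_n)$ and $\tau=(p-1,\dots,p-1)$, with product $x^{(\alpha)}x^{(\beta)}=\binom{\alpha+\beta}{\alpha}x^{(\alpha+\beta)}$ (and $x^{(\gamma)}=0$ if some $\gamma_i<0$ or $\gamma_i\ge p$), and with derivations $D_i x^{(\alpha)}=x^{(\alpha-\epsilon_i)}$, where $\epsilon_i$ is the $i$-th unit vector. Let $\mathcal D_K:\mathcal O\to \mathrm{Der}_{\mathcal K}(\mathcal O)$ be the linear map $$\mathcal D_K(x^{(\alpha)})=\Big(2-\sum_{i=1}^n(\alpha_i+\alpha_{-i})\Big)x^{(\alpha)}D_0+\sum_{i=1}^n x^{(\alpha-\epsilon_0)}\big(x^{(\epsilon_i)}D_i+x^{(\epsilon_{-i})}D_{-i}\big)+\sum_{i=1}^n\big(x^{(\alpha-\epsilon_{-i})}D_i-x^{(\alpha-\epsilon_i)}D_{-i}\big).$$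 Its image is a Lie algebra; its derived algebra is the contact algebra $\mathbf K=\mathbf K(2n+1;\underline 1)$. Call $\alpha$ admissible if $0\le\alpha\le\tau$ and, in case $p\mid 2n+4$, also $\alpha\ne\tau$; then $\mathcal D_K(x^{(\alpha)})\in\mathbf K$. Let $\mathbf u(\mathbf K)$ be the restricted enveloping algebra, i.e. the quotient of the universal enveloping algebra $U(\mathbf K)$ by the two-sided ideal generated by $\mathcal D_K(x^{(\alpha)})^p-\mathcal D_K(x^{(\alpha)})$ for $\alpha\in\{\epsilon_0\}\cup\{\epsilon_i+\epsilon_{-i}:1\le i\le n\}$ and by $\mathcal D_K(x^{(\alpha)})^p$ for all other admissible $\alpha$. Put $\mathcal K[t]_p^{(q)}=\mathcal K[t]/(t^p-qt)$ and $\mathbf u_{t,q}(\mathbf K)=\mathbf u(\mathbf K)\otimes_{\mathcal K}\mathcal K[t]_p^{(q)}$. Let $h=\mathcal D_K(x^{(\epsilon_k+\epsilon_{-k})})$, $e=\mathcal D_K(x^{(\epsilon_k+\epsilon_0)})$, $d^{(\ell)}=\frac1{\ell!}(\mathrm{ad}\,e)^\ell$ for $0\le\ell<p$, and $x_a^{\langle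 \ell\rangle}=(x+a)(x+a+1)\cdots(x+a+\ell-1)$, $x^{\langle\ell\rangle}=x_0^{\langle\ell\rangle}$. Then $1-et$ is invertible in $\mathbf u_{t,q}(\mathbf K)$, and there is a noncommutative and noncocommutative Hopf algebra structure $(\mathbf u_{t,q}(\mathbf K),m,\iota,\Delta,S,\varepsilon)$ over $\mathcal K[t]_p^{(q)}$ (called of vertical type) whose product $m$ and unit $\iota$ are the given ones and which satisfies, for every admissible $\alpha$, $$\Delta(\mathcal D_K(x^{(\alpha)}))=\mathcal D_K(x^{(\alpha)})\otimes(1-et)^{\alpha_k-\alpha_{-k}}+\sum_{\ell=0}^{p-1}(-1)^\ell h^{\langle\ell\rangle}\otimes(1-et)^{-\ell}\,d^{(\ell)}(\mathcal D_K(x^{(\alpha)}))\,t^\ell,$$ $$S(\mathcal D_K(x^{(\alpha)}))=-(1-et)^{\alpha_{-k}-\alpha_k}\sum_{\ell=0}^{p-1}d^{(\ell)}(\mathcal D_K(x^{(\alpha)}))\,h_1^{\langle\ell\rangle}\,t^\ell,\qquad \varepsilon(\mathcal D_K(x^{(\alpha)}))=0.$$ Moreover $\mathbf u_{t,q}(\mathbf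 K)$ is finite-dimensional over $\mathcal K$, with $\dim_{\mathcal K}\mathbf u_{t,q}(\mathbf K)=p^{p^{2n+1}+1}$ if $2n+4\not\equiv0\pmod p$, and $\dim_{\mathcal K}\mathbf u_{t,q}(\mathbf K)=p^{p^{2n+1}}$ if $2n+4\equiv0\pmod p$. -/

import Mathlib

open scoped TensorProduct
open Finset

noncomputable section

namespace ContactHopf

/-! ### The truncated divided power algebra -/

/-- Indices `-n, …, -1, 0, 1, …, n`; see `Idx.zero`, `Idx.pos`, `Idx.neg`. -/
abbrev Idx (n : ℕ) : Type := Option (Fin n ⊕ Fin n)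

/-- The index `0`. -/
abbrev Idx.zero {n : ℕ} : Idx n := none

/-- The positive index `i + 1`, for `i = 0, …, n - 1`. -/
abbrev Idx.pos {n : ℕ} (i : Fin n) : Idx n := some (Sum.inl i)

/-- The negative index `-(i + 1)`, for `i = 0, …, n - 1`. -/
abbrev Idx.neg {n : ℕ} (i : Fin n) : Idx n := some (Sum.inr i)

/-- The unit vector `ε_i`. -/
abbrev eps {n : ℕ} (i : Idx n) : Idx n → ℕ := Pi.single i 1

section Algebra

variable (𝒦 : Type*) [Field 𝒦] (p : ℕ) (n : ℕ)

/-- The ideal generated by the `p`-th powers of the variables. -/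
abbrev truncIdeal : Ideal (MvPolynomial (Idx n) 𝒦) :=
  Ideal.span (Set.range fun i : Idx n => (MvPolynomial.X i : MvPolynomial (Idx n) 𝒦) ^ p)

/-- The truncated divided power algebra `𝒪(2n+1; 1)` over a field of characteristic `p`, realised as
the truncated polynomial algebra `𝒦[x_{-n}, …, x_n] / (x_i ^ p)`; its divided power monomials
`x^{(α)} = x^α / α!`, `0 ≤ α_i < p`, multiply by the rule `dpMon_mul`. -/
abbrev DPAlg : Type _ := MvPolynomial (Idx n) 𝒦 ⧸ truncIdeal 𝒦 p n

variable {n}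

/-- The generator `x_i`. -/
def gen (i : Idx n) : DPAlg 𝒦 p n := Ideal.Quotient.mk _ (MvPolynomial.X i)

/-- The divided power monomial `x^{(α)} = x^α / α!`. It is `0` as soon as some `α_i ≥ p`. -/
def dpMon (α : Idx n → ℕ) : DPAlg 𝒦 p n :=
  ((∏ i, ((α i).factorial : 𝒦))⁻¹) • ∏ i, gen 𝒦 p i ^ α i

variable {𝒦 p}

lemma gen_pow_p (i : Idx n) : gen 𝒦 p i ^ p = 0 := by
  unfold gen
  rw [← map_pow, Ideal.Quotient.eq_zero_iff_mem]
  exact Ideal.subset_span ⟨i, rfl⟩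

lemma dpMon_eq_zero {α : Idx n → ℕ} (i : Idx n) (h : p ≤ α i) : dpMon 𝒦 p α = 0 := by
  have h0 : ∏ i, gen 𝒦 p i ^ α i = 0 := by
    refine Finset.prod_eq_zero (Finset.mem_univ i) ?_
    rw [← Nat.sub_add_cancel h, pow_add, gen_pow_p, mul_zero]
  rw [dpMon, h0, smul_zero]

lemma der_ext {D E : Derivation 𝒦 (DPAlg 𝒦 p n) (DPAlg 𝒦 p n)}
    (h : ∀ j, D (gen 𝒦 p j) = E (gen 𝒦 p j)) : D = E := by
  ext f
  obtain ⟨f, rfl⟩ := Ideal.Quotient.mk_surjective f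
  induction f using MvPolynomial.induction_on with
  | C a =>
    have : Ideal.Quotient.mk (truncIdeal 𝒦 p n) (MvPolynomial.C a) =
      algebraMap 𝒦 (DPAlg 𝒦 p n) a := rfl
    rw [this, Derivation.map_algebraMap, Derivation.map_algebraMap]
  | add f g hf hg => rw [map_add, map_add, map_add, hf, hg]
  | mul_X f i hf =>
    rw [map_mul, Derivation.leibniz, Derivation.leibniz, hf]
    congr 2
    exact h i

lemma der_sum_apply {ι : Type*} (s : Finset ι)
    (D : ι → Derivation 𝒦 (DPAlg 𝒦 p n) (DPAlg 𝒦 p n)) (g : DPAlg 𝒦 p n) :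
    (∑ i ∈ s, D i) g = ∑ i ∈ s, D i g := by
  induction s using Finset.cons_induction with
  | empty => simp
  | cons a s ha ih => rw [Finset.sum_cons, Finset.sum_cons, Derivation.add_apply, ih]

section DividedPowers

variable [hp : Fact p.Prime] [CharP 𝒦 p]

lemma factorial_cast_ne_zero {m : ℕ} (h : m < p) : (m.factorial : 𝒦) ≠ 0 := by
  rw [Ne, CharP.cast_eq_zero_iff 𝒦 p, hp.out.dvd_factorial]
  omega

/-- The multiplication rule of divided powers. -/
lemma dpMon_mul {α β : Idx n → ℕ} (hα : ∀ i, α i < p) (hβ : ∀ i, β i < p) :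
    dpMon 𝒦 p α * dpMon 𝒦 p β =
      ((∏ i, (α i + β i).choose (α i) : ℕ) : 𝒦) • dpMon 𝒦 p (α + β) := by
  by_cases h : ∀ i, α i + β i < p
  · unfold dpMon
    rw [smul_mul_smul_comm, ← Finset.prod_mul_distrib, smul_smul]
    congr 1
    · push_cast
      rw [← mul_inv, ← Finset.prod_mul_distrib, ← Finset.prod_inv_distrib,
        ← Finset.prod_inv_distrib, ← Finset.prod_mul_distrib]
      refine Finset.prod_congr rfl fun i _ => ?_
      have h1 := factorial_cast_ne_zero (𝒦 := 𝒦) (hα i)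
      have h2 := factorial_cast_ne_zero (𝒦 := 𝒦) (hβ i)
      have h3 := factorial_cast_ne_zero (𝒦 := 𝒦) (h i)
      have h4 : ((α i + β i).choose (α i) : 𝒦) * (α i).factorial * (β i).factorial =
          ((α i + β i).factorial : 𝒦) := by
        have := Nat.choose_mul_factorial_mul_factorial (Nat.le_add_right (α i) (β i))
        rw [Nat.add_sub_cancel_left] at this
        rw [← Nat.cast_mul, ← Nat.cast_mul, this]
      rw [Pi.add_apply]
      field_simp
      linear_combination -h4
    · exact Finset.prod_congr rfl fun i _ => by rw [Pi.add_apply, pow_add]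
  · push Not at h
    obtain ⟨i, hi⟩ := h
    rw [dpMon_eq_zero (α := α + β) i hi, smul_zero]
    have h0 : ∏ i, gen 𝒦 p i ^ α i * gen 𝒦 p i ^ β i = 0 := by
      refine Finset.prod_eq_zero (Finset.mem_univ i) ?_
      rw [← pow_add, ← Nat.sub_add_cancel hi, pow_add, gen_pow_p, mul_zero]
    rw [dpMon, dpMon, smul_mul_smul_comm, ← Finset.prod_mul_distrib, h0, smul_zero]

end DividedPowers

section Partial

variable (𝒦 p)
variable [CharP 𝒦 p]

lemma partialD_aux (i : Idx n) (x : MvPolynomial (Idx n) 𝒦)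
    (hx : Ideal.Quotient.mkₐ 𝒦 (truncIdeal 𝒦 p n) x = 0) :
    Ideal.Quotient.mkₐ 𝒦 (truncIdeal 𝒦 p n) (MvPolynomial.pderiv i x) = 0 := by
  rw [Ideal.Quotient.mkₐ_eq_mk, Ideal.Quotient.eq_zero_iff_mem] at hx ⊢
  refine Submodule.span_induction ?_ (by simp) ?_ ?_ hx
  · rintro _ ⟨j, rfl⟩
    simp
  · intro a b _ _ ha hb
    rw [map_add]
    exact Ideal.add_mem _ ha hb
  · intro a b hb' hb
    rw [smul_eq_mul, Derivation.leibniz]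
    exact Ideal.add_mem _ (Ideal.mul_mem_left _ _ hb) (Ideal.mul_mem_right _ _ hb')

/-- The partial derivative `D_i` of `𝒪(2n+1; 1)`, with `D_i x_j = δ_{ij}` and
`D_i x^{(α)} = x^{(α - ε_i)}` (see `partialD_gen`, `partialD_dpMon`). -/
def partialD (i : Idx n) : Derivation 𝒦 (DPAlg 𝒦 p n) (DPAlg 𝒦 p n) :=
  Derivation.liftOfSurjective (f := Ideal.Quotient.mkₐ 𝒦 (truncIdeal 𝒦 p n))
    (Ideal.Quotient.mkₐ_surjective _ _) (d := MvPolynomial.pderiv i) (partialD_aux 𝒦 p i)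

variable {𝒦 p}

lemma partialD_mk (i : Idx n) (f : MvPolynomial (Idx n) 𝒦) :
    partialD 𝒦 p i (Ideal.Quotient.mk _ f) = Ideal.Quotient.mk _ (MvPolynomial.pderiv i f) :=
  Derivation.liftOfSurjective_apply (f := Ideal.Quotient.mkₐ 𝒦 (truncIdeal 𝒦 p n))
    (Ideal.Quotient.mkₐ_surjective _ _) (partialD_aux 𝒦 p i) f

lemma partialD_gen (i j : Idx n) :
    partialD 𝒦 p i (gen 𝒦 p j) = if j = i then 1 else 0 := by
  rw [gen, partialD_mk, MvPolynomial.pderiv_X, Pi.single_apply]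
  split_ifs <;> simp

lemma partialD_comm (i j : Idx n) (f : DPAlg 𝒦 p n) :
    partialD 𝒦 p i (partialD 𝒦 p j f) = partialD 𝒦 p j (partialD 𝒦 p i f) := by
  have : ⁅partialD 𝒦 p i, partialD 𝒦 p j⁆ = 0 := by
    apply der_ext
    intro l
    rw [Derivation.commutator_apply, partialD_gen, partialD_gen]
    split_ifs <;> simp
  have h := Derivation.congr_fun this f
  rw [Derivation.commutator_apply] at h
  exact sub_eq_zero.mp h

lemma partialD_prod (i : Idx n) (α : Idx n → ℕ) :
    partialD 𝒦 p i (∏ j, gen 𝒦 p j ^ α j) =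
      (α i : 𝒦) • ∏ j, gen 𝒦 p j ^ (α - eps i) j := by
  have h0 : ∀ s : Finset (Idx n), i ∉ s → partialD 𝒦 p i (∏ j ∈ s, gen 𝒦 p j ^ α j) = 0 := by
    intro s
    induction s using Finset.induction_on with
    | empty => simp
    | insert a s ha ih =>
      intro hi
      rw [Finset.mem_insert, not_or] at hi
      rw [Finset.prod_insert ha, Derivation.leibniz, ih hi.2, Derivation.leibniz_pow,
        partialD_gen, if_neg (Ne.symm hi.1)]
      simp
  rw [← Finset.mul_prod_erase _ _ (Finset.mem_univ i), Derivation.leibniz,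
    h0 _ (Finset.notMem_erase _ _), Derivation.leibniz_pow, partialD_gen, if_pos rfl,
    ← Finset.mul_prod_erase _ (fun j => gen 𝒦 p j ^ (α - eps i) j) (Finset.mem_univ i)]
  have h1 : ∏ j ∈ Finset.univ.erase i, gen 𝒦 p j ^ (α - eps i) j =
      ∏ j ∈ Finset.univ.erase i, gen 𝒦 p j ^ α j := by
    refine Finset.prod_congr rfl fun j hj => ?_
    rw [Pi.sub_apply, eps, Pi.single_eq_of_ne (Finset.ne_of_mem_erase hj), Nat.sub_zero]
  rw [h1, Pi.sub_apply, eps, Pi.single_eq_same, Nat.cast_smul_eq_nsmul]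
  simp only [smul_eq_mul, mul_one, nsmul_eq_mul]
  ring

lemma partialD_dpMon [Fact p.Prime] (i : Idx n) {α : Idx n → ℕ} (hα : ∀ j, α j < p) :
    partialD 𝒦 p i (dpMon 𝒦 p α) = if α i = 0 then 0 else dpMon 𝒦 p (α - eps i) := by
  rw [dpMon, Derivation.map_smul, partialD_prod, smul_smul]
  split_ifs with h
  · simp [h]
  · rw [dpMon]
    congr 1
    obtain ⟨m, hm⟩ := Nat.exists_eq_succ_of_ne_zero h
    rw [← Finset.mul_prod_erase _ _ (Finset.mem_univ i),
      ← Finset.mul_prod_erase _ (fun j => (((α - eps i) j).factorial : 𝒦)) (Finset.mem_univ i)]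
    have h1 : ∏ j ∈ Finset.univ.erase i, (((α - eps i) j).factorial : 𝒦) =
        ∏ j ∈ Finset.univ.erase i, ((α j).factorial : 𝒦) := by
      refine Finset.prod_congr rfl fun j hj => ?_
      rw [Pi.sub_apply, eps, Pi.single_eq_of_ne (Finset.ne_of_mem_erase hj), Nat.sub_zero]
    have h2 : ((α i : ℕ) : 𝒦) ≠ 0 := by
      rw [Ne, CharP.cast_eq_zero_iff 𝒦 p]
      exact fun hd => absurd (Nat.le_of_dvd (Nat.pos_of_ne_zero h) hd) (not_le.mpr (hα i))
    rw [h1, Pi.sub_apply, eps, Pi.single_eq_same, hm, Nat.succ_sub_one, Nat.factorial_succ]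
    rw [hm] at h2
    push_cast at h2 ⊢
    rw [mul_inv, mul_inv, mul_inv]
    field_simp

lemma gen_mul_partialD_dpMon (i : Idx n) (α : Idx n → ℕ) :
    gen 𝒦 p i * partialD 𝒦 p i (dpMon 𝒦 p α) = (α i : 𝒦) • dpMon 𝒦 p α := by
  rw [dpMon, Derivation.map_smul, partialD_prod, mul_smul_comm, mul_smul_comm,
    smul_comm (α i : 𝒦)]
  by_cases h : α i = 0
  · simp [h]
  · congr 2
    rw [← Finset.mul_prod_erase _ (fun j => gen 𝒦 p j ^ (α - eps i) j) (Finset.mem_univ i),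
      ← Finset.mul_prod_erase _ (fun j => gen 𝒦 p j ^ α j) (Finset.mem_univ i), ← mul_assoc]
    congr 1
    · rw [Pi.sub_apply, eps, Pi.single_eq_same, ← pow_succ', Nat.sub_add_cancel]
      omega
    · refine Finset.prod_congr rfl fun j hj => ?_
      rw [Pi.sub_apply, eps, Pi.single_eq_of_ne (Finset.ne_of_mem_erase hj), Nat.sub_zero]

end Partial

/-! ### The contact algebra -/

section Contact

variable (𝒦 p)
variable [CharP 𝒦 p]

/-- The Euler derivation in the variables of non-zero index,
`E = ∑_i (x_i D_i + x_{-i} D_{-i})`. -/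
def eulerD : Derivation 𝒦 (DPAlg 𝒦 p n) (DPAlg 𝒦 p n) :=
  ∑ i : Fin n, (gen 𝒦 p (.pos i) • partialD 𝒦 p (.pos i) +
    gen 𝒦 p (.neg i) • partialD 𝒦 p (.neg i))

/-- The derivation `∑_i ((D_{-i} f) D_i - (D_i f) D_{-i})`. -/
def hamD (f : DPAlg 𝒦 p n) : Derivation 𝒦 (DPAlg 𝒦 p n) (DPAlg 𝒦 p n) :=
  ∑ i : Fin n, (partialD 𝒦 p (.neg i) f • partialD 𝒦 p (.pos i) -
    partialD 𝒦 p (.pos i) f • partialD 𝒦 p (.neg i))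

/-- The linear map `D_K` from `𝒪(2n+1; 1)` to its derivations,
`D_K(f) = (2 f - E f) D_0 + (D_0 f) E + ∑_i ((D_{-i} f) D_i - (D_i f) D_{-i})`.
Its value on `x^{(α)}` is spelled out in `contactD_dpMon`. -/
def contactD : DPAlg 𝒦 p n →ₗ[𝒦] Derivation 𝒦 (DPAlg 𝒦 p n) (DPAlg 𝒦 p n) where
  toFun f := (2 * f - eulerD 𝒦 p f) • partialD 𝒦 p .zero +
    partialD 𝒦 p .zero f • eulerD 𝒦 p + hamD 𝒦 p f
  map_add' f g := by
    have h : hamD 𝒦 p (f + g) = hamD 𝒦 p f + hamD 𝒦 p g := by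
      simp only [hamD, ← Finset.sum_add_distrib, map_add, add_smul]
      exact Finset.sum_congr rfl fun i _ => by abel
    rw [h, map_add, map_add, mul_add]
    module
  map_smul' c f := by
    have h : hamD 𝒦 p (c • f) = c • hamD 𝒦 p f := by
      simp only [hamD, Finset.smul_sum]
      refine Finset.sum_congr rfl fun i _ => ?_
      ext a
      simp [smul_sub]
    rw [h, Derivation.map_smul, Derivation.map_smul, RingHom.id_apply, smul_add, smul_add, ← smul_assoc, ← smul_assoc,
      smul_sub, mul_smul_comm]

variable {𝒦 p}

lemma contactD_apply (f g : DPAlg 𝒦 p n) :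
    contactD 𝒦 p f g = (2 * f - eulerD 𝒦 p f) * partialD 𝒦 p .zero g +
      partialD 𝒦 p .zero f * eulerD 𝒦 p g + hamD 𝒦 p f g := by
  simp [contactD]

lemma eulerD_apply (g : DPAlg 𝒦 p n) :
    eulerD 𝒦 p g = ∑ i : Fin n, (gen 𝒦 p (.pos i) * partialD 𝒦 p (.pos i) g +
      gen 𝒦 p (.neg i) * partialD 𝒦 p (.neg i) g) := by
  rw [eulerD, der_sum_apply]
  rfl

lemma hamD_apply (f g : DPAlg 𝒦 p n) :
    hamD 𝒦 p f g = ∑ i : Fin n, (partialD 𝒦 p (.neg i) f * partialD 𝒦 p (.pos i) g -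
      partialD 𝒦 p (.pos i) f * partialD 𝒦 p (.neg i) g) := by
  rw [hamD, der_sum_apply]
  rfl

lemma hamD_antisymm (f g : DPAlg 𝒦 p n) : hamD 𝒦 p g f = -hamD 𝒦 p f g := by
  rw [hamD_apply, hamD_apply, ← Finset.sum_neg_distrib]
  exact Finset.sum_congr rfl fun i _ => by ring

lemma partialD_hamD (j : Idx n) (f g : DPAlg 𝒦 p n) :
    partialD 𝒦 p j (hamD 𝒦 p f g) =
      hamD 𝒦 p (partialD 𝒦 p j f) g + hamD 𝒦 p f (partialD 𝒦 p j g) := by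
  rw [hamD_apply, hamD_apply, hamD_apply, map_sum, ← Finset.sum_add_distrib]
  refine Finset.sum_congr rfl fun i _ => ?_
  simp only [map_sub, Derivation.leibniz, smul_eq_mul, partialD_comm j]
  ring

lemma partialD_zero_eulerD (f : DPAlg 𝒦 p n) :
    partialD 𝒦 p .zero (eulerD 𝒦 p f) = eulerD 𝒦 p (partialD 𝒦 p .zero f) := by
  rw [eulerD_apply, eulerD_apply, map_sum]
  refine Finset.sum_congr rfl fun i _ => ?_
  simp only [map_add, Derivation.leibniz, smul_eq_mul, partialD_comm .zero, partialD_gen]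
  simp

lemma partialD_pos_eulerD (j : Fin n) (f : DPAlg 𝒦 p n) :
    partialD 𝒦 p (.pos j) (eulerD 𝒦 p f) =
      eulerD 𝒦 p (partialD 𝒦 p (.pos j) f) + partialD 𝒦 p (.pos j) f := by
  rw [eulerD_apply, eulerD_apply, map_sum]
  have h : partialD 𝒦 p (.pos j) f =
      ∑ i : Fin n, if i = j then partialD 𝒦 p (.pos i) f else 0 := by simp
  refine Eq.trans ?_ (congrArg₂ (· + ·) rfl h.symm)
  rw [← Finset.sum_add_distrib]
  refine Finset.sum_congr rfl fun i _ => ?_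
  simp only [map_add, Derivation.leibniz, smul_eq_mul, partialD_comm (.pos j), partialD_gen]
  by_cases hij : i = j
  · simp [hij]
    ring
  · simp [hij]

lemma partialD_neg_eulerD (j : Fin n) (f : DPAlg 𝒦 p n) :
    partialD 𝒦 p (.neg j) (eulerD 𝒦 p f) =
      eulerD 𝒦 p (partialD 𝒦 p (.neg j) f) + partialD 𝒦 p (.neg j) f := by
  rw [eulerD_apply, eulerD_apply, map_sum]
  have h : partialD 𝒦 p (.neg j) f =
      ∑ i : Fin n, if i = j then partialD 𝒦 p (.neg i) f else 0 := by simp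
  refine Eq.trans ?_ (congrArg₂ (· + ·) rfl h.symm)
  rw [← Finset.sum_add_distrib]
  refine Finset.sum_congr rfl fun i _ => ?_
  simp only [map_add, Derivation.leibniz, smul_eq_mul, partialD_comm (.neg j), partialD_gen]
  by_cases hij : i = j
  · simp [hij]
    ring
  · simp [hij]

lemma eulerD_hamD (f g : DPAlg 𝒦 p n) :
    eulerD 𝒦 p (hamD 𝒦 p f g) =
      hamD 𝒦 p (eulerD 𝒦 p f) g + hamD 𝒦 p f (eulerD 𝒦 p g) - 2 * hamD 𝒦 p f g := by
  rw [hamD_apply, hamD_apply, hamD_apply, map_sum, Finset.mul_sum, ← Finset.sum_add_distrib,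
    ← Finset.sum_sub_distrib]
  refine Finset.sum_congr rfl fun i _ => ?_
  simp only [map_sub, Derivation.leibniz, smul_eq_mul, partialD_pos_eulerD, partialD_neg_eulerD]
  ring

lemma eulerD_zero : eulerD 𝒦 p (gen 𝒦 p (.zero : Idx n)) = 0 := by
  simp [eulerD_apply, partialD_gen]

lemma eulerD_pos (j : Fin n) : eulerD 𝒦 p (gen 𝒦 p (.pos j)) = gen 𝒦 p (.pos j) := by
  simp [eulerD_apply, partialD_gen]

lemma eulerD_neg (j : Fin n) : eulerD 𝒦 p (gen 𝒦 p (.neg j)) = gen 𝒦 p (.neg j) := by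
  simp [eulerD_apply, partialD_gen]

lemma hamD_zero (f : DPAlg 𝒦 p n) : hamD 𝒦 p f (gen 𝒦 p .zero) = 0 := by
  simp [hamD_apply, partialD_gen]

lemma hamD_pos (f : DPAlg 𝒦 p n) (j : Fin n) :
    hamD 𝒦 p f (gen 𝒦 p (.pos j)) = partialD 𝒦 p (.neg j) f := by
  simp [hamD_apply, partialD_gen]

lemma hamD_neg (f : DPAlg 𝒦 p n) (j : Fin n) :
    hamD 𝒦 p f (gen 𝒦 p (.neg j)) = -partialD 𝒦 p (.pos j) f := by
  simp [hamD_apply, partialD_gen]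

lemma contactD_gen_zero (f : DPAlg 𝒦 p n) :
    contactD 𝒦 p f (gen 𝒦 p .zero) = 2 * f - eulerD 𝒦 p f := by
  rw [contactD_apply, partialD_gen, eulerD_zero, hamD_zero]
  simp

lemma contactD_gen_pos (f : DPAlg 𝒦 p n) (j : Fin n) :
    contactD 𝒦 p f (gen 𝒦 p (.pos j)) =
      gen 𝒦 p (.pos j) * partialD 𝒦 p .zero f + partialD 𝒦 p (.neg j) f := by
  rw [contactD_apply, partialD_gen, eulerD_pos, hamD_pos]
  simp [mul_comm]

lemma contactD_gen_neg (f : DPAlg 𝒦 p n) (j : Fin n) :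
    contactD 𝒦 p f (gen 𝒦 p (.neg j)) =
      gen 𝒦 p (.neg j) * partialD 𝒦 p .zero f - partialD 𝒦 p (.pos j) f := by
  rw [contactD_apply, partialD_gen, eulerD_neg, hamD_neg]
  simp [mul_comm, sub_eq_add_neg]

/-- The contact bracket `[D_K(f), D_K(g)] = D_K(D_K(f) g - 2 (D_0 f) g)`; in particular the
image of `D_K` is closed under the Lie bracket. -/
lemma contactD_lie (f g : DPAlg 𝒦 p n) :
    ⁅contactD 𝒦 p f, contactD 𝒦 p g⁆ =
      contactD 𝒦 p (contactD 𝒦 p f g - 2 * (partialD 𝒦 p .zero f * g)) := by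
  have two (D : Derivation 𝒦 (DPAlg 𝒦 p n) (DPAlg 𝒦 p n)) (a : DPAlg 𝒦 p n) :
      D (2 * a) = 2 * D a := by
    rw [two_mul, two_mul, map_add]
  apply der_ext
  rintro (_ | j | j)
  · rw [Derivation.commutator_apply, contactD_gen_zero, contactD_gen_zero, contactD_gen_zero]
    simp only [contactD_apply, map_add, map_sub, two,
      Derivation.leibniz, smul_eq_mul, eulerD_hamD, partialD_zero_eulerD]
    rw [hamD_antisymm f g, hamD_antisymm (eulerD 𝒦 p f) g]
    ring
  · rw [Derivation.commutator_apply, contactD_gen_pos, contactD_gen_pos, contactD_gen_pos]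
    simp only [contactD_apply, map_add, map_sub, two, partialD_gen, eulerD_pos, hamD_pos,
      Derivation.leibniz, smul_eq_mul, partialD_zero_eulerD, partialD_hamD,
      partialD_neg_eulerD, partialD_comm .zero (.neg j), reduceCtorEq, if_false]
    rw [hamD_antisymm (partialD 𝒦 p .zero f) g, hamD_antisymm (partialD 𝒦 p (.neg j) f) g]
    ring
  · rw [Derivation.commutator_apply, contactD_gen_neg, contactD_gen_neg, contactD_gen_neg]
    simp only [contactD_apply, map_add, map_sub, two, partialD_gen, eulerD_neg, hamD_neg,
      Derivation.leibniz, smul_eq_mul, partialD_zero_eulerD, partialD_hamD,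
      partialD_pos_eulerD, partialD_comm .zero (.pos j), reduceCtorEq, if_false]
    rw [hamD_antisymm (partialD 𝒦 p .zero f) g, hamD_antisymm (partialD 𝒦 p (.pos j) f) g]
    ring

lemma eulerD_dpMon (α : Idx n → ℕ) :
    eulerD 𝒦 p (dpMon 𝒦 p α) =
      (∑ i : Fin n, ((α (.pos i) : 𝒦) + (α (.neg i) : 𝒦))) • dpMon 𝒦 p α := by
  rw [eulerD_apply, Finset.sum_smul]
  refine Finset.sum_congr rfl fun i _ => ?_
  rw [gen_mul_partialD_dpMon, gen_mul_partialD_dpMon, add_smul]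

variable (𝒦 p) in
/-- The monomial `x^{(α - ε_i)}`, which is `0` if `α_i = 0`. -/
def dpLower (α : Idx n → ℕ) (i : Idx n) : DPAlg 𝒦 p n :=
  if α i = 0 then 0 else dpMon 𝒦 p (α - eps i)

/-- The values of `D_K` on the divided power monomials. -/
lemma contactD_dpMon [Fact p.Prime] {α : Idx n → ℕ} (hα : ∀ j, α j < p) :
    contactD 𝒦 p (dpMon 𝒦 p α) =
      ((2 - ∑ i : Fin n, ((α (.pos i) : 𝒦) + (α (.neg i) : 𝒦))) • dpMon 𝒦 p α) •
          partialD 𝒦 p .zero +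
        ∑ i : Fin n, ((dpLower 𝒦 p α .zero * gen 𝒦 p (.pos i)) • partialD 𝒦 p (.pos i) +
          (dpLower 𝒦 p α .zero * gen 𝒦 p (.neg i)) • partialD 𝒦 p (.neg i)) +
        ∑ i : Fin n, (dpLower 𝒦 p α (.neg i) • partialD 𝒦 p (.pos i) -
          dpLower 𝒦 p α (.pos i) • partialD 𝒦 p (.neg i)) := by
  have h (i : Idx n) : dpLower 𝒦 p α i = partialD 𝒦 p i (dpMon 𝒦 p α) :=
    (partialD_dpMon i hα).symm
  simp only [h]
  apply Derivation.ext
  intro g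
  rw [contactD_apply, eulerD_dpMon, eulerD_apply, hamD_apply, Derivation.add_apply,
    Derivation.add_apply, der_sum_apply, der_sum_apply, Finset.mul_sum]
  congr 1
  congr 1
  · rw [Derivation.smul_apply, smul_eq_mul, sub_smul, two_smul, two_mul]
  · refine Finset.sum_congr rfl fun i _ => ?_
    rw [Derivation.add_apply, Derivation.smul_apply, Derivation.smul_apply, smul_eq_mul,
      smul_eq_mul]
    ring

variable (𝒦 p n)

/-- The Lie algebra `K'(2n+1; 1) = D_K(𝒪(2n+1; 1))`. -/
def contactFull : LieSubalgebra 𝒦 (Derivation 𝒦 (DPAlg 𝒦 p n) (DPAlg 𝒦 p n)) where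
  __ := LinearMap.range (contactD 𝒦 p)
  lie_mem' := by
    rintro _ _ ⟨f, rfl⟩ ⟨g, rfl⟩
    exact ⟨_, (contactD_lie f g).symm⟩

/-- The contact algebra `K(2n+1; 1)`: the derived algebra of `K'(2n+1; 1)`. -/
abbrev ContactAlg : Type _ := ↥(LieAlgebra.derivedSeries 𝒦 (contactFull 𝒦 p n) 1)

variable {n}

/-- `D_K(f)` as an element of `K'(2n+1; 1)`. -/
def contactFullElt (f : DPAlg 𝒦 p n) : contactFull 𝒦 p n := ⟨contactD 𝒦 p f, f, rfl⟩

open scoped Classical in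
/-- `D_K(x^{(α)})` as an element of `K(2n+1; 1)`. It is one for every admissible `α`
(see `contactElt_mem` and `coe_contactElt`), and the definition is only used for such `α`. -/
def contactElt (α : Idx n → ℕ) : ContactAlg 𝒦 p n :=
  if h : contactFullElt 𝒦 p (dpMon 𝒦 p α) ∈ LieAlgebra.derivedSeries 𝒦 (contactFull 𝒦 p n) 1
  then ⟨contactFullElt 𝒦 p (dpMon 𝒦 p α), h⟩ else 0

/-- The exponents of the basis elements `D_K(x^{(α)})` of `K(2n+1; 1)`: `0 ≤ α ≤ τ` with
`τ = (p - 1, …, p - 1)`, and `α ≠ τ` if `2n + 4 ≡ 0 (mod p)`. -/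
def Admissible (α : Idx n → ℕ) : Prop :=
  (∀ i, α i ≤ p - 1) ∧ (p ∣ 2 * n + 4 → α ≠ fun _ => p - 1)

variable {p}

lemma contactElt_mem [hp : Fact p.Prime] (hp2 : p ≠ 2) {α : Idx n → ℕ} (hα : Admissible p α) :
    contactFullElt 𝒦 p (dpMon 𝒦 p α) ∈
      LieAlgebra.derivedSeries 𝒦 (contactFull 𝒦 p n) 1 := by
  have hp1 : 1 < p := hp.out.one_lt
  have h2 : (2 : 𝒦) ≠ 0 := by
    have h : ((2 : ℕ) : 𝒦) ≠ 0 := by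
      rw [Ne, CharP.cast_eq_zero_iff 𝒦 p]
      exact fun h => hp2 ((Nat.prime_dvd_prime_iff_eq hp.out Nat.prime_two).mp h)
    exact_mod_cast h
  set N : Submodule 𝒦 (DPAlg 𝒦 p n) :=
    { carrier := {f | contactFullElt 𝒦 p f ∈ LieAlgebra.derivedSeries 𝒦 (contactFull 𝒦 p n) 1}
      add_mem' := fun {f g} hf hg => by
        have h : contactFullElt 𝒦 p (f + g) = contactFullElt 𝒦 p f + contactFullElt 𝒦 p g :=
          Subtype.ext (map_add _ f g)
        rw [Set.mem_ofPred_eq, h]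
        exact add_mem hf hg
      zero_mem' := by
        have h : contactFullElt 𝒦 p (0 : DPAlg 𝒦 p n) = 0 :=
          Subtype.ext (map_zero (contactD 𝒦 p))
        rw [Set.mem_ofPred_eq, h]
        exact zero_mem _
      smul_mem' := fun c f hf => by
        have h : contactFullElt 𝒦 p (c • f) = c • contactFullElt 𝒦 p f :=
          Subtype.ext (map_smul _ c f)
        rw [Set.mem_ofPred_eq, h]
        exact Submodule.smul_mem _ c hf } with hN
  have hbr (f g : DPAlg 𝒦 p n) : contactD 𝒦 p f g - 2 * (partialD 𝒦 p .zero f * g) ∈ N := by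
    have h : contactFullElt 𝒦 p (contactD 𝒦 p f g - 2 * (partialD 𝒦 p .zero f * g)) =
        ⁅contactFullElt 𝒦 p f, contactFullElt 𝒦 p g⁆ :=
      Subtype.ext (contactD_lie f g).symm
    change contactFullElt 𝒦 p (contactD 𝒦 p f g - 2 * (partialD 𝒦 p .zero f * g)) ∈
      LieAlgebra.derivedSeries 𝒦 (contactFull 𝒦 p n) 1
    rw [h, LieAlgebra.derivedSeries_def, LieAlgebra.derivedSeriesOfIdeal_succ]
    exact LieSubmodule.lie_mem_lie (LieSubmodule.mem_top _) (LieSubmodule.mem_top _)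
  have hz (f : DPAlg 𝒦 p n) : partialD 𝒦 p .zero f ∈ N := by
    have h := hbr 1 f
    have h' : contactD 𝒦 p 1 f - 2 * (partialD 𝒦 p .zero 1 * f) =
        (2 : 𝒦) • partialD 𝒦 p .zero f := by
      rw [contactD_apply, hamD_antisymm, Derivation.map_one_eq_zero,
        Derivation.map_one_eq_zero, Derivation.map_one_eq_zero, two_smul]
      ring
    rw [h'] at h
    exact (Submodule.smul_mem_iff N h2).mp h
  have hpos (i : Fin n) (f : DPAlg 𝒦 p n) : partialD 𝒦 p (.pos i) f ∈ N := by
    have h := hbr (gen 𝒦 p (.neg i)) f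
    have h' : contactD 𝒦 p (gen 𝒦 p (.neg i)) f -
        2 * (partialD 𝒦 p .zero (gen 𝒦 p (.neg i)) * f) =
        partialD 𝒦 p .zero (gen 𝒦 p (.neg i) * f) + partialD 𝒦 p (.pos i) f := by
      rw [contactD_apply, hamD_antisymm, hamD_neg, eulerD_neg, Derivation.leibniz, partialD_gen]
      simp
      ring
    rw [h'] at h
    exact (Submodule.add_mem_iff_right N (hz _)).mp h
  have hneg (i : Fin n) (f : DPAlg 𝒦 p n) : partialD 𝒦 p (.neg i) f ∈ N := by
    have h := hbr (gen 𝒦 p (.pos i)) f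
    have h' : contactD 𝒦 p (gen 𝒦 p (.pos i)) f -
        2 * (partialD 𝒦 p .zero (gen 𝒦 p (.pos i)) * f) =
        partialD 𝒦 p .zero (gen 𝒦 p (.pos i) * f) - partialD 𝒦 p (.neg i) f := by
      rw [contactD_apply, hamD_antisymm, hamD_pos, eulerD_pos, Derivation.leibniz, partialD_gen]
      simp
      ring
    rw [h'] at h
    exact (Submodule.sub_mem_iff_right N (hz _)).mp h
  have hall (i : Idx n) (f : DPAlg 𝒦 p n) : partialD 𝒦 p i f ∈ N := by
    rcases i with _ | i | i
    exacts [hz f, hpos i f, hneg i f]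
  change dpMon 𝒦 p α ∈ N
  by_cases h : ∃ i, α i < p - 1
  · obtain ⟨i, hi⟩ := h
    have hlt : ∀ j, (α + eps i) j < p := by
      intro j
      have := hα.1 j
      rw [Pi.add_apply, eps, Pi.single_apply]
      split_ifs with hj
      · subst hj; omega
      · omega
    have h := hall i (dpMon 𝒦 p (α + eps i))
    rw [partialD_dpMon i hlt, if_neg (by simp), add_tsub_cancel_right] at h
    exact h
  · push Not at h
    have hτ : ∀ i, α i = p - 1 := fun i => le_antisymm (hα.1 i) (h i)
    have hnd : ¬ p ∣ 2 * n + 4 := fun hd => hα.2 hd (funext hτ)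
    have h := hbr (gen 𝒦 p .zero) (dpMon 𝒦 p α)
    have h' : contactD 𝒦 p (gen 𝒦 p .zero) (dpMon 𝒦 p α) -
        2 * (partialD 𝒦 p .zero (gen 𝒦 p .zero) * dpMon 𝒦 p α) =
        (-((2 * n + 4 : ℕ) : 𝒦)) • dpMon 𝒦 p α := by
      have hc : ((p - 1 : ℕ) : 𝒦) = -1 := by
        rw [Nat.cast_sub hp1.le, CharP.cast_eq_zero]
        simp
      rw [contactD_apply, hamD_antisymm, hamD_zero, eulerD_zero, partialD_gen, if_pos rfl,
        sub_zero, mul_assoc, gen_mul_partialD_dpMon, eulerD_dpMon]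
      simp only [hτ, hc]
      rw [Finset.sum_const, Finset.card_univ, Fintype.card_fin, two_mul, two_mul]
      simp only [one_mul, neg_zero, add_zero]
      push_cast
      module
    rw [h'] at h
    refine (Submodule.smul_mem_iff N (neg_ne_zero.mpr ?_)).mp h
    rwa [Ne, CharP.cast_eq_zero_iff 𝒦 p]

lemma coe_contactElt [Fact p.Prime] (hp2 : p ≠ 2) {α : Idx n → ℕ} (hα : Admissible p α) :
    ((contactElt 𝒦 p α : contactFull 𝒦 p n) : Derivation 𝒦 (DPAlg 𝒦 p n) (DPAlg 𝒦 p n)) =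
      contactD 𝒦 p (dpMon 𝒦 p α) := by
  rw [contactElt, dif_pos (contactElt_mem 𝒦 hp2 hα)]
  rfl

/-! ### The restricted enveloping algebra and its base change -/

variable (p)

/-- The exponents `ε_0` and `ε_k + ε_{-k}`, for which `D_K(x^{(α)})` is its own `p`-th power. -/
def IsToral (α : Idx n → ℕ) : Prop :=
  α = eps .zero ∨ ∃ i : Fin n, α = eps (.pos i) + eps (.neg i)

/-- The relations of the restricted enveloping algebra: `D_K(x^{(α)}) ^ p = D_K(x^{(α)})` for
`α = ε_0` and `α = ε_k + ε_{-k}`, and `D_K(x^{(α)}) ^ p = 0` for the other exponents. -/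
inductive RestrictedRel (n : ℕ) :
    UniversalEnvelopingAlgebra 𝒦 (ContactAlg 𝒦 p n) →
    UniversalEnvelopingAlgebra 𝒦 (ContactAlg 𝒦 p n) → Prop
  | toral (α : Idx n → ℕ) (hα : Admissible p α) (h : IsToral α) :
      RestrictedRel n (UniversalEnvelopingAlgebra.ι 𝒦 (contactElt 𝒦 p α) ^ p)
        (UniversalEnvelopingAlgebra.ι 𝒦 (contactElt 𝒦 p α))
  | nilpotent (α : Idx n → ℕ) (hα : Admissible p α) (h : ¬ IsToral α) :
      RestrictedRel n (UniversalEnvelopingAlgebra.ι 𝒦 (contactElt 𝒦 p α) ^ p) 0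

variable (n)

/-- The restricted enveloping algebra `u(K(2n+1; 1))`: the quotient of the universal enveloping
algebra of `K(2n+1; 1)` by the two-sided ideal of the relations `RestrictedRel`. -/
abbrev RestrictedEnv : Type _ := RingQuot (RestrictedRel 𝒦 p n)

variable {𝒦}

/-- The ring `𝒦[t]_p^{(q)} = 𝒦[t] / (t ^ p - q t)`. -/
abbrev TruncPoly (q : 𝒦) : Type _ :=
  AdjoinRoot (Polynomial.X ^ p - Polynomial.C q * Polynomial.X : Polynomial 𝒦)

/-- The `𝒦[t]_p^{(q)}`-algebra `u_{t,q}(K(2n+1; 1))`: the restricted enveloping algebra with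
scalars extended from `𝒦` to `𝒦[t]_p^{(q)}`. -/
abbrev QEnv (q : 𝒦) : Type _ := TruncPoly p q ⊗[𝒦] RestrictedEnv 𝒦 p n

variable {n}

/-- The class of `t` in `𝒦[t]_p^{(q)}`. -/
def tVar (q : 𝒦) : TruncPoly p q :=
  AdjoinRoot.root (Polynomial.X ^ p - Polynomial.C q * Polynomial.X : Polynomial 𝒦)

/-- The canonical image of an element of `K(2n+1; 1)` in `u_{t,q}(K(2n+1; 1))`. -/
def toQEnv (q : 𝒦) (y : ContactAlg 𝒦 p n) : QEnv p n q :=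
  1 ⊗ₜ[𝒦] RingQuot.mkAlgHom 𝒦 (RestrictedRel 𝒦 p n) (UniversalEnvelopingAlgebra.ι 𝒦 y)

variable {p}

/-- The divided power `d^{(ℓ)} = (1 / ℓ!) (ad e)^ℓ` of the inner derivation of `e`; it is only
used for `ℓ < p`. -/
def divAd (e : ContactAlg 𝒦 p n) (ℓ : ℕ) (y : ContactAlg 𝒦 p n) : ContactAlg 𝒦 p n :=
  ((ℓ.factorial : 𝒦)⁻¹) • ((LieAlgebra.ad 𝒦 (ContactAlg 𝒦 p n) e) ^ ℓ) y

end Contact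

end Algebra

/-- The rising factorial `x (x + 1) ⋯ (x + m - 1)`. -/
def risingFactorial {A : Type*} [Ring A] (x : A) : ℕ → A
  | 0 => 1
  | m + 1 => risingFactorial x m * (x + (m : A))

/-! ### Hopf algebra structures on a given algebra -/

/-- A Hopf algebra structure on the `R`-algebra `A` with the given product and unit. -/
structure HopfStructure (R A : Type*) [CommRing R] [Ring A] [Algebra R A] where
  /-- The coproduct. -/
  comul : A →ₐ[R] A ⊗[R] A
  /-- The counit. -/
  counit : A →ₐ[R] R
  /-- The antipode. -/
  antipode : A →ₗ[R] A
  coassoc : (Algebra.TensorProduct.assoc R R R A A A).toAlgHom.comp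
      ((Algebra.TensorProduct.map comul (AlgHom.id R A)).comp comul) =
    (Algebra.TensorProduct.map (AlgHom.id R A) comul).comp comul
  counit_left : (Algebra.TensorProduct.map counit (AlgHom.id R A)).comp comul =
    (Algebra.TensorProduct.lid R A).symm
  counit_right : (Algebra.TensorProduct.map (AlgHom.id R A) counit).comp comul =
    (Algebra.TensorProduct.rid R R A).symm
  antipode_left : LinearMap.mul' R A ∘ₗ antipode.rTensor A ∘ₗ comul.toLinearMap =
    Algebra.linearMap R A ∘ₗ counit.toLinearMap
  antipode_right : LinearMap.mul' R A ∘ₗ antipode.lTensor A ∘ₗ comul.toLinearMap =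
    Algebra.linearMap R A ∘ₗ counit.toLinearMap

section Hopf

variable {R A : Type*} [CommRing R] [Ring A] [Algebra R A]

/-- The Hopf algebra in the sense of Mathlib that a Hopf structure defines. -/
abbrev HopfStructure.toHopfAlgebra (H : HopfStructure R A) : HopfAlgebra R A where
  __ := Bialgebra.ofAlgHom H.comul H.counit H.coassoc H.counit_left H.counit_right
  antipode := H.antipode
  mul_antipode_rTensor_comul := H.antipode_left
  mul_antipode_lTensor_comul := H.antipode_right

/-- The underlying algebra is the given one. -/
lemma HopfStructure.toHopfAlgebra_toAlgebra (H : HopfStructure R A) :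
    H.toHopfAlgebra.toAlgebra = (inferInstance : Algebra R A) := rfl

/-- The coproduct is invariant under the flip `a ⊗ b ↦ b ⊗ a`. -/
def HopfStructure.IsCocommutative (H : HopfStructure R A) : Prop :=
  ∀ a : A, TensorProduct.comm R A A (H.comul a) = H.comul a

end Hopf

end ContactHopf

end

/-! Two independent facts carry the theorem: a restricted Poincaré–Birkhoff–Witt theorem, which
gives the dimension and the linear functionals used below, and a Drinfeld twist, which gives the
Hopf structure.

The contact algebra acts faithfully on the divided power algebra, and there the operator
`D_K(x^{(α)})` has `p`-th power equal to itself in the toral cases and zero in all others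
(`contactD_dpMon_pow_of_isToral`, `contactD_dpMon_pow_of_not_isToral`). So the defining relations of
the restricted enveloping algebra hold in a faithful matrix representation, and this suffices for
PBW (`word_linearIndependent_and_span`). Words with multiplicities below `p` span because reordering
costs only shorter words. They are independent because matrices act as invariant vector fields on
the polynomial functions of a matrix `Z`, compatibly with brackets and `p`-th powers; at `Z = 1` the
basis fields are dual to suitable coordinates, so words pair triangularly with monomials in these
coordinates. The number of letters is the dimension of the contact algebra (`contactBasis`): the top
monomial is lost exactly when `p ∣ 2n + 4`, by integration by parts (`topCoeff_bracket`).

The universal property gives the cocommutative structure `Δ₀`, `S₀`, `ε` in which the contact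
algebra is primitive. Since `h ^ p = h`, there are eigenprojections `P i`, `i ∈ ZMod p`, polynomial
in `h` (`exists_isSpectral`). With `z = t e` one has `[h, z] = z` and `z ^ p = 0`, so `g = 1 - z`
satisfies `g ^ p = 1` and may be raised to powers in `ZMod p`. The twist is `F = ∑ P i ⊗ g ^ i`,
formally `(1 ⊗ g) ^ (h ⊗ 1)`; it satisfies the cocycle identity (`comulLeft_comul_F`,
`comulRight_comul_F`), and the new structure is `Δ = F Δ₀ F⁻¹`, `S = w S₀ w⁻¹` with `w = ∑ P i (1 +
z) ^ i`, the image of `F` under `a ⊗ b ↦ a S₀(b)`.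

The stated formulas come from expanding powers of `g` binomially modulo `z ^ p`: conjugation by `g ^
i` becomes a sum of `(ad z) ^ r` with coefficients `i ^ ⟨r⟩ / r!` (`zpow'_conj_left`), and `∑ i ^
⟨r⟩ P i = h ^ ⟨r⟩`. Finally `Δ h = h ⊗ g⁻¹ + 1 ⊗ h` is not symmetric, as PBW coordinates detect
because `t ≠ 0`, and `[h, e] = e ≠ 0`. -/

noncomputable section

namespace ContactHopf

/-! ### Ordered words in algebras generated by a restricted Lie algebra -/

section Words

variable {k B ι : Type*} [Field k] [Ring B] [Algebra k B] (v : ι → B)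

/-- The product of the letters `v i` along a multiset of indices, in a chosen order. -/
def word (s : Multiset ι) : B := (s.toList.map v).prod

/-- The span of the products of at most `m` letters. -/
def wordSpan (k : Type*) {B ι : Type*} [Field k] [Ring B] [Algebra k B] (v : ι → B) (m : ℕ) :
    Submodule k B :=
  Submodule.span k {x | ∃ l : List ι, l.length ≤ m ∧ x = (l.map v).prod}

variable {v}

lemma wordSpan_mono {m m' : ℕ} (h : m ≤ m') : wordSpan k v m ≤ wordSpan k v m' :=
  Submodule.span_mono fun _ ⟨l, hl, hx⟩ => ⟨l, hl.trans h, hx⟩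

lemma prod_mem_wordSpan {l : List ι} {m : ℕ} (h : l.length ≤ m) :
    (l.map v).prod ∈ wordSpan k v m :=
  Submodule.subset_span ⟨l, h, rfl⟩

lemma mul_mem_wordSpan {a b : ℕ} {x y : B} (hx : x ∈ wordSpan k v a) (hy : y ∈ wordSpan k v b) :
    x * y ∈ wordSpan k v (a + b) := by
  refine Submodule.span_induction₂ (p := fun x y _ _ => x * y ∈ wordSpan k v (a + b))
    ?_ ?_ ?_ ?_ ?_ ?_ ?_ hx hy
  · rintro _ _ ⟨l, hl, rfl⟩ ⟨l', hl', rfl⟩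
    rw [← List.prod_append, ← List.map_append]
    exact prod_mem_wordSpan (by rw [List.length_append]; omega)
  · intro y _; rw [zero_mul]; exact zero_mem _
  · intro y _; rw [mul_zero]; exact zero_mem _
  · intro x y z _ _ _ h1 h2; rw [add_mul]; exact add_mem h1 h2
  · intro x y z _ _ _ h1 h2; rw [mul_add]; exact add_mem h1 h2
  · intro r x y _ _ h; rw [smul_mul_assoc]; exact Submodule.smul_mem _ _ h
  · intro r x y _ _ h; rw [mul_smul_comm]; exact Submodule.smul_mem _ _ h

lemma span_range_le_wordSpan : Submodule.span k (Set.range v) ≤ wordSpan k v 1 := by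
  rw [Submodule.span_le]
  rintro _ ⟨i, rfl⟩
  have := prod_mem_wordSpan (k := k) (v := v) (l := [i]) (m := 1) le_rfl
  simpa using this

/-- Swapping two adjacent letters changes a word by a commutator, which is linear in the letters and
hence shortens the word by one; a permutation is a chain of such swaps. -/
lemma perm_sub_mem_wordSpan
    (hcomm : ∀ i j, v i * v j - v j * v i ∈ Submodule.span k (Set.range v))
    {l l' : List ι} (h : l.Perm l') : ∀ m, l.length ≤ m + 1 →
      (l.map v).prod - (l'.map v).prod ∈ wordSpan k v m := by
  induction h with
  | nil => intro m _; rw [sub_self]; exact zero_mem _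
  | cons x hl ih =>
    rename_i l₁ l₂
    intro m hm
    rw [List.map_cons, List.map_cons, List.prod_cons, List.prod_cons, ← mul_sub]
    rcases m with _ | m
    · have h0 : l₁ = [] := List.length_eq_zero_iff.mp (by simpa using hm)
      subst h0
      rw [List.nil_perm.mp hl, sub_self, mul_zero]
      exact zero_mem _
    · have h1 : v x ∈ wordSpan k v 1 :=
        span_range_le_wordSpan (Submodule.subset_span ⟨x, rfl⟩)
      rw [add_comm]
      exact mul_mem_wordSpan h1 (ih m (by simpa using hm))
  | swap x y l =>
    intro m hm
    have h1 := mul_mem_wordSpan (span_range_le_wordSpan (hcomm y x))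
      (prod_mem_wordSpan (k := k) (v := v) (le_refl l.length))
    refine wordSpan_mono (m := 1 + l.length) (by simp at hm; omega) ?_
    simpa [sub_mul, mul_assoc] using h1
  | trans h1 h2 ih1 ih2 =>
    intro m hm
    have := add_mem (ih1 m hm) (ih2 m (h1.length_eq ▸ hm))
    simpa using this

/-- Induction on the length. Modulo shorter words the letters may be permuted: either `p` equal
letters can be collected in front and replaced by a linear expression, which shortens the word, or
the word can be brought to its chosen order. -/
lemma wordSpan_le_span_word {p : ℕ} (hp : 1 < p)
    (hcomm : ∀ i j, v i * v j - v j * v i ∈ Submodule.span k (Set.range v))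
    (hpow : ∀ i, v i ^ p ∈ Submodule.span k (Set.range v)) [DecidableEq ι] (m : ℕ) :
    wordSpan k v m ≤
      Submodule.span k (Set.range fun s : {s : Multiset ι // ∀ i, s.count i < p} => word v s) := by
  induction m with
  | zero =>
    refine Submodule.span_le.mpr ?_
    rintro _ ⟨l, hl, rfl⟩
    have h0 : l = [] := List.length_eq_zero_iff.mp (by simpa using hl)
    subst h0
    refine Submodule.subset_span ⟨⟨0, fun i => ?_⟩, ?_⟩
    · simp; omega
    · simp [word]
  | succ m ih =>
    refine Submodule.span_le.mpr ?_
    rintro _ ⟨l, hl, rfl⟩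
    by_cases h : ∃ i, p ≤ l.count i
    · obtain ⟨i, hi⟩ := h
      have hle : Multiset.replicate p i ≤ (l : Multiset ι) := by
        rw [← Multiset.le_count_iff_replicate_le]
        simpa using hi
      obtain ⟨l', hl'⟩ : ∃ l' : List ι, (l' : Multiset ι) = l - Multiset.replicate p i :=
        ⟨_, Multiset.coe_toList _⟩
      have hperm : l.Perm (List.replicate p i ++ l') := by
        rw [← Multiset.coe_eq_coe, ← Multiset.coe_add, hl', Multiset.coe_replicate,
          add_tsub_cancel_of_le hle]
      have hlen : l.length = p + l'.length := by
        rw [hperm.length_eq, List.length_append, List.length_replicate]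
      refine ih ?_
      have h1 := perm_sub_mem_wordSpan hcomm hperm m hl
      have h2 : ((List.replicate p i ++ l').map v).prod ∈ wordSpan k v m := by
        rw [List.map_append, List.prod_append, List.map_replicate, List.prod_replicate]
        exact wordSpan_mono (by omega) (mul_mem_wordSpan (span_range_le_wordSpan (hpow i))
          (prod_mem_wordSpan (le_refl l'.length)))
      simpa using add_mem h1 h2
    · push Not at h
      have hperm : l.Perm (l : Multiset ι).toList := by
        rw [← Multiset.coe_eq_coe, Multiset.coe_toList]
      have h1 := ih (perm_sub_mem_wordSpan hcomm hperm m hl)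
      have h2 : ((l : Multiset ι).toList.map v).prod ∈ Submodule.span k (Set.range fun
          s : {s : Multiset ι // ∀ i, s.count i < p} => word v s) :=
        Submodule.subset_span ⟨⟨l, fun i => by simpa using h i⟩, rfl⟩
      simpa using add_mem h1 h2

/-- In an algebra generated by letters whose commutators and `p`-th powers are linear in the
letters, the words with all multiplicities below `p` span. -/
theorem span_word_eq_top {p : ℕ} (hp : 1 < p)
    (hcomm : ∀ i j, v i * v j - v j * v i ∈ Submodule.span k (Set.range v))
    (hpow : ∀ i, v i ^ p ∈ Submodule.span k (Set.range v)) [DecidableEq ι]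
    (hgen : Algebra.adjoin k (Set.range v) = ⊤) :
    Submodule.span k (Set.range fun s : {s : Multiset ι // ∀ i, s.count i < p} => word v s) =
      ⊤ := by
  rw [eq_top_iff]
  intro x _
  have hx : x ∈ Algebra.adjoin k (Set.range v) := by rw [hgen]; trivial
  obtain ⟨m, hm⟩ : ∃ m, x ∈ wordSpan k v m := by
    induction hx using Algebra.adjoin_induction with
    | mem x hx => exact ⟨1, span_range_le_wordSpan (Submodule.subset_span hx)⟩
    | algebraMap r =>
      refine ⟨0, ?_⟩
      rw [Algebra.algebraMap_eq_smul_one]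
      exact Submodule.smul_mem _ _ (prod_mem_wordSpan (l := []) le_rfl)
    | add x y _ _ hx hy =>
      obtain ⟨a, ha⟩ := hx trivial
      obtain ⟨b, hb⟩ := hy trivial
      exact ⟨a + b, add_mem (wordSpan_mono (by omega) ha) (wordSpan_mono (by omega) hb)⟩
    | mul x y _ _ hx hy =>
      obtain ⟨a, ha⟩ := hx trivial
      obtain ⟨b, hb⟩ := hy trivial
      exact ⟨a + b, mul_mem_wordSpan ha hb⟩
  exact wordSpan_le_span_word hp hcomm hpow m hm

end Words

/-! ### Independence of words acting by derivations near a point -/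

section Independence

variable {k C ι : Type*} [Field k] [CommRing C] [Algebra k C]

/-- Apply a list of derivations to an element, the last one first. -/
def applyWord (D : ι → Derivation k C C) (l : List ι) (x : C) : C :=
  l.foldr (fun i y => D i y) x

variable {D : ι → Derivation k C C}

lemma applyWord_add (l : List ι) (x y : C) :
    applyWord D l (x + y) = applyWord D l x + applyWord D l y := by
  induction l with
  | nil => rfl
  | cons a l ih => simp only [applyWord, List.foldr_cons] at ih ⊢; rw [ih, map_add]

lemma applyWord_nsmul (l : List ι) (m : ℕ) (x : C) :
    applyWord D l (m • x) = m • applyWord D l x := by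
  induction l with
  | nil => rfl
  | cons a l ih => simp only [applyWord, List.foldr_cons] at ih ⊢; rw [ih, map_nsmul]

lemma applyWord_append_singleton (l : List ι) (a : ι) (x : C) :
    applyWord D (l ++ [a]) x = applyWord D l (D a x) := by
  simp [applyWord]

lemma derivation_mem_pow (E : Derivation k C C) (I : Ideal C) (m : ℕ) {x : C}
    (hx : x ∈ I ^ (m + 1)) : E x ∈ I ^ m := by
  induction m generalizing x with
  | zero => simp
  | succ m ih =>
    rw [pow_succ] at hx
    refine Submodule.mul_induction_on hx ?_ ?_
    · intro a ha b hb
      rw [Derivation.leibniz]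
      refine add_mem ?_ ?_
      · exact Ideal.mul_mem_right _ _ ha
      · rw [smul_eq_mul, mul_comm, pow_succ]
        exact Ideal.mul_mem_mul (ih ha) hb
    · intro a b ha hb
      rw [map_add]
      exact add_mem ha hb

lemma applyWord_mem (I : Ideal C) (l : List ι) (m : ℕ) {x : C} (hx : x ∈ I ^ (l.length + m)) :
    applyWord D l x ∈ I ^ m := by
  induction l generalizing m with
  | nil => simpa [applyWord] using hx
  | cons a l ih =>
    refine derivation_mem_pow _ _ _ (ih (m + 1) ?_)
    rw [List.length_cons] at hx
    rwa [show l.length + (m + 1) = l.length + 1 + m by omega]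

lemma map_prod_mem_pow {I : Ideal C} {φ : ι → C} (hφ : ∀ i, φ i ∈ I) (s : Multiset ι) :
    (s.map φ).prod ∈ I ^ s.card := by
  induction s using Multiset.induction_on with
  | empty => simp
  | cons a s ih =>
    rw [Multiset.map_cons, Multiset.prod_cons, Multiset.card_cons, pow_succ']
    exact Ideal.mul_mem_mul (hφ a) ih

variable {p : ℕ} [CharP k p] {ev : C →ₐ[k] k} {φ : ι → C}

lemma ev_applyWord_eq_zero_of_lt (hφ : ∀ i, ev (φ i) = 0) {l : List ι} {s : Multiset ι}
    (h : l.length < s.card) : ev (applyWord D l (s.map φ).prod) = 0 := by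
  have h1 := applyWord_mem (D := D) (RingHom.ker ev) l 1 (x := (s.map φ).prod)
    (Ideal.pow_le_pow_right h (map_prod_mem_pow (I := RingHom.ker ev) hφ s))
  rwa [pow_one] at h1

variable [DecidableEq ι]

/-- To leading order at the point, `D a` acts on monomials in the local parameters as the partial
derivative with respect to `φ a`; the error vanishes to one order more than the main term. -/
lemma derivation_map_prod_sub_mem {I : Ideal C} (hφ : ∀ i, φ i ∈ I)
    (hD : ∀ i j, D i (φ j) - (if i = j then 1 else 0) ∈ I) (a : ι) (s : Multiset ι) :
    D a (s.map φ).prod - s.count a • ((s.erase a).map φ).prod ∈ I ^ s.card := by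
  induction s using Multiset.induction_on with
  | empty => simp
  | cons b s ih =>
    have h1 : φ b * (D a (s.map φ).prod - s.count a • ((s.erase a).map φ).prod) ∈
        I ^ (s.card + 1) := by
      rw [pow_succ']
      exact Ideal.mul_mem_mul (hφ b) ih
    have h2 : (s.map φ).prod * (D a (φ b) - (if a = b then 1 else 0)) ∈ I ^ (s.card + 1) := by
      rw [pow_succ]
      exact Ideal.mul_mem_mul (map_prod_mem_pow hφ s) (hD a b)
    rw [Multiset.map_cons, Multiset.prod_cons, Multiset.card_cons, Derivation.leibniz]
    refine (congrArg (· ∈ I ^ (s.card + 1)) ?_).mp (add_mem h1 h2)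
    by_cases hab : a = b
    · subst hab
      rw [Multiset.erase_cons_head, Multiset.count_cons_self, if_pos rfl]
      have h3 : s.count a • (φ a * ((s.erase a).map φ).prod) = s.count a • (s.map φ).prod := by
        by_cases ha : a ∈ s
        · rw [← Multiset.prod_cons, ← Multiset.map_cons, Multiset.cons_erase ha]
        · rw [Multiset.count_eq_zero_of_notMem ha, zero_smul, zero_smul]
      simp only [nsmul_eq_mul, smul_eq_mul] at h3 ⊢
      push_cast
      linear_combination -h3
    · rw [Multiset.erase_cons_tail _ (Ne.symm hab), Multiset.count_cons_of_ne hab, if_neg hab,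
        Multiset.map_cons, Multiset.prod_cons]
      simp only [nsmul_eq_mul, smul_eq_mul]
      ring

/-- In equal degree only the leading terms survive evaluation, so the word acts as an iterated
partial derivative. The value for matching exponents is a product of factorials of numbers below
`p`, hence nonzero in characteristic `p`. -/
lemma ev_applyWord_ne_zero_iff (hφ : ∀ i, ev (φ i) = 0)
    (hD : ∀ i j, ev (D i (φ j)) = if i = j then 1 else 0) (l : List ι) (s : Multiset ι)
    (hs : ∀ i, s.count i < p) (h : l.length = s.card) :
    ev (applyWord D l (s.map φ).prod) ≠ 0 ↔ (l : Multiset ι) = s := by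
  induction l using List.reverseRecOn generalizing s with
  | nil =>
    have : s = 0 := Multiset.card_eq_zero.mp h.symm
    subst this
    simp [applyWord]
  | append_singleton l a ih =>
    have hD' : ∀ i j, D i (φ j) - (if i = j then 1 else 0) ∈ RingHom.ker ev := by
      intro i j
      rw [RingHom.mem_ker, map_sub, hD]
      split_ifs <;> simp
    have h1 := derivation_map_prod_sub_mem (I := RingHom.ker ev) hφ hD' a s
    rw [List.length_append, List.length_singleton] at h
    rw [← h] at h1
    have h2 := applyWord_mem (D := D) (RingHom.ker ev) l 1 h1
    rw [pow_one, RingHom.mem_ker] at h2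
    have h3 : ev (applyWord D l (D a (s.map φ).prod)) =
        (s.count a : k) * ev (applyWord D l (((s.erase a).map φ).prod)) := by
      rw [← sub_add_cancel (D a (s.map φ).prod) (s.count a • ((s.erase a).map φ).prod),
        applyWord_add, map_add, h2, applyWord_nsmul, map_nsmul, nsmul_eq_mul, zero_add]
    rw [applyWord_append_singleton, h3]
    by_cases ha : a ∈ s
    · have hc : (s.count a : k) ≠ 0 := by
        rw [Ne, CharP.cast_eq_zero_iff k p]
        exact fun hd => absurd (Nat.le_of_dvd (Multiset.count_pos.mpr ha) hd) (not_le.mpr (hs a))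
      rw [mul_ne_zero_iff, and_iff_right hc, ih (s.erase a)
        (fun i => (Multiset.count_le_of_le i (Multiset.erase_le a s)).trans_lt (hs i))
        (by rw [Multiset.card_erase_of_mem ha, ← h]; rfl)]
      constructor
      · intro hl
        rw [← Multiset.coe_add, hl, Multiset.coe_singleton, add_comm, Multiset.singleton_add,
          Multiset.cons_erase ha]
      · intro hl
        rw [← hl, ← Multiset.coe_add, Multiset.coe_singleton, add_comm, Multiset.singleton_add,
          Multiset.erase_cons_head]
    · rw [Multiset.count_eq_zero_of_notMem ha, Nat.cast_zero, zero_mul]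
      refine iff_of_false (by simp) ?_
      rintro rfl
      exact ha (by simp)

/-- If the letters act by derivations that are dual to local parameters `φ i` at a point `ev`,
then the words with all multiplicities below `p` are linearly independent. -/
theorem linearIndependent_word {B : Type*} [Ring B] [Algebra k B] {v : ι → B}
    (Φ : B →ₐ[k] Module.End k C) (hΦ : ∀ i x, Φ (v i) x = D i x) (hφ : ∀ i, ev (φ i) = 0)
    (hD : ∀ i j, ev (D i (φ j)) = if i = j then 1 else 0) :
    LinearIndependent k (fun s : {s : Multiset ι // ∀ i, s.count i < p} => word v s) := by
  have hword (l : List ι) (x : C) : Φ ((l.map v).prod) x = applyWord D l x := by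
    induction l with
    | nil => simp [applyWord]
    | cons a l ih =>
      rw [List.map_cons, List.prod_cons, map_mul, Module.End.mul_apply, ih, hΦ]
      rfl
  classical
  rw [linearIndependent_iff']
  intro S g hg
  by_contra! hne
  obtain ⟨s₀, hs₀, hgs₀⟩ := hne
  -- Test the relation on the monomial of a longest word with nonzero coefficient: shorter words
  -- give zero there, and so do the other words of the same length.
  obtain ⟨s, hs, hmax⟩ := Finset.exists_max_image (S.filter fun s => g s ≠ 0)
    (fun s => s.1.card) ⟨s₀, by simp [hs₀, hgs₀]⟩
  rw [Finset.mem_filter] at hs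
  have h1 : ∑ s' ∈ S, g s' * ev (applyWord D s'.1.toList (s.1.map φ).prod) = 0 := by
    have h2 := congrArg (fun b => ev (Φ b (s.1.map φ).prod)) hg
    simpa [word, hword] using h2
  rw [Finset.sum_eq_single_of_mem s hs.1] at h1
  · rcases mul_eq_zero.mp h1 with h2 | h2
    · exact hs.2 h2
    · exact (ev_applyWord_ne_zero_iff hφ hD _ s.1 s.2 (by simp)).mpr (by simp) h2
  · intro s' hs' hne
    by_cases hg' : g s' = 0
    · rw [hg', zero_mul]
    · have hle := hmax s' (by simp [hs', hg'])
      rcases hle.lt_or_eq with hlt | heq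
      · rw [ev_applyWord_eq_zero_of_lt hφ (by simpa using hlt), mul_zero]
      · by_contra h3
        have h4 := (ev_applyWord_ne_zero_iff hφ hD _ s.1 s.2 (by simpa using heq)).mp
          (right_ne_zero_of_mul h3)
        rw [Multiset.coe_toList] at h4
        exact hne (Subtype.ext h4)

end Independence

/-! ### Bounded multisets, and `p`-th powers of derivations -/

/-- The multisets with multiplicities below `p`, as functions. -/
def boundedMultisetEquiv (ι : Type*) [Fintype ι] [DecidableEq ι] (p : ℕ) :
    {s : Multiset ι // ∀ i, s.count i < p} ≃ (ι → Fin p) where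
  toFun s i := ⟨s.1.count i, s.2 i⟩
  invFun a := ⟨∑ i, Multiset.replicate (a i) i, fun i => by
    rw [Multiset.count_sum']
    simp [Multiset.count_replicate]⟩
  left_inv s := by
    ext i
    simp [Multiset.count_sum', Multiset.count_replicate]
  right_inv a := by
    ext i
    simp [Multiset.count_sum', Multiset.count_replicate]

/-- In characteristic `p` the `p`-th power of a derivation is a derivation. -/
lemma exists_derivation_pow_char {k A : Type*} [Field k] [CommRing A] [Algebra k A] (p : ℕ)
    [Fact p.Prime] [CharP k p] (D : Derivation k A A) :
    ∃ E : Derivation k A A, ∀ a, E a = ((D : A →ₗ[k] A) ^ p) a := by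
  have hE : CharP (Module.End k (Module.End k A)) p ∨ Subsingleton A := by
    rcases subsingleton_or_nontrivial A with h | h
    · exact Or.inr h
    · have : Nontrivial (Module.End k (Module.End k A)) := by
        have h1 : Nontrivial (Module.End k A) := inferInstance
        infer_instance
      exact Or.inl (charP_of_injective_algebraMap
        (algebraMap k (Module.End k (Module.End k A))).injective p)
  rcases hE with hE | hE
  · set T : Module.End k A := (D : A →ₗ[k] A) with hT
    -- Left and right multiplication by `T` commute, so `(ad T) ^ p = ad (T ^ p)`. Since `ad T`
    -- sends multiplication by `a` to multiplication by `T a`, the same holds with `T ^ p` in place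
    -- of `T`, and that is the Leibniz rule.
    have h0 := sub_pow_char_of_commute (R := Module.End k (Module.End k A)) p
      (LinearMap.commute_mulLeft_right (R := k) (A := Module.End k A) T T)
    have h1 (m : ℕ) (a : A) : ((LinearMap.mulLeft k T - LinearMap.mulRight k T) ^ m)
        (LinearMap.mulLeft k a) = LinearMap.mulLeft k ((T ^ m) a) := by
      induction m with
      | zero => simp
      | succ m ih =>
        rw [pow_succ', Module.End.mul_apply, ih, pow_succ', Module.End.mul_apply]
        ext b
        simp [hT, Module.End.mul_apply, mul_comm]
    have h2 (a b : A) : (T ^ p) (a * b) = a * (T ^ p) b + b * (T ^ p) a := by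
      have h3 := h1 p a
      rw [h0, LinearMap.pow_mulLeft, LinearMap.pow_mulRight] at h3
      have h4 := LinearMap.congr_fun h3 b
      simp only [LinearMap.sub_apply, LinearMap.mulLeft_apply, LinearMap.mulRight_apply,
        Module.End.mul_apply] at h4
      linear_combination h4
    exact ⟨Derivation.mk' (T ^ p) h2, fun a => rfl⟩
  · exact ⟨0, fun a => Subsingleton.elim _ _⟩

/-! ### Invariant vector fields on matrices and the restricted PBW theorem -/

section MatrixCoordinates

variable {k L J ι : Type*} [Field k] [LieRing L] [LieAlgebra k L] [Fintype J]

/-- The derivation of the coordinate ring of the `J × J` matrices `Z` with `Z ↦ Z * M`. -/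
def matrixDer (M : Matrix J J k) : Derivation k (MvPolynomial (J × J) k) (MvPolynomial (J × J) k) :=
  MvPolynomial.mkDerivation k fun ij => ∑ d, M d ij.2 • MvPolynomial.X (ij.1, d)

lemma matrixDer_X (M : Matrix J J k) (i j : J) :
    matrixDer M (MvPolynomial.X (i, j)) = ∑ d, M d j • MvPolynomial.X (i, d) := by
  rw [matrixDer, MvPolynomial.mkDerivation_X]

lemma matrixDer_matrixDer_X (M N : Matrix J J k) (i j : J) :
    matrixDer M (matrixDer N (MvPolynomial.X (i, j))) =
      ∑ d, (M * N) d j • MvPolynomial.X (i, d) := by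
  simp only [matrixDer_X, map_sum, Derivation.map_smul, Finset.smul_sum, smul_smul,
    Matrix.mul_apply, Finset.sum_smul]
  rw [Finset.sum_comm]
  exact Finset.sum_congr rfl fun _ _ => Finset.sum_congr rfl fun _ _ => by rw [mul_comm]

lemma matrixDer_add (M N : Matrix J J k) : matrixDer (M + N) = matrixDer M + matrixDer N := by
  refine MvPolynomial.derivation_ext fun ⟨i, j⟩ => ?_
  simp [matrixDer_X, add_smul, Finset.sum_add_distrib]

lemma matrixDer_smul (c : k) (M : Matrix J J k) : matrixDer (c • M) = c • matrixDer M := by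
  refine MvPolynomial.derivation_ext fun ⟨i, j⟩ => ?_
  simp [matrixDer_X, Finset.smul_sum, smul_smul]

lemma matrixDer_commutator (M N : Matrix J J k) (x : MvPolynomial (J × J) k) :
    matrixDer (M * N - N * M) x = matrixDer M (matrixDer N x) - matrixDer N (matrixDer M x) := by
  have h : matrixDer (M * N - N * M) = ⁅matrixDer M, matrixDer N⁆ := by
    refine MvPolynomial.derivation_ext fun ⟨i, j⟩ => ?_
    rw [Derivation.commutator_apply, matrixDer_matrixDer_X, matrixDer_matrixDer_X, matrixDer_X]
    simp [sub_smul, Finset.sum_sub_distrib]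
  rw [h, Derivation.commutator_apply]

variable [DecidableEq J]

lemma matrixDer_pow_X (M : Matrix J J k) (m : ℕ) (i j : J) :
    ((matrixDer M : MvPolynomial (J × J) k →ₗ[k] MvPolynomial (J × J) k) ^ m)
      (MvPolynomial.X (i, j)) = ∑ d, (M ^ m) d j • MvPolynomial.X (i, d) := by
  induction m with
  | zero => simp [Matrix.one_apply]
  | succ m ih =>
    rw [pow_succ', Module.End.mul_apply, ih, pow_succ']
    simp only [Derivation.coeFn_coe, matrixDer_X, map_sum, Derivation.map_smul, Finset.smul_sum,
      smul_smul, Matrix.mul_apply, Finset.sum_smul]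
    rw [Finset.sum_comm]
    exact Finset.sum_congr rfl fun _ _ => Finset.sum_congr rfl fun _ _ => by rw [mul_comm]

/-- Both sides are derivations, and on the coordinate functions the field acts linearly, so the
comparison reduces to a power of `M`. -/
lemma matrixDer_pow_char (p : ℕ) [Fact p.Prime] [CharP k p] (M : Matrix J J k) :
    (matrixDer M : MvPolynomial (J × J) k →ₗ[k] MvPolynomial (J × J) k) ^ p =
      matrixDer (M ^ p) := by
  obtain ⟨E, hE⟩ := exists_derivation_pow_char p (matrixDer M)
  have h : E = matrixDer (M ^ p) := by
    refine MvPolynomial.derivation_ext fun ⟨i, j⟩ => ?_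
    rw [hE, matrixDer_pow_X, matrixDer_X]
  refine LinearMap.ext fun x => ?_
  rw [← hE, h]
  rfl

variable (k J) in
/-- Evaluation at the identity matrix. -/
def evalOne : MvPolynomial (J × J) k →ₐ[k] k :=
  MvPolynomial.aeval fun ij => (1 : Matrix J J k) ij.1 ij.2

/-- The function `Z ↦ λ(Z - 1)` on matrices. -/
def matrixCoord (l : Matrix J J k →ₗ[k] k) : MvPolynomial (J × J) k :=
  ∑ i, ∑ j, l (Matrix.single i j 1) • MvPolynomial.X (i, j) - MvPolynomial.C (l 1)

lemma map_eq_sum_single (l : Matrix J J k →ₗ[k] k) (M : Matrix J J k) :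
    l M = ∑ i, ∑ j, l (Matrix.single i j 1) * M i j := by
  conv_lhs => rw [Matrix.matrix_eq_sum_single M]
  simp only [map_sum]
  refine Finset.sum_congr rfl fun i _ => Finset.sum_congr rfl fun j _ => ?_
  rw [← mul_one (M i j), ← smul_eq_mul, ← Matrix.smul_single, map_smul, smul_eq_mul, smul_eq_mul,
    mul_one, mul_comm]

lemma evalOne_matrixCoord (l : Matrix J J k →ₗ[k] k) : evalOne k J (matrixCoord l) = 0 := by
  rw [matrixCoord, map_sub, map_eq_sum_single l 1]
  simp [evalOne]

lemma evalOne_matrixDer_matrixCoord (M : Matrix J J k) (l : Matrix J J k →ₗ[k] k) :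
    evalOne k J (matrixDer M (matrixCoord l)) = l M := by
  rw [matrixCoord, map_sub, map_eq_sum_single l M]
  simp [evalOne, matrixDer_X, Matrix.one_apply]

/-- Restricted Poincaré–Birkhoff–Witt: let `L` have a faithful matrix representation `ρ` in which
`ρ (b i) ^ p = ρ (c i)`. Then in the universal algebra `B` generated by `L` with
`(b i) ^ p = c i`, the words in the basis `b` with all multiplicities below `p` form a basis. -/
theorem word_linearIndependent_and_span [DecidableEq ι] {p : ℕ} [Fact p.Prime] [CharP k p]
    (b : Module.Basis ι k L) (c : ι → L) (ρ : L →ₗ[k] Matrix J J k) (hρ : Function.Injective ρ)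
    (hρl : ∀ x y, ρ ⁅x, y⁆ = ρ x * ρ y - ρ y * ρ x) (hρp : ∀ i, ρ (b i) ^ p = ρ (c i))
    {B : Type*} [Ring B] [Algebra k B] (v : L →ₗ[k] B)
    (hv : ∀ x y, v ⁅x, y⁆ = v x * v y - v y * v x) (hvp : ∀ i, v (b i) ^ p = v (c i))
    (hgen : Algebra.adjoin k (Set.range v) = ⊤)
    (huniv : ∀ f : L →ₗ[k] Module.End k (MvPolynomial (J × J) k),
      (∀ x y, f ⁅x, y⁆ = f x * f y - f y * f x) → (∀ i, f (b i) ^ p = f (c i)) →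
      ∃ Φ : B →ₐ[k] Module.End k (MvPolynomial (J × J) k), ∀ x, Φ (v x) = f x) :
    LinearIndependent k
      (fun s : {s : Multiset ι // ∀ i, s.count i < p} => word (fun i => v (b i)) s) ∧
    Submodule.span k (Set.range fun s : {s : Multiset ι // ∀ i, s.count i < p} =>
      word (fun i => v (b i)) s) = ⊤ := by
  have hmem (x : L) : v x ∈ Submodule.span k (Set.range fun i => v (b i)) := by
    have h : Submodule.map v (Submodule.span k (Set.range b)) =
        Submodule.span k (Set.range fun i => v (b i)) := by
      rw [Submodule.map_span, ← Set.range_comp]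
      rfl
    rw [← h, b.span_eq]
    exact Submodule.mem_map_of_mem trivial
  constructor
  -- A left inverse of `ρ` extends the coordinate functionals of `b` to all matrices; these linear
  -- functions of `Z - 1` are the local parameters dual to the fields of the `ρ (b i)` at the
  -- identity.
  · obtain ⟨ψ, hψ⟩ := LinearMap.exists_leftInverse_of_injective ρ (LinearMap.ker_eq_bot.mpr hρ)
    let f : L →ₗ[k] Module.End k (MvPolynomial (J × J) k) :=
      { toFun x := matrixDer (ρ x)
        map_add' x y := by rw [map_add, matrixDer_add]; rfl
        map_smul' r x := by rw [map_smul, matrixDer_smul]; rfl }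
    obtain ⟨Φ, hΦ⟩ := huniv f
      (fun x y => LinearMap.ext fun a => by
        simp only [f, LinearMap.coe_mk, AddHom.coe_mk, hρl, Derivation.coeFn_coe,
          matrixDer_commutator, LinearMap.sub_apply, Module.End.mul_apply])
      (fun i => by
        simp only [f, LinearMap.coe_mk, AddHom.coe_mk, matrixDer_pow_char, hρp])
    refine linearIndependent_word (D := fun i => matrixDer (ρ (b i))) (ev := evalOne k J)
      (φ := fun i => matrixCoord (b.coord i ∘ₗ ψ)) Φ (fun i x => by rw [hΦ]; rfl)
      (fun i => evalOne_matrixCoord _) (fun i j => ?_)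
    rw [evalOne_matrixDer_matrixCoord, LinearMap.comp_apply]
    have h1 : ψ (ρ (b i)) = b i := LinearMap.congr_fun hψ (b i)
    rw [h1, Module.Basis.coord_apply, Module.Basis.repr_self, Finsupp.single_apply]
  · refine span_word_eq_top (Fact.out : p.Prime).one_lt (fun i j => ?_) (fun i => ?_) ?_
    · rw [← hv]; exact hmem _
    · rw [hvp]; exact hmem _
    · rw [eq_top_iff, ← hgen]
      refine Algebra.adjoin_le ?_
      rintro _ ⟨x, rfl⟩
      exact Algebra.span_le_adjoin _ _ (hmem x)

end MatrixCoordinates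

/-! ### Nilpotency of the operators `D_K(f)`: repeated and unpaired variables -/

section NilpotentAndToral

variable {𝒦 : Type*} [Field 𝒦] {p n : ℕ} [hp : Fact p.Prime] [CharP 𝒦 p]

/-- Iterates of a derivation on an eigenvector up to a square-scaling function `u`. -/
lemma derivation_iterate_eq {A : Type*} [CommRing A] [Algebra 𝒦 A] (D : Derivation 𝒦 A A)
    {y u : A} {a c : ℤ} (hy : D y = a * y * u) (hu : D u = c * u ^ 2) (m : ℕ) :
    ((D : A →ₗ[𝒦] A) ^ m) y = (∏ j ∈ range m, ((a + j * c : ℤ) : A)) * (y * u ^ m) := by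
  induction m with
  | zero => simp
  | succ m ih =>
    have h0 : D (∏ j ∈ range m, ((a + j * c : ℤ) : A)) = 0 := by
      rw [← Int.cast_prod, Derivation.map_intCast]
    rw [pow_succ', Module.End.mul_apply, ih, Finset.prod_range_succ, Derivation.coeFn_coe,
      Derivation.leibniz, Derivation.leibniz, Derivation.leibniz_pow, hy, hu, h0]
    rcases m with _ | m
    · simp; ring
    · simp only [smul_eq_mul, nsmul_eq_mul, Nat.add_sub_cancel]
      push_cast
      ring

/-- Pulling `y` out turns `D` into `T + W` with `T = D + a u` and `W` multiplication by `w`. They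
commute as `D w = 0`, so the `p`-th power splits; `T ^ p` sends `1` to a multiple of `u ^ p = 0`,
and `W ^ p = 0`. -/
lemma derivation_pow_eq_zero {A : Type*} [CommRing A] [Algebra 𝒦 A] (D : Derivation 𝒦 A A)
    {y u w : A} {a c : ℤ} (hy : D y = y * (a * u + w)) (hu : D u = c * u ^ 2) (hw : D w = 0)
    (hup : u ^ p = 0) (hwp : w ^ p = 0) : ((D : A →ₗ[𝒦] A) ^ p) y = 0 := by
  rcases subsingleton_or_nontrivial A with hA | hA
  · exact Subsingleton.elim _ _
  have : CharP (Module.End 𝒦 A) p :=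
    charP_of_injective_algebraMap (algebraMap 𝒦 (Module.End 𝒦 A)).injective p
  set T : Module.End 𝒦 A := (D : A →ₗ[𝒦] A) + LinearMap.mulLeft 𝒦 (a * u) with hT
  set W : Module.End 𝒦 A := LinearMap.mulLeft 𝒦 w with hW
  have hcomm : Commute T W := by
    refine LinearMap.ext fun b => ?_
    simp [hT, hW, Derivation.leibniz, hw]
    ring
  have h1 (m : ℕ) (b : A) : ((D : A →ₗ[𝒦] A) ^ m) (y * b) = y * ((T + W) ^ m) b := by
    induction m generalizing b with
    | zero => simp
    | succ m ih =>
      rw [pow_succ, pow_succ, Module.End.mul_apply, Module.End.mul_apply, ← ih]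
      congr 1
      simp [hT, hW, Derivation.leibniz, hy]
      ring
  have h2 (m : ℕ) : ∃ C : ℤ, (T ^ m) 1 = C * u ^ m := by
    induction m with
    | zero => exact ⟨1, by simp⟩
    | succ m ih =>
      obtain ⟨C, hC⟩ := ih
      refine ⟨C * (a + m * c), ?_⟩
      rw [pow_succ', Module.End.mul_apply, hC]
      rcases m with _ | m
      · simp [hT]; ring
      · simp [hT, Derivation.leibniz, Derivation.leibniz_pow, hu]
        ring
  obtain ⟨C, hC⟩ := h2 p
  have h3 := h1 p 1
  rw [mul_one] at h3
  rw [h3, add_pow_char_of_commute p hcomm, LinearMap.add_apply, hC, hup, hW,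
    LinearMap.pow_mulLeft, LinearMap.mulLeft_apply, hwp]
  simp

/-- As `D ^ p` is itself a derivation, generators suffice. -/
lemma derivation_pow_char_eq {D E : Derivation 𝒦 (DPAlg 𝒦 p n) (DPAlg 𝒦 p n)}
    (h : ∀ j, ((D : DPAlg 𝒦 p n →ₗ[𝒦] DPAlg 𝒦 p n) ^ p) (gen 𝒦 p j) = E (gen 𝒦 p j)) :
    (D : DPAlg 𝒦 p n →ₗ[𝒦] DPAlg 𝒦 p n) ^ p = E := by
  obtain ⟨E', hE'⟩ := exists_derivation_pow_char p D
  have h1 : E' = E := der_ext fun j => by rw [hE', h]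
  refine LinearMap.ext fun x => ?_
  rw [← hE', h1]
  rfl

-- If the square of a variable `y` divides `f`, then `D` maps everything into multiples of `y`, and
-- `D y` is a multiple of `y ^ 2`. So every application of `D` raises the divisibility by `y`, and
-- `y ^ p = 0`.
omit hp in
lemma contactD_pow_of_sq (i : Idx n) (f' : DPAlg 𝒦 p n) :
    (contactD 𝒦 p (gen 𝒦 p i ^ 2 * f') : DPAlg 𝒦 p n →ₗ[𝒦] DPAlg 𝒦 p n) ^ p = 0 := by
  set y := gen 𝒦 p i with hy
  set f := y ^ 2 * f' with hf
  set D := contactD 𝒦 p f with hD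
  have h1 (E : Derivation 𝒦 (DPAlg 𝒦 p n) (DPAlg 𝒦 p n)) : y ∣ E f := by
    refine ⟨y * E f' + 2 * f' * E y, ?_⟩
    rw [hf, Derivation.leibniz, Derivation.leibniz_pow]
    simp only [smul_eq_mul, nsmul_eq_mul]
    push_cast
    ring
  have h0 : y ∣ f := ⟨y * f', by rw [hf]; ring⟩
  have h2 (a : DPAlg 𝒦 p n) : y ∣ D a := by
    rw [hD, contactD_apply, hamD_antisymm]
    exact dvd_add (dvd_add (Dvd.dvd.mul_right (dvd_sub (h0.mul_left _) (h1 _)) _)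
      ((h1 _).mul_right _)) (dvd_neg.mpr (h1 _))
  have h3 (E : Derivation 𝒦 (DPAlg 𝒦 p n) (DPAlg 𝒦 p n)) (hE : E y = 0) : y ^ 2 ∣ E f := by
    refine ⟨E f', ?_⟩
    rw [hf, Derivation.leibniz, Derivation.leibniz_pow, hE]
    simp
  have h4 : y ^ 2 ∣ D y := by
    have hf2 : y ^ 2 ∣ f := ⟨f', rfl⟩
    rcases i with _ | i | i
    · rw [hD, hy, contactD_gen_zero]
      exact dvd_sub (hf2.mul_left _) (h3 _ (eulerD_zero))
    · rw [hD, hy, contactD_gen_pos]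
      refine dvd_add ?_ (h3 _ (by rw [hy, partialD_gen]; simp))
      exact Dvd.dvd.mul_left (h3 _ (by rw [hy, partialD_gen]; simp)) _
    · rw [hD, hy, contactD_gen_neg]
      refine dvd_sub ?_ (h3 _ (by rw [hy, partialD_gen]; simp))
      exact Dvd.dvd.mul_left (h3 _ (by rw [hy, partialD_gen]; simp)) _
  have h5 (m : ℕ) (a : DPAlg 𝒦 p n) :
      y ^ m ∣ ((D : DPAlg 𝒦 p n →ₗ[𝒦] DPAlg 𝒦 p n) ^ m) a := by
    induction m with
    | zero => simp
    | succ m ih =>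
      obtain ⟨b, hb⟩ := ih
      rw [pow_succ' (D : DPAlg 𝒦 p n →ₗ[𝒦] DPAlg 𝒦 p n), Module.End.mul_apply, hb,
        Derivation.coeFn_coe, Derivation.leibniz, Derivation.leibniz_pow]
      refine dvd_add ?_ ?_
      · rw [smul_eq_mul, pow_succ]
        exact mul_dvd_mul_left _ (h2 b)
      · rcases m with _ | m
        · simp
        · obtain ⟨d, hd⟩ := h4
          refine ⟨b * ((m + 1 : ℕ) : DPAlg 𝒦 p n) * d, ?_⟩
          rw [hd]
          simp only [smul_eq_mul, nsmul_eq_mul, Nat.add_sub_cancel]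
          ring
  refine LinearMap.ext fun a => ?_
  obtain ⟨b, hb⟩ := h5 p a
  rw [hb, hy, gen_pow_p, zero_mul]
  rfl

omit hp

lemma hamD_self (f : DPAlg 𝒦 p n) : hamD 𝒦 p f f = 0 := by
  rw [hamD_apply]
  exact Finset.sum_eq_zero fun i _ => by ring

lemma hamD_zero_left (f : DPAlg 𝒦 p n) : hamD 𝒦 p 0 f = 0 := by
  rw [hamD_antisymm, map_zero, neg_zero]

lemma hamD_mul_left (a b c : DPAlg 𝒦 p n) :
    hamD 𝒦 p (a * b) c = a * hamD 𝒦 p b c + b * hamD 𝒦 p a c := by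
  rw [hamD_antisymm, Derivation.leibniz, hamD_antisymm b, hamD_antisymm a]
  simp only [smul_eq_mul]
  ring

lemma contactD_self (f : DPAlg 𝒦 p n) :
    contactD 𝒦 p f f = 2 * f * partialD 𝒦 p .zero f := by
  rw [contactD_apply, hamD_self]
  ring

/-- `y` and `z` are opposite indices, with `s` the sign of `y`. -/
def IsOpposite (y z : Idx n) (s : ℤ) : Prop :=
  ∃ i : Fin n, (y = .pos i ∧ z = .neg i ∧ s = 1) ∨ (y = .neg i ∧ z = .pos i ∧ s = -1)

namespace IsOpposite

variable {y z : Idx n} {s : ℤ}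

lemma ne_zero (h : IsOpposite y z s) : y ≠ .zero := by
  obtain ⟨i, ⟨rfl, rfl, rfl⟩ | ⟨rfl, rfl, rfl⟩⟩ := h <;> simp

lemma symm (h : IsOpposite y z s) : IsOpposite z y (-s) := by
  obtain ⟨i, ⟨rfl, rfl, rfl⟩ | ⟨rfl, rfl, rfl⟩⟩ := h
  exacts [⟨i, by simp⟩, ⟨i, by simp⟩]

lemma ne (h : IsOpposite y z s) : y ≠ z := by
  obtain ⟨i, ⟨rfl, rfl, rfl⟩ | ⟨rfl, rfl, rfl⟩⟩ := h <;> simp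

lemma hamD_gen (h : IsOpposite y z s) (f : DPAlg 𝒦 p n) :
    hamD 𝒦 p f (gen 𝒦 p y) = s * partialD 𝒦 p z f := by
  obtain ⟨i, ⟨rfl, rfl, rfl⟩ | ⟨rfl, rfl, rfl⟩⟩ := h
  · simp [hamD_pos]
  · rw [hamD_neg]
    push_cast
    ring

lemma eulerD_gen (h : IsOpposite y z s) : eulerD 𝒦 p (gen 𝒦 p y) = gen 𝒦 p y := by
  obtain ⟨i, ⟨rfl, rfl, rfl⟩ | ⟨rfl, rfl, rfl⟩⟩ := h
  · exact eulerD_pos _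
  · exact eulerD_neg _

lemma partialD_eulerD (h : IsOpposite y z s) (f : DPAlg 𝒦 p n) :
    partialD 𝒦 p y (eulerD 𝒦 p f) = eulerD 𝒦 p (partialD 𝒦 p y f) + partialD 𝒦 p y f := by
  obtain ⟨i, ⟨rfl, rfl, rfl⟩ | ⟨rfl, rfl, rfl⟩⟩ := h
  · exact partialD_pos_eulerD _ _
  · exact partialD_neg_eulerD _ _

lemma partialD_zero_gen (h : IsOpposite y z s) :
    partialD 𝒦 p .zero (gen 𝒦 p y) = 0 := by
  rw [partialD_gen, if_neg h.ne_zero]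

lemma contactD_gen (h : IsOpposite y z s) (f : DPAlg 𝒦 p n) :
    contactD 𝒦 p f (gen 𝒦 p y) =
      gen 𝒦 p y * partialD 𝒦 p .zero f + s * partialD 𝒦 p z f := by
  rw [contactD_apply, h.hamD_gen, h.eulerD_gen, h.partialD_zero_gen]
  ring

end IsOpposite

lemma exists_isOpposite {y : Idx n} (hy : y ≠ .zero) : ∃ z s, IsOpposite y z s := by
  rcases y with _ | i | i
  · exact absurd rfl hy
  · exact ⟨.neg i, 1, i, by simp⟩
  · exact ⟨.pos i, -1, i, by simp⟩

include hp

/-- Here `y` occurs once in the Hamiltonian and its conjugate `z` does not. On functions free of `z`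
the operator gains a factor `y` at each step, so only its action on `z` itself needs computation. -/
lemma contactD_pow_of_unpaired {y z : Idx n} {s : ℤ} (h : IsOpposite y z s) {m : DPAlg 𝒦 p n}
    (hym : partialD 𝒦 p y m = 0) (hzm : partialD 𝒦 p z m = 0) {c : ℤ}
    (hu : contactD 𝒦 p (gen 𝒦 p y * m) (partialD 𝒦 p .zero (gen 𝒦 p y * m)) =
      c * partialD 𝒦 p .zero (gen 𝒦 p y * m) ^ 2) :
    (contactD 𝒦 p (gen 𝒦 p y * m) : DPAlg 𝒦 p n →ₗ[𝒦] DPAlg 𝒦 p n) ^ p = 0 := by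
  set Y := gen 𝒦 p y with hY
  set Z := gen 𝒦 p z with hZ
  set D := contactD 𝒦 p (Y * m) with hD
  set u := partialD 𝒦 p .zero (Y * m) with hu'
  have hu0 : u = Y * partialD 𝒦 p .zero m := by
    rw [hu', Derivation.leibniz, hY, h.partialD_zero_gen]
    simp
  have hDb (b : DPAlg 𝒦 p n) : D b = Y * ((m - eulerD 𝒦 p m) * partialD 𝒦 p .zero b +
      partialD 𝒦 p .zero m * eulerD 𝒦 p b + hamD 𝒦 p m b) - s * m * partialD 𝒦 p z b := by
    rw [hD, contactD_apply, ← hu', hu0, hamD_mul_left, Derivation.leibniz, hY, h.eulerD_gen,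
      hamD_antisymm b (gen 𝒦 p y), h.hamD_gen]
    simp only [smul_eq_mul]
    ring
  have hDY : D Y = Y ^ 2 * partialD 𝒦 p .zero m := by
    rw [hD, hY, h.contactD_gen, ← hY, ← hu', hu0, Derivation.leibniz, hzm, hY, partialD_gen,
      if_neg h.ne]
    simp
    ring
  have hDZ : D Z = Z * u - s * m := by
    rw [hD, hZ, h.symm.contactD_gen, ← hu', Derivation.leibniz, hym, hY, partialD_gen, if_pos rfl]
    simp
    ring
  have hDm : D m = m * u := by
    rw [hDb, hamD_self, hzm, hu0]
    ring
  -- The only part of `D` not divisible by `Y` is a multiple of the derivative in `z`, which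
  -- vanishes here and keeps vanishing under iteration.
  have hfree (k : ℕ) {a : DPAlg 𝒦 p n} (ha : partialD 𝒦 p z a = 0) :
      ∃ b, partialD 𝒦 p z b = 0 ∧
        ((D : DPAlg 𝒦 p n →ₗ[𝒦] DPAlg 𝒦 p n) ^ k) a = Y ^ k * b := by
    induction k with
    | zero => exact ⟨a, ha, by simp⟩
    | succ k ih =>
      obtain ⟨b, hb, hk⟩ := ih
      refine ⟨((m - eulerD 𝒦 p m) * partialD 𝒦 p .zero b +
        partialD 𝒦 p .zero m * eulerD 𝒦 p b + hamD 𝒦 p m b) +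
        k * (partialD 𝒦 p .zero m * b), ?_, ?_⟩
      · simp only [map_add, map_sub, Derivation.leibniz, partialD_hamD, h.symm.partialD_eulerD,
          partialD_comm z .zero, hb, hzm, map_zero, Derivation.map_natCast, hamD_zero_left]
        simp
      · rw [pow_succ' (D : DPAlg 𝒦 p n →ₗ[𝒦] DPAlg 𝒦 p n), Module.End.mul_apply, hk,
          Derivation.coeFn_coe, Derivation.leibniz, Derivation.leibniz_pow, hDY, hDb b, hb]
        rcases k with _ | k
        · simp
        · simp only [smul_eq_mul, nsmul_eq_mul, Nat.add_sub_cancel]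
          ring
  -- Closed form from `D Z = Z u - s m`, `D m = m u` and `D u = c u ^ 2`. At `k + 1 = p` the first
  -- term dies with `u ^ p` and the second with the factor `k + 1`.
  have hz (k : ℕ) : ((D : DPAlg 𝒦 p n →ₗ[𝒦] DPAlg 𝒦 p n) ^ (k + 1)) Z =
      (∏ j ∈ range (k + 1), ((1 + j * c : ℤ) : DPAlg 𝒦 p n)) * (Z * u ^ (k + 1)) -
      (k + 1 : ℕ) * (∏ j ∈ range k, ((1 + j * c : ℤ) : DPAlg 𝒦 p n)) * (s * (m * u ^ k)) := by
    induction k with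
    | zero => simp [hDZ]
    | succ k ih =>
      have h0 (k : ℕ) : D (∏ j ∈ range k, ((1 + j * c : ℤ) : DPAlg 𝒦 p n)) = 0 := by
        rw [← Int.cast_prod, Derivation.map_intCast]
      rw [pow_succ', Module.End.mul_apply, ih, Derivation.coeFn_coe]
      simp only [map_sub, Derivation.leibniz, Derivation.leibniz_pow, h0,
        Derivation.map_intCast, Derivation.map_natCast, hDZ, hDm, hu, smul_eq_mul, nsmul_eq_mul,
        Nat.add_sub_cancel]
      rw [Finset.prod_range_succ _ (k + 1), Finset.prod_range_succ _ k]
      rcases k with _ | k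
      · simp; ring
      · simp only [Nat.add_sub_cancel]
        push_cast
        ring
  have hup : Y ^ p = 0 := gen_pow_p y
  refine derivation_pow_char_eq (E := 0) fun j => ?_
  rw [Derivation.zero_apply]
  by_cases hj : j = z
  · obtain ⟨k, hk⟩ := Nat.exists_eq_succ_of_ne_zero hp.out.ne_zero
    have hz' := hz k
    have hpc : ((k + 1 : ℕ) : DPAlg 𝒦 p n) = 0 := by
      rw [← Nat.succ_eq_add_one, ← hk, ← map_natCast (algebraMap 𝒦 (DPAlg 𝒦 p n)),
        CharP.cast_eq_zero, map_zero]
    have hu2 : u ^ (k + 1) = 0 := by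
      rw [← Nat.succ_eq_add_one, ← hk, hu0, mul_pow, hup, zero_mul]
    rw [← Nat.succ_eq_add_one, ← hk] at hz' hpc hu2
    rw [hj, ← hZ, hz', hpc, hu2]
    simp
  · obtain ⟨b, -, hb⟩ := hfree p (a := gen 𝒦 p j) (by rw [partialD_gen, if_neg hj])
    rw [hb, hup, zero_mul]

end NilpotentAndToral

/-! ### Squarefree monomials, and the `p`-th powers of all `D_K(x^{(α)})` -/

section SquarefreeMonomials

variable {𝒦 : Type*} [Field 𝒦] {p n : ℕ}

lemma prod_gen_pow_p {S : Finset (Idx n)} (hS : S.Nonempty) :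
    (∏ j ∈ S, gen 𝒦 p j) ^ p = 0 := by
  obtain ⟨j, hj⟩ := hS
  rw [← Finset.prod_pow]
  exact Finset.prod_eq_zero hj (gen_pow_p j)

lemma dpMon_eq_prod_gen (S : Finset (Idx n)) :
    dpMon 𝒦 p (fun j => if j ∈ S then 1 else 0) = ∏ j ∈ S, gen 𝒦 p j := by
  have h1 : ∀ j : Idx n, (((if j ∈ S then 1 else 0 : ℕ).factorial : 𝒦)) = 1 := by
    intro j; split_ifs <;> simp
  simp [dpMon, h1, pow_ite, Finset.prod_ite_mem]

variable [CharP 𝒦 p]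

lemma partialD_prod_gen_of_notMem {S : Finset (Idx n)} {i : Idx n} (hi : i ∉ S) :
    partialD 𝒦 p i (∏ j ∈ S, gen 𝒦 p j) = 0 := by
  induction S using Finset.induction_on with
  | empty => simp
  | insert a S ha ih =>
    rw [Finset.mem_insert, not_or] at hi
    rw [Finset.prod_insert ha, Derivation.leibniz, ih hi.2, partialD_gen, if_neg (Ne.symm hi.1)]
    simp

lemma partialD_prod_gen_of_mem {S : Finset (Idx n)} {i : Idx n} (hi : i ∈ S) :
    partialD 𝒦 p i (∏ j ∈ S, gen 𝒦 p j) = ∏ j ∈ S.erase i, gen 𝒦 p j := by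
  rw [← Finset.mul_prod_erase _ _ hi, Derivation.leibniz,
    partialD_prod_gen_of_notMem (Finset.notMem_erase i S), partialD_gen, if_pos rfl]
  simp

lemma eulerD_prod_gen (S : Finset (Idx n)) : ∃ c : ℤ,
    eulerD 𝒦 p (∏ j ∈ S, gen 𝒦 p j) = c * ∏ j ∈ S, gen 𝒦 p j := by
  induction S using Finset.induction_on with
  | empty => exact ⟨0, by simp⟩
  | insert a S ha ih =>
    obtain ⟨c, hc⟩ := ih
    have h : ∃ d : ℤ, eulerD 𝒦 p (gen 𝒦 p a) = d * gen 𝒦 p a := by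
      rcases a with _ | i | i
      · exact ⟨0, by rw [eulerD_zero]; simp⟩
      · exact ⟨1, by rw [eulerD_pos]; simp⟩
      · exact ⟨1, by rw [eulerD_neg]; simp⟩
    obtain ⟨d, hd⟩ := h
    refine ⟨c + d, ?_⟩
    rw [Finset.prod_insert ha, Derivation.leibniz, hc, hd]
    simp only [smul_eq_mul]
    push_cast
    ring

/-- If `x_0` occurs, the monomial is `x_0 u` with `u` free of `x_0`, the Hamiltonian terms vanish,
and only `u E(u)` is left; `c` is thus the Euler degree of `u`. If it does not occur, `u = 0`. -/
lemma contactD_partialD_zero_prod_gen (S : Finset (Idx n)) : ∃ c : ℤ,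
    contactD 𝒦 p (∏ j ∈ S, gen 𝒦 p j) (partialD 𝒦 p .zero (∏ j ∈ S, gen 𝒦 p j)) =
      c * partialD 𝒦 p .zero (∏ j ∈ S, gen 𝒦 p j) ^ 2 := by
  by_cases h : Idx.zero ∈ S
  · obtain ⟨c, hc⟩ := eulerD_prod_gen (𝒦 := 𝒦) (p := p) (S.erase .zero)
    refine ⟨c, ?_⟩
    rw [partialD_prod_gen_of_mem h, contactD_apply, hc,
      partialD_prod_gen_of_notMem (Finset.notMem_erase .zero S), partialD_prod_gen_of_mem h,
      ← Finset.mul_prod_erase _ _ h, hamD_mul_left, hamD_self, hamD_antisymm, hamD_zero]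
    ring
  · exact ⟨0, by rw [partialD_prod_gen_of_notMem h]; simp⟩

variable [hp : Fact p.Prime]

-- The cofactor of a conjugate pair is a constant of motion: the pair has Euler degree two, so the
-- `D_0` and Euler terms cancel, and the Hamiltonian terms only differentiate the cofactor along the
-- pair.
omit hp in
lemma contactD_apply_cofactor {y z : Idx n} {s : ℤ} (h : IsOpposite y z s) {m : DPAlg 𝒦 p n}
    (hym : partialD 𝒦 p y m = 0) (hzm : partialD 𝒦 p z m = 0) :
    contactD 𝒦 p (gen 𝒦 p y * (gen 𝒦 p z * m)) m = 0 := by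
  rw [contactD_apply, hamD_mul_left, hamD_mul_left, hamD_self, hamD_antisymm m (gen 𝒦 p y),
    hamD_antisymm m (gen 𝒦 p z), h.hamD_gen, h.symm.hamD_gen, hym, hzm]
  simp only [Derivation.leibniz, h.eulerD_gen, h.symm.eulerD_gen, h.partialD_zero_gen,
    h.symm.partialD_zero_gen, smul_eq_mul]
  ring

/-- Every variable of nonzero index is multiplied by `u + s w`, with `u` the derivative of `f` along
`x_0` and `w` either the cofactor of its conjugate pair or zero, so `derivation_pow_eq_zero`
applies. The excluded sets are those where `u = 1` or a cofactor is `1`, that is the toral cases. -/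
lemma contactD_pow_of_paired {S : Finset (Idx n)}
    (hS : ∀ y z s, IsOpposite y z s → y ∈ S → z ∈ S) (h0 : S ≠ {.zero})
    (hpair : ∀ y z s, IsOpposite y z s → S ≠ {y, z}) :
    (contactD 𝒦 p (∏ j ∈ S, gen 𝒦 p j) : DPAlg 𝒦 p n →ₗ[𝒦] DPAlg 𝒦 p n) ^ p = 0 := by
  obtain ⟨c, hc⟩ := contactD_partialD_zero_prod_gen (𝒦 := 𝒦) (p := p) S
  set f := ∏ j ∈ S, gen 𝒦 p j with hf
  set D := contactD 𝒦 p f with hD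
  set u := partialD 𝒦 p .zero f with hu
  have hu0 : u = 0 ∨ (f = gen 𝒦 p .zero * u ∧ u ^ p = 0) := by
    by_cases h : Idx.zero ∈ S
    · right
      rw [hu, hf, partialD_prod_gen_of_mem h]
      refine ⟨(Finset.mul_prod_erase _ _ h).symm, prod_gen_pow_p ?_⟩
      rw [Finset.nonempty_iff_ne_empty]
      intro he
      rw [Finset.erase_eq_empty_iff] at he
      rcases he with he | he
      · rw [he] at h; simp at h
      · exact h0 he
    · left
      exact partialD_prod_gen_of_notMem h
  have hup : u ^ p = 0 := by
    rcases hu0 with h | h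
    · rw [h, zero_pow hp.out.ne_zero]
    · exact h.2
  refine derivation_pow_char_eq (E := 0) fun j => ?_
  rw [Derivation.zero_apply]
  by_cases hj : j = .zero
  -- For `x_0`: the first application gives a multiple of `f`, and the other `p - 1` give a multiple
  -- of `f u ^ (p - 1)`, which is zero or `x_0 u ^ p`, hence zero.
  · obtain ⟨d, hd⟩ := eulerD_prod_gen (𝒦 := 𝒦) (p := p) S
    obtain ⟨k, hk⟩ := Nat.exists_eq_add_of_le hp.out.two_le
    have h1 : D (gen 𝒦 p j) = (2 - d : ℤ) • f := by
      rw [hj, hD, contactD_gen_zero, hf, hd, zsmul_eq_mul]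
      push_cast
      ring
    have h2 : D f = (2 : ℤ) * f * u := by
      rw [hD, contactD_self]
      push_cast
      rfl
    have h3 : f * u ^ (k + 1) = 0 := by
      rcases hu0 with h | h
      · rw [h, zero_pow (by omega), mul_zero]
      · rw [h.1, mul_assoc, ← pow_succ', show k + 1 + 1 = p by omega, hup, mul_zero]
    have hpk : p = (k + 1) + 1 := by omega
    have h4 : ((D : DPAlg 𝒦 p n →ₗ[𝒦] DPAlg 𝒦 p n) ^ ((k + 1) + 1)) (gen 𝒦 p j) = 0 := by
      rw [pow_succ, Module.End.mul_apply, Derivation.coeFn_coe, h1, map_zsmul,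
        derivation_iterate_eq D h2 hc (k + 1), h3]
      simp
    rwa [← hpk] at h4
  · obtain ⟨z, s, h⟩ := exists_isOpposite hj
    by_cases hjS : j ∈ S
    · have hzS : z ∈ S.erase j := Finset.mem_erase.mpr ⟨h.ne.symm, hS j z s h hjS⟩
      set m := ∏ i ∈ (S.erase j).erase z, gen 𝒦 p i with hm
      have hfm : f = gen 𝒦 p j * (gen 𝒦 p z * m) := by
        rw [hf, hm, Finset.mul_prod_erase _ _ hzS, Finset.mul_prod_erase _ _ hjS]
      have hjm : partialD 𝒦 p j m = 0 := partialD_prod_gen_of_notMem (by simp)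
      have hzm : partialD 𝒦 p z m = 0 := partialD_prod_gen_of_notMem (by simp)
      have hmp : m ^ p = 0 := by
        refine prod_gen_pow_p ?_
        rw [Finset.nonempty_iff_ne_empty]
        intro he
        refine hpair j z s h ?_
        rw [Finset.erase_eq_empty_iff] at he
        rcases he with he | he
        · rw [he] at hzS; simp at hzS
        · rw [← Finset.insert_erase hjS, he]
      refine derivation_pow_eq_zero D (u := u) (w := s * m) (a := 1) (c := c) ?_ hc ?_ hup ?_
      · rw [hD, h.contactD_gen, ← hu]
        have h5 : partialD 𝒦 p z f = gen 𝒦 p j * m := by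
          rw [hfm, Derivation.leibniz, Derivation.leibniz, hzm, partialD_gen, partialD_gen,
            if_neg h.ne, if_pos rfl]
          simp
        rw [h5]
        push_cast
        ring
      · rw [Derivation.leibniz, Derivation.map_intCast, hD, hfm,
          contactD_apply_cofactor h hjm hzm]
        simp
      · rw [mul_pow, hmp, mul_zero]
    · have hzS : z ∉ S := fun hz => hjS (hS z j _ h.symm hz)
      refine derivation_pow_eq_zero D (u := u) (w := 0) (a := 1) (c := c) ?_ hc (map_zero D)
        hup (zero_pow hp.out.ne_zero)
      rw [hD, h.contactD_gen, ← hu, hf, partialD_prod_gen_of_notMem hzS]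
      simp

lemma contactD_pow_prod_gen {S : Finset (Idx n)} (h0 : S ≠ {.zero})
    (hpair : ∀ y z s, IsOpposite y z s → S ≠ {y, z}) :
    (contactD 𝒦 p (∏ j ∈ S, gen 𝒦 p j) : DPAlg 𝒦 p n →ₗ[𝒦] DPAlg 𝒦 p n) ^ p = 0 := by
  by_cases hS : ∀ y z s, IsOpposite y z s → y ∈ S → z ∈ S
  · exact contactD_pow_of_paired hS h0 hpair
  · push Not at hS
    obtain ⟨y, z, s, h, hy, hz⟩ := hS
    obtain ⟨c, hc⟩ := contactD_partialD_zero_prod_gen (𝒦 := 𝒦) (p := p) S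
    rw [← Finset.mul_prod_erase _ _ hy] at hc ⊢
    exact contactD_pow_of_unpaired h (partialD_prod_gen_of_notMem (by simp))
      (partialD_prod_gen_of_notMem (by simp [hz])) hc

/-- The eigenvalues on the generators lie in the prime field, where `a ^ p = a`. -/
lemma derivation_pow_char_of_eigen {D : Derivation 𝒦 (DPAlg 𝒦 p n) (DPAlg 𝒦 p n)}
    (h : ∀ j, ∃ a : ℤ, D (gen 𝒦 p j) = a * gen 𝒦 p j) :
    (D : DPAlg 𝒦 p n →ₗ[𝒦] DPAlg 𝒦 p n) ^ p = D := by
  refine derivation_pow_char_eq fun j => ?_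
  obtain ⟨a, ha⟩ := h j
  have h1 := derivation_iterate_eq D (y := gen 𝒦 p j) (u := 1) (a := a) (c := 0)
    (by rw [ha, mul_one]) (by simp) p
  have h2 : (a : DPAlg 𝒦 p n) ^ p = a := by
    have h3 : ((a : ZMod p)) ^ p = a := ZMod.pow_card _
    have h4 := congrArg (ZMod.castHom (dvd_refl p) 𝒦) h3
    rw [map_pow, map_intCast] at h4
    rw [← map_intCast (algebraMap 𝒦 (DPAlg 𝒦 p n)), ← map_pow, h4]
  rw [h1, ha]
  simp [h2]

lemma isOpposite_pair_cases {y z : Idx n} {s : ℤ} (h : IsOpposite y z s) :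
    ∃ i : Fin n, ({y, z} : Finset (Idx n)) = {.pos i, .neg i} := by
  obtain ⟨i, ⟨rfl, rfl, rfl⟩ | ⟨rfl, rfl, rfl⟩⟩ := h
  exacts [⟨i, rfl⟩, ⟨i, Finset.pair_comm _ _⟩]

lemma eps_zero_eq : (eps .zero : Idx n → ℕ) =
    fun j => if j ∈ ({.zero} : Finset (Idx n)) then 1 else 0 := by
  funext j
  simp [eps, Pi.single_apply]

lemma eps_pos_add_eps_neg_eq (i : Fin n) : (eps (.pos i) + eps (.neg i) : Idx n → ℕ) =
    fun j => if j ∈ ({.pos i, .neg i} : Finset (Idx n)) then 1 else 0 := by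
  funext j
  rcases j with _ | j | j <;> simp [eps, Pi.single_apply]

/-- The toral elements `D_K(x^{(α)})` equal their `p`-th power as operators. -/
theorem contactD_dpMon_pow_of_isToral {α : Idx n → ℕ} (hα : IsToral α) :
    (contactD 𝒦 p (dpMon 𝒦 p α) : DPAlg 𝒦 p n →ₗ[𝒦] DPAlg 𝒦 p n) ^ p =
      (contactD 𝒦 p (dpMon 𝒦 p α) : DPAlg 𝒦 p n →ₗ[𝒦] DPAlg 𝒦 p n) := by
  refine derivation_pow_char_of_eigen ?_
  rcases hα with rfl | ⟨i, rfl⟩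
  · rw [eps_zero_eq, dpMon_eq_prod_gen, Finset.prod_singleton]
    rintro (_ | j | j)
    · exact ⟨2, by rw [contactD_gen_zero, eulerD_zero]; simp⟩
    · exact ⟨1, by rw [contactD_gen_pos, partialD_gen, partialD_gen]; simp⟩
    · exact ⟨1, by rw [contactD_gen_neg, partialD_gen, partialD_gen]; simp⟩
  · rw [eps_pos_add_eps_neg_eq, dpMon_eq_prod_gen, Finset.prod_pair (by simp)]
    rintro (_ | j | j)
    · refine ⟨0, ?_⟩
      rw [contactD_gen_zero, Derivation.leibniz, eulerD_pos, eulerD_neg]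
      simp only [smul_eq_mul]
      push_cast
      ring
    · by_cases hij : i = j
      · refine ⟨1, ?_⟩
        subst hij
        simp [contactD_gen_pos, partialD_gen]
      · refine ⟨0, ?_⟩
        simp [contactD_gen_pos, partialD_gen, hij]
    · by_cases hij : i = j
      · refine ⟨-1, ?_⟩
        subst hij
        simp [contactD_gen_neg, partialD_gen]
        exact (neg_one_mul (gen 𝒦 p (.neg i))).symm
      · refine ⟨0, ?_⟩
        simp [contactD_gen_neg, partialD_gen, hij]

/-- The elements `D_K(x^{(α)})` that are not toral have vanishing `p`-th power as operators. -/
theorem contactD_dpMon_pow_of_not_isToral {α : Idx n → ℕ} (hα : ¬ IsToral α) :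
    (contactD 𝒦 p (dpMon 𝒦 p α) : DPAlg 𝒦 p n →ₗ[𝒦] DPAlg 𝒦 p n) ^ p = 0 := by
  by_cases h : ∃ i, 2 ≤ α i
  · obtain ⟨i, hi⟩ := h
    have h1 : dpMon 𝒦 p α = gen 𝒦 p i ^ 2 * (((∏ i, ((α i).factorial : 𝒦))⁻¹) •
        (gen 𝒦 p i ^ (α i - 2) * ∏ j ∈ univ.erase i, gen 𝒦 p j ^ α j)) := by
      rw [dpMon, mul_smul_comm, ← mul_assoc, ← pow_add, Nat.add_sub_cancel' hi,
        Finset.mul_prod_erase univ (fun j => gen 𝒦 p j ^ α j) (Finset.mem_univ i)]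
    rw [h1]
    exact contactD_pow_of_sq _ _
  · push Not at h
    obtain ⟨S, hS⟩ : ∃ S : Finset (Idx n), α = fun j => if j ∈ S then 1 else 0 := by
      refine ⟨univ.filter fun j => α j = 1, funext fun j => ?_⟩
      have := h j
      simp only [Finset.mem_filter, Finset.mem_univ, true_and]
      split_ifs <;> omega
    rw [hS, dpMon_eq_prod_gen]
    refine contactD_pow_prod_gen ?_ ?_
    · rintro rfl
      exact hα (Or.inl (hS.trans eps_zero_eq.symm))
    · rintro y z s hyz rfl
      obtain ⟨i, hi⟩ := isOpposite_pair_cases hyz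
      rw [hi] at hS
      exact hα (Or.inr ⟨i, hS.trans (eps_pos_add_eps_neg_eq i).symm⟩)

end SquarefreeMonomials

/-! ### Bases of the divided power algebra and of the contact algebra -/

section Bases

variable (𝒦 : Type*) [Field 𝒦] (p n : ℕ) [hp : Fact p.Prime] [CharP 𝒦 p]

omit [CharP 𝒦 p] hp in
lemma truncIdeal_eq : truncIdeal 𝒦 p n = Ideal.span ((fun s => MvPolynomial.monomial s (1 : 𝒦)) ''
    Set.range fun i : Idx n => Finsupp.single i p) := by
  rw [truncIdeal, ← Set.range_comp]
  congr 2
  funext i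
  simp [MvPolynomial.X_pow_eq_monomial]

omit [CharP 𝒦 p] hp in
lemma prod_gen_pow_eq (α : Idx n → ℕ) : ∏ i, gen 𝒦 p i ^ α i =
    Ideal.Quotient.mk _ (MvPolynomial.monomial (Finsupp.equivFunOnFinite.symm α) (1 : 𝒦)) := by
  rw [MvPolynomial.monomial_eq, Finsupp.prod_fintype _ _ (by simp)]
  simp [gen, map_prod]

lemma linearIndependent_dpMon :
    LinearIndependent 𝒦 fun a : Idx n → Fin p => dpMon 𝒦 p (fun i => (a i : ℕ)) := by
  rw [Fintype.linearIndependent_iff]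
  intro g hg a
  set F : (Idx n → Fin p) → Idx n →₀ ℕ :=
    fun a => Finsupp.equivFunOnFinite.symm fun i => (a i : ℕ) with hF
  have hFinj : Function.Injective F := fun a b hab => by
    funext i
    exact Fin.ext (DFunLike.congr_fun hab i)
  set d : (Idx n → Fin p) → 𝒦 := fun a => (∏ i, ((a i : ℕ).factorial : 𝒦))⁻¹ with hd
  set P : MvPolynomial (Idx n) 𝒦 := ∑ a, MvPolynomial.monomial (F a) (g a * d a) with hP
  have hmem : P ∈ truncIdeal 𝒦 p n := by
    rw [← Ideal.Quotient.eq_zero_iff_mem, ← hg, hP, map_sum]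
    refine Finset.sum_congr rfl fun a _ => ?_
    have h1 : (MvPolynomial.monomial (F a) (g a * d a) : MvPolynomial (Idx n) 𝒦) =
        (g a * d a) • MvPolynomial.monomial (F a) 1 := by
      rw [MvPolynomial.smul_monomial, smul_eq_mul, mul_one]
    rw [h1, dpMon, prod_gen_pow_eq, smul_smul]
    rfl
  -- The ideal is monomial, so every monomial occurring in `P` is divisible by some `x_i ^ p`,
  -- whereas all exponents in `P` are below `p`.
  rw [truncIdeal_eq, MvPolynomial.mem_ideal_span_monomial_image] at hmem
  have hcoeff : MvPolynomial.coeff (F a) P = g a * d a := by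
    rw [hP, MvPolynomial.coeff_sum, Finset.sum_eq_single a]
    · rw [MvPolynomial.coeff_monomial, if_pos rfl]
    · intro b _ hb
      rw [MvPolynomial.coeff_monomial, if_neg fun h => hb (hFinj h)]
    · simp
  by_contra hga
  have hne : MvPolynomial.coeff (F a) P ≠ 0 := by
    rw [hcoeff]
    refine mul_ne_zero hga (inv_ne_zero (Finset.prod_ne_zero_iff.mpr fun i _ => ?_))
    exact factorial_cast_ne_zero (a i).2
  obtain ⟨_, ⟨i, rfl⟩, hle⟩ := hmem _ (MvPolynomial.mem_support_iff.mpr hne)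
  have := hle i
  rw [Finsupp.single_eq_same] at this
  exact absurd this (not_le.mpr (a i).2)

lemma span_dpMon :
    ⊤ ≤ Submodule.span 𝒦 (Set.range fun a : Idx n → Fin p => dpMon 𝒦 p (fun i => (a i : ℕ))) := by
  intro x _
  obtain ⟨f, rfl⟩ := Ideal.Quotient.mk_surjective x
  induction f using MvPolynomial.induction_on' with
  | monomial s c =>
    have h1 : (MvPolynomial.monomial s c : MvPolynomial (Idx n) 𝒦) =
        c • MvPolynomial.monomial (Finsupp.equivFunOnFinite.symm s) 1 := by
      rw [show Finsupp.equivFunOnFinite.symm ⇑s = s from Equiv.symm_apply_apply _ s,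
        MvPolynomial.smul_monomial, smul_eq_mul, mul_one]
    have h2 : Ideal.Quotient.mk (truncIdeal 𝒦 p n) (MvPolynomial.monomial s c) =
        c • ∏ i, gen 𝒦 p i ^ s i := by
      rw [h1, prod_gen_pow_eq]
      rfl
    rw [h2]
    refine Submodule.smul_mem _ _ ?_
    by_cases hs : ∃ i, p ≤ s i
    · obtain ⟨i, hi⟩ := hs
      have h0 : ∏ i, gen 𝒦 p i ^ s i = 0 := by
        refine Finset.prod_eq_zero (Finset.mem_univ i) ?_
        rw [← Nat.sub_add_cancel hi, pow_add, gen_pow_p, mul_zero]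
      rw [h0]
      exact zero_mem _
    · push Not at hs
      have h3 : ∏ i, gen 𝒦 p i ^ s i =
          (∏ i, ((s i).factorial : 𝒦)) • dpMon 𝒦 p (fun i => s i) := by
        rw [dpMon, smul_smul, mul_inv_cancel₀, one_smul]
        exact Finset.prod_ne_zero_iff.mpr fun i _ => factorial_cast_ne_zero (hs i)
      rw [h3]
      exact Submodule.smul_mem _ _ (Submodule.subset_span ⟨fun i => ⟨s i, hs i⟩, rfl⟩)
  | add f g hf hg =>
    rw [map_add]
    exact add_mem (hf trivial) (hg trivial)

/-- The divided power monomials form a basis of the truncated divided power algebra. -/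
def dpBasis : Module.Basis (Idx n → Fin p) 𝒦 (DPAlg 𝒦 p n) :=
  Module.Basis.mk (linearIndependent_dpMon 𝒦 p n) (span_dpMon 𝒦 p n)

variable {𝒦 p n}

lemma dpBasis_apply (a : Idx n → Fin p) : dpBasis 𝒦 p n a = dpMon 𝒦 p (fun i => (a i : ℕ)) := by
  rw [dpBasis, Module.Basis.mk_apply]

/-- If `D_K(f) = 0`, its values on `x_i` and `x_{-i}` combine to `x_i D_i f + x_{-i} D_{-i} f = 0`,
so the Euler derivative of `f` vanishes; the value on `x_0` then reads `2 f = 0`. -/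
lemma contactD_injective (hp2 : p ≠ 2) :
    Function.Injective (contactD 𝒦 p : DPAlg 𝒦 p n →ₗ[𝒦] _) := by
  refine (injective_iff_map_eq_zero (contactD 𝒦 p)).mpr fun f hf => ?_
  have h (j : Idx n) : contactD 𝒦 p f (gen 𝒦 p j) = 0 := by
    rw [hf]; rfl
  have h0 := h .zero
  rw [contactD_gen_zero] at h0
  have hE : eulerD 𝒦 p f = 0 := by
    rw [eulerD_apply]
    refine Finset.sum_eq_zero fun i _ => ?_
    have h1 := h (.pos i)
    have h2 := h (.neg i)
    rw [contactD_gen_pos] at h1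
    rw [contactD_gen_neg] at h2
    linear_combination gen 𝒦 p (.neg i) * h1 - gen 𝒦 p (.pos i) * h2
  rw [hE, sub_zero] at h0
  have h2 : (2 : 𝒦) ≠ 0 := by
    have h : ((2 : ℕ) : 𝒦) ≠ 0 := by
      rw [Ne, CharP.cast_eq_zero_iff 𝒦 p]
      exact fun h => hp2 ((Nat.prime_dvd_prime_iff_eq hp.out Nat.prime_two).mp h)
    exact_mod_cast h
  have h3 : (2 : 𝒦) • f = 0 := by rw [two_smul, ← two_mul, h0]
  exact (smul_eq_zero.mp h3).resolve_left h2

variable (𝒦 p n) in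
/-- The coefficient of the top monomial `x^{(τ)}`. -/
def topCoeff : DPAlg 𝒦 p n →ₗ[𝒦] 𝒦 :=
  (dpBasis 𝒦 p n).coord fun _ => ⟨p - 1, Nat.sub_lt hp.out.pos one_pos⟩

/-- No partial derivative reaches the top monomial, so `topCoeff` is an integral with integration by
parts. -/
lemma topCoeff_partialD (i : Idx n) (f : DPAlg 𝒦 p n) :
    topCoeff 𝒦 p n (partialD 𝒦 p i f) = 0 := by
  have h : topCoeff 𝒦 p n ∘ₗ (partialD 𝒦 p i : DPAlg 𝒦 p n →ₗ[𝒦] DPAlg 𝒦 p n) = 0 := by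
    refine (dpBasis 𝒦 p n).ext fun a => ?_
    rw [LinearMap.comp_apply, Derivation.coeFn_coe, dpBasis_apply, partialD_dpMon i fun j => (a j).2]
    split_ifs with h0
    · simp
    · have h1 : dpMon 𝒦 p ((fun j => (a j : ℕ)) - eps i) =
          dpBasis 𝒦 p n fun j => ⟨(a j : ℕ) - eps i j, (Nat.sub_le _ _).trans_lt (a j).2⟩ := by
        rw [dpBasis_apply]
        rfl
      rw [h1, topCoeff, Module.Basis.coord_apply, Module.Basis.repr_self, Finsupp.single_apply,
        if_neg, LinearMap.zero_apply]
      intro h2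
      have h3 := congrArg Fin.val (congrFun h2 i)
      simp only [eps, Pi.single_eq_same] at h3
      have := (a i).2
      omega
  exact LinearMap.congr_fun h f

lemma topCoeff_partialD_mul (i : Idx n) (f g : DPAlg 𝒦 p n) :
    topCoeff 𝒦 p n (partialD 𝒦 p i f * g) = -topCoeff 𝒦 p n (f * partialD 𝒦 p i g) := by
  have h := topCoeff_partialD i (f * g)
  rw [Derivation.leibniz, map_add, smul_eq_mul, smul_eq_mul, mul_comm g] at h
  linear_combination h

lemma topCoeff_hamD (f g : DPAlg 𝒦 p n) : topCoeff 𝒦 p n (hamD 𝒦 p f g) = 0 := by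
  rw [hamD_apply, map_sum]
  refine Finset.sum_eq_zero fun i _ => ?_
  rw [map_sub, topCoeff_partialD_mul, topCoeff_partialD_mul, partialD_comm]
  ring

/-- Integration by parts for the Euler field, whose divergence is `2n`. -/
lemma topCoeff_mul_eulerD (f g : DPAlg 𝒦 p n) :
    topCoeff 𝒦 p n (f * eulerD 𝒦 p g) =
      -topCoeff 𝒦 p n (eulerD 𝒦 p f * g) - (2 * n : 𝒦) * topCoeff 𝒦 p n (f * g) := by
  have h (j : Idx n) : topCoeff 𝒦 p n (f * (gen 𝒦 p j * partialD 𝒦 p j g)) =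
      -topCoeff 𝒦 p n (gen 𝒦 p j * partialD 𝒦 p j f * g) - topCoeff 𝒦 p n (f * g) := by
    have h1 := topCoeff_partialD_mul j (f * gen 𝒦 p j) g
    rw [Derivation.leibniz, partialD_gen, if_pos rfl, smul_eq_mul, smul_eq_mul, mul_one, add_mul,
      map_add, mul_assoc f] at h1
    linear_combination h1
  rw [eulerD_apply, eulerD_apply, Finset.mul_sum, Finset.sum_mul, map_sum, map_sum]
  have h2 : (2 * n : 𝒦) * topCoeff 𝒦 p n (f * g) =
      ∑ _i : Fin n, 2 * topCoeff 𝒦 p n (f * g) := by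
    rw [Finset.sum_const, Finset.card_univ, Fintype.card_fin, nsmul_eq_mul]
    ring
  rw [h2, ← Finset.sum_neg_distrib, ← Finset.sum_sub_distrib]
  refine Finset.sum_congr rfl fun i _ => ?_
  rw [mul_add, add_mul, map_add, map_add, h, h]
  ring

/-- Source of the congruence on `2n + 4`: moving all derivatives onto `f`, the contributions are
`-2` from `2 f D_0 g`, `-2n` from the divergence of the Euler field and `-2` from the correction
term. -/
lemma topCoeff_bracket (f g : DPAlg 𝒦 p n) :
    topCoeff 𝒦 p n (contactD 𝒦 p f g - 2 * (partialD 𝒦 p .zero f * g)) =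
      -((2 * n + 4 : ℕ) : 𝒦) * topCoeff 𝒦 p n (partialD 𝒦 p .zero f * g) := by
  have h1 := topCoeff_partialD_mul .zero f g
  have h2 := topCoeff_partialD_mul .zero (eulerD 𝒦 p f) g
  rw [partialD_zero_eulerD] at h2
  have h3 := topCoeff_mul_eulerD (partialD 𝒦 p .zero f) g
  rw [contactD_apply, map_sub, map_add, map_add, topCoeff_hamD, sub_mul, map_sub, two_mul,
    add_mul, two_mul, map_add, map_add, h3]
  push_cast
  linear_combination 2 * h1 - h2

/-- The exponents of the basis of the contact algebra. -/
abbrev AdmissibleIdx (p n : ℕ) : Type := {a : Idx n → Fin p // Admissible p fun i => (a i : ℕ)}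

lemma Admissible.exists_idx {α : Idx n → ℕ} (hα : Admissible p α) :
    ∃ a : AdmissibleIdx p n, (fun i => (a.1 i : ℕ)) = α := by
  have hlt (i : Idx n) : α i < p := (hα.1 i).trans_lt (Nat.sub_lt hp.out.pos one_pos)
  exact ⟨⟨fun i => ⟨α i, hlt i⟩, hα⟩, rfl⟩

/-- If `p ∣ 2n + 4`, all brackets have vanishing top coefficient, so the derived algebra misses the
top monomial. -/
lemma exists_contactD_eq_of_mem (x : ContactAlg 𝒦 p n) :
    ∃ f, contactD 𝒦 p f = ((x : contactFull 𝒦 p n) : Derivation 𝒦 _ _) ∧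
      (p ∣ 2 * n + 4 → topCoeff 𝒦 p n f = 0) := by
  by_cases hd : p ∣ 2 * n + 4
  swap
  · obtain ⟨f, hf⟩ := x.1.2
    exact ⟨f, hf, fun h => absurd h hd⟩
  obtain ⟨⟨y, hy'⟩, hy⟩ := x
  rw [LieAlgebra.derivedSeries_def, LieAlgebra.derivedSeriesOfIdeal_succ,
    LieAlgebra.derivedSeriesOfIdeal_zero, ← LieSubmodule.mem_toSubmodule,
    LieSubmodule.lieIdeal_oper_eq_linear_span'] at hy
  have hle : Submodule.map (contactFull 𝒦 p n).toSubmodule.subtype (Submodule.span 𝒦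
      {x | ∃ a ∈ (⊤ : LieIdeal 𝒦 (contactFull 𝒦 p n)),
        ∃ b ∈ (⊤ : LieIdeal 𝒦 (contactFull 𝒦 p n)), ⁅a, b⁆ = x}) ≤
      Submodule.map (contactD 𝒦 p) (LinearMap.ker (topCoeff 𝒦 p n)) := by
    rw [Submodule.map_span, Submodule.span_le]
    rintro _ ⟨_, ⟨⟨_, f, rfl⟩, -, ⟨_, g, rfl⟩, -, rfl⟩, rfl⟩
    refine ⟨_, ?_, (contactD_lie f g).symm⟩
    rw [SetLike.mem_coe, LinearMap.mem_ker, topCoeff_bracket, (CharP.cast_eq_zero_iff 𝒦 p _).mpr hd,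
      neg_zero, zero_mul]
  obtain ⟨f, hf, hfy⟩ := hle (Submodule.mem_map_of_mem hy)
  exact ⟨f, hfy, fun _ => hf⟩

variable (𝒦 p n) in
/-- The inclusion of the contact algebra in the derivations of the divided power algebra. -/
def contactIncl : ContactAlg 𝒦 p n →ₗ[𝒦] Derivation 𝒦 (DPAlg 𝒦 p n) (DPAlg 𝒦 p n) where
  toFun x := ((x : contactFull 𝒦 p n) : Derivation 𝒦 _ _)
  map_add' _ _ := rfl
  map_smul' _ _ := rfl

omit hp in
lemma contactIncl_injective : Function.Injective (contactIncl 𝒦 p n) :=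
  fun _ _ h => Subtype.ext (Subtype.ext h)

lemma contactIncl_contactElt (hp2 : p ≠ 2) {α : Idx n → ℕ} (hα : Admissible p α) :
    contactIncl 𝒦 p n (contactElt 𝒦 p α) = contactD 𝒦 p (dpMon 𝒦 p α) :=
  coe_contactElt 𝒦 hp2 hα

omit hp in
lemma contactIncl_lie (x y : ContactAlg 𝒦 p n) :
    contactIncl 𝒦 p n ⁅x, y⁆ = ⁅contactIncl 𝒦 p n x, contactIncl 𝒦 p n y⁆ := rfl

lemma linearIndependent_contactElt (hp2 : p ≠ 2) :
    LinearIndependent 𝒦 fun a : AdmissibleIdx p n => contactElt 𝒦 p fun i => (a.1 i : ℕ) := by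
  have h0 : LinearIndependent 𝒦 fun a : AdmissibleIdx p n => dpMon 𝒦 p fun i => (a.1 i : ℕ) :=
    (linearIndependent_dpMon 𝒦 p n).comp Subtype.val Subtype.val_injective
  have h1 := h0.map_injOn (contactD 𝒦 p) (contactD_injective hp2).injOn
  have h2 : (contactD 𝒦 p ∘ fun a : AdmissibleIdx p n => dpMon 𝒦 p fun i => (a.1 i : ℕ)) =
      contactIncl 𝒦 p n ∘ fun a : AdmissibleIdx p n => contactElt 𝒦 p fun i => (a.1 i : ℕ) :=
    funext fun a => (contactIncl_contactElt hp2 a.2).symm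
  rw [h2] at h1
  exact LinearIndependent.of_comp (contactIncl 𝒦 p n) h1

lemma admissible_or_repr_eq_zero {f : DPAlg 𝒦 p n}
    (hd : p ∣ 2 * n + 4 → topCoeff 𝒦 p n f = 0) (a : Idx n → Fin p) :
    Admissible p (fun i => (a i : ℕ)) ∨ (dpBasis 𝒦 p n).repr f a = 0 := by
  refine or_iff_not_imp_left.mpr fun ha => ?_
  have h1 : ∀ i, (a i : ℕ) ≤ p - 1 := fun i => Nat.le_sub_one_of_lt (a i).2
  simp only [Admissible, h1, implies_true, true_and, not_forall, not_not, Ne] at ha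
  obtain ⟨hdvd, ha⟩ := ha
  have h2 : a = fun _ => ⟨p - 1, Nat.sub_lt hp.out.pos one_pos⟩ :=
    funext fun i => Fin.ext (congrFun ha i)
  rw [h2]
  exact hd hdvd

lemma span_contactElt (hp2 : p ≠ 2) : ⊤ ≤ Submodule.span 𝒦
    (Set.range fun a : AdmissibleIdx p n => contactElt 𝒦 p fun i => (a.1 i : ℕ)) := by
  intro x _
  obtain ⟨f, hf, hd⟩ := exists_contactD_eq_of_mem x
  -- The sum runs over all exponents; where `a` is not admissible the coefficient is zero, so the
  -- value of `contactElt` there is irrelevant.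
  have hx : x = ∑ a : Idx n → Fin p,
      (dpBasis 𝒦 p n).repr f a • contactElt 𝒦 p fun i => (a i : ℕ) := by
    apply contactIncl_injective
    have h1 : contactIncl 𝒦 p n x = contactD 𝒦 p f := hf.symm
    rw [h1, map_sum]
    conv_lhs => rw [← (dpBasis 𝒦 p n).sum_repr f, map_sum]
    refine Finset.sum_congr rfl fun a _ => ?_
    rw [map_smul, map_smul, dpBasis_apply]
    rcases admissible_or_repr_eq_zero hd a with ha | ha
    · rw [contactIncl_contactElt hp2 ha]
    · rw [ha, zero_smul, zero_smul]
  rw [hx]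
  refine sum_mem fun a _ => ?_
  rcases admissible_or_repr_eq_zero hd a with ha | ha
  · exact Submodule.smul_mem _ _ (Submodule.subset_span ⟨⟨a, ha⟩, rfl⟩)
  · rw [ha, zero_smul]
    exact zero_mem _

variable (𝒦 n) in
/-- The basis `D_K(x^{(α)})`, `α` admissible, of the contact algebra. -/
def contactBasis (hp2 : p ≠ 2) : Module.Basis (AdmissibleIdx p n) 𝒦 (ContactAlg 𝒦 p n) :=
  Module.Basis.mk (linearIndependent_contactElt hp2) (span_contactElt hp2)

lemma contactBasis_apply (hp2 : p ≠ 2) (a : AdmissibleIdx p n) :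
    contactBasis 𝒦 n hp2 a = contactElt 𝒦 p fun i => (a.1 i : ℕ) := by
  rw [contactBasis, Module.Basis.mk_apply]

omit hp in
lemma natCard_admissibleIdx_of_not_dvd (h : ¬ p ∣ 2 * n + 4) :
    Nat.card (AdmissibleIdx p n) = p ^ (2 * n + 1) := by
  have h1 : ∀ a : Idx n → Fin p, Admissible p fun i => (a i : ℕ) := fun a =>
    ⟨fun i => Nat.le_sub_one_of_lt (a i).2, fun hd => absurd hd h⟩
  rw [Nat.card_congr (Equiv.subtypeUnivEquiv h1), Nat.card_eq_fintype_card]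
  simp [two_mul]

lemma natCard_admissibleIdx_of_dvd (h : p ∣ 2 * n + 4) :
    Nat.card (AdmissibleIdx p n) = p ^ (2 * n + 1) - 1 := by
  classical
  have h1 : ∀ a : Idx n → Fin p, (Admissible p fun i => (a i : ℕ)) ↔
      a ≠ fun _ => ⟨p - 1, Nat.sub_lt hp.out.pos one_pos⟩ := fun a => by
    refine ⟨?_, fun ha => ⟨fun i => Nat.le_sub_one_of_lt (a i).2, fun _ h' => ?_⟩⟩
    · rintro ha rfl
      exact ha.2 h rfl
    · exact ha (funext fun i => Fin.ext (congrFun h' i))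
  rw [Nat.card_congr (Equiv.subtypeEquivRight h1), Nat.card_eq_fintype_card,
    Fintype.card_subtype_compl, Fintype.card_subtype_eq]
  simp [two_mul]

end Bases

/-! ### Universal enveloping algebras through linear maps -/

section UniversalEnveloping

attribute [local instance] LieRing.ofAssociativeRing

variable {k L A : Type*} [Field k] [LieRing L] [LieAlgebra k L] [Ring A] [Algebra k A]

variable (k L) in
/-- The canonical linear map of a Lie algebra to its universal enveloping algebra. -/
def ueaι : L →ₗ[k] UniversalEnvelopingAlgebra k L :=
  (UniversalEnvelopingAlgebra.ι k : L →ₗ⁅k⁆ UniversalEnvelopingAlgebra k L).toLinearMap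

lemma ueaι_apply (x : L) : ueaι k L x = UniversalEnvelopingAlgebra.ι k x := rfl

lemma ueaι_lie (x y : L) : ueaι k L ⁅x, y⁆ = ueaι k L x * ueaι k L y - ueaι k L y * ueaι k L x := by
  simp only [ueaι_apply]
  rw [LieHom.map_lie, LieRing.of_associative_ring_bracket]

lemma exists_uea_lift (f : L →ₗ[k] A) (hf : ∀ x y, f ⁅x, y⁆ = f x * f y - f y * f x) :
    ∃ g : UniversalEnvelopingAlgebra k L →ₐ[k] A, ∀ x, g (ueaι k L x) = f x := by
  let g : L →ₗ⁅k⁆ A := { f with map_lie' := fun {x y} => hf x y }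
  exact ⟨UniversalEnvelopingAlgebra.lift k g, fun x =>
    UniversalEnvelopingAlgebra.lift_ι_apply k g x⟩

lemma uea_hom_ext {f g : UniversalEnvelopingAlgebra k L →ₐ[k] A}
    (h : ∀ x, f (ueaι k L x) = g (ueaι k L x)) : f = g := by
  refine UniversalEnvelopingAlgebra.hom_ext (R := k) ?_
  ext x
  exact h x

end UniversalEnveloping

/-! ### The restricted enveloping algebra: universal property, PBW basis, dimension -/

section RestrictedEnveloping

variable (𝒦 : Type*) [Field 𝒦] (p n : ℕ) [CharP 𝒦 p]

/-- The canonical map of the contact algebra to its restricted enveloping algebra. -/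
def resι : ContactAlg 𝒦 p n →ₗ[𝒦] RestrictedEnv 𝒦 p n :=
  (RingQuot.mkAlgHom 𝒦 (RestrictedRel 𝒦 p n)).toLinearMap ∘ₗ ueaι 𝒦 (ContactAlg 𝒦 p n)

variable {𝒦 p n}

lemma resι_apply (x : ContactAlg 𝒦 p n) : resι 𝒦 p n x =
    RingQuot.mkAlgHom 𝒦 (RestrictedRel 𝒦 p n) (ueaι 𝒦 (ContactAlg 𝒦 p n) x) := rfl

lemma resι_lie (x y : ContactAlg 𝒦 p n) : resι 𝒦 p n ⁅x, y⁆ =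
    resι 𝒦 p n x * resι 𝒦 p n y - resι 𝒦 p n y * resι 𝒦 p n x := by
  simp only [resι_apply, ueaι_lie, map_sub, map_mul]

lemma resι_pow_of_isToral {α : Idx n → ℕ} (hα : Admissible p α) (h : IsToral α) :
    resι 𝒦 p n (contactElt 𝒦 p α) ^ p = resι 𝒦 p n (contactElt 𝒦 p α) := by
  rw [resι_apply, ← map_pow]
  exact RingQuot.mkAlgHom_rel 𝒦 (RestrictedRel.toral α hα h)

lemma resι_pow_of_not_isToral {α : Idx n → ℕ} (hα : Admissible p α) (h : ¬ IsToral α) :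
    resι 𝒦 p n (contactElt 𝒦 p α) ^ p = 0 := by
  rw [resι_apply, ← map_pow, ← map_zero (RingQuot.mkAlgHom 𝒦 (RestrictedRel 𝒦 p n))]
  exact RingQuot.mkAlgHom_rel 𝒦 (RestrictedRel.nilpotent α hα h)

/-- The universal property of the restricted enveloping algebra. -/
lemma exists_restrictedEnv_lift {A : Type*} [Ring A] [Algebra 𝒦 A]
    (f : ContactAlg 𝒦 p n →ₗ[𝒦] A) (hf : ∀ x y, f ⁅x, y⁆ = f x * f y - f y * f x)
    (ht : ∀ α, Admissible p α → IsToral α → f (contactElt 𝒦 p α) ^ p = f (contactElt 𝒦 p α))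
    (hn : ∀ α, Admissible p α → ¬ IsToral α → f (contactElt 𝒦 p α) ^ p = 0) :
    ∃ Φ : RestrictedEnv 𝒦 p n →ₐ[𝒦] A, ∀ x, Φ (resι 𝒦 p n x) = f x := by
  obtain ⟨g, hg⟩ := exists_uea_lift f hf
  have hrel : ∀ ⦃x y⦄, RestrictedRel 𝒦 p n x y → g x = g y := by
    rintro _ _ (⟨α, hα, h⟩ | ⟨α, hα, h⟩)
    · rw [map_pow, ← ueaι_apply, hg, ht α hα h]
    · rw [map_pow, ← ueaι_apply, hg, hn α hα h, map_zero]
  refine ⟨RingQuot.liftAlgHom 𝒦 (s := RestrictedRel 𝒦 p n) ⟨g, hrel⟩, fun x => ?_⟩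
  rw [resι_apply, RingQuot.liftAlgHom_mkAlgHom_apply, hg]

lemma restrictedEnv_hom_ext {A : Type*} [Ring A] [Algebra 𝒦 A]
    {f g : RestrictedEnv 𝒦 p n →ₐ[𝒦] A} (h : ∀ x, f (resι 𝒦 p n x) = g (resι 𝒦 p n x)) :
    f = g :=
  RingQuot.ringQuot_ext' 𝒦 f g (uea_hom_ext h)

/-- The universal property gives a map to the generated subalgebra, and its composite with the
inclusion is the identity by uniqueness. -/
lemma adjoin_range_resι : Algebra.adjoin 𝒦 (Set.range (resι 𝒦 p n)) = ⊤ := by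
  set S := Algebra.adjoin 𝒦 (Set.range (resι 𝒦 p n)) with hS
  have hmem (x) : resι 𝒦 p n x ∈ S := Algebra.subset_adjoin ⟨x, rfl⟩
  let f : ContactAlg 𝒦 p n →ₗ[𝒦] S :=
    LinearMap.codRestrict (Subalgebra.toSubmodule S) (resι 𝒦 p n) hmem
  obtain ⟨Φ, hΦ⟩ := exists_restrictedEnv_lift f
    (fun x y => Subtype.ext (resι_lie x y))
    (fun α hα h => Subtype.ext (resι_pow_of_isToral hα h))
    (fun α hα h => Subtype.ext (resι_pow_of_not_isToral hα h))
  have h1 : S.val.comp Φ = AlgHom.id 𝒦 _ := restrictedEnv_hom_ext fun x => by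
    rw [AlgHom.comp_apply, hΦ]
    rfl
  rw [eq_top_iff]
  intro x _
  have h2 := AlgHom.congr_fun h1 x
  rw [AlgHom.comp_apply, AlgHom.id_apply] at h2
  rw [← h2]
  exact (Φ x).2

variable [hp : Fact p.Prime]

-- The faithful matrix representation is the action on the divided power algebra, in the basis of
-- monomials; the prescribed `p`-th powers hold there by the toral and nilpotent computations.
open scoped Classical in
lemma restrictedEnv_words (hp2 : p ≠ 2) :
    LinearIndependent 𝒦 (fun s : {s : Multiset (AdmissibleIdx p n) // ∀ i, s.count i < p} =>
      word (fun a : AdmissibleIdx p n => resι 𝒦 p n (contactElt 𝒦 p fun i => (a.1 i : ℕ))) s) ∧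
    Submodule.span 𝒦 (Set.range fun s : {s : Multiset (AdmissibleIdx p n) //
        ∀ i, s.count i < p} =>
      word (fun a : AdmissibleIdx p n => resι 𝒦 p n (contactElt 𝒦 p fun i => (a.1 i : ℕ))) s) = ⊤ := by
  have hb := contactBasis_apply (𝒦 := 𝒦) (n := n) hp2
  let T : Module.End 𝒦 (DPAlg 𝒦 p n) ≃ₐ[𝒦] Matrix (Idx n → Fin p) (Idx n → Fin p) 𝒦 :=
    LinearMap.toMatrixAlgEquiv (dpBasis 𝒦 p n)
  let ρ : ContactAlg 𝒦 p n →ₗ[𝒦] Matrix (Idx n → Fin p) (Idx n → Fin p) 𝒦 :=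
    T.toLinearMap ∘ₗ
      { toFun x := (contactIncl 𝒦 p n x : DPAlg 𝒦 p n →ₗ[𝒦] DPAlg 𝒦 p n)
        map_add' _ _ := rfl
        map_smul' _ _ := rfl }
  have hρ (x) : ρ x = T (contactIncl 𝒦 p n x : DPAlg 𝒦 p n →ₗ[𝒦] DPAlg 𝒦 p n) := rfl
  have hword := word_linearIndependent_and_span (p := p) (contactBasis 𝒦 n hp2)
    (fun a => if IsToral (fun i => (a.1 i : ℕ)) then contactElt 𝒦 p fun i => (a.1 i : ℕ) else 0)
    ρ ?_ ?_ ?_ (resι 𝒦 p n) resι_lie ?_ adjoin_range_resι ?_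
  · simpa only [hb] using hword
  · intro x y hxy
    apply contactIncl_injective
    have h1 := T.injective hxy
    exact Derivation.ext fun a => LinearMap.congr_fun h1 a
  · intro x y
    rw [hρ, hρ, hρ, ← map_mul, ← map_mul, ← map_sub]
    congr 1
  · intro a
    rw [hb, hρ, hρ, ← map_pow, contactIncl_contactElt hp2 a.2]
    split_ifs with h
    · rw [contactD_dpMon_pow_of_isToral h, contactIncl_contactElt hp2 a.2]
    · rw [contactD_dpMon_pow_of_not_isToral h, map_zero, map_zero]
      exact (map_zero T).symm
  · intro a
    rw [hb]
    split_ifs with h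
    · rw [resι_pow_of_isToral a.2 h]
    · rw [resι_pow_of_not_isToral a.2 h, map_zero]
  · intro f hf hfp
    refine exists_restrictedEnv_lift f hf (fun α hα h => ?_) (fun α hα h => ?_)
    · obtain ⟨a, rfl⟩ := hα.exists_idx
      have := hfp a
      rwa [hb, if_pos h] at this
    · obtain ⟨a, rfl⟩ := hα.exists_idx
      have := hfp a
      rwa [hb, if_neg h, map_zero] at this

open scoped Classical in
variable (𝒦 n) in
/-- The Poincaré–Birkhoff–Witt basis of the restricted enveloping algebra. -/
def resBasis (hp2 : p ≠ 2) :
    Module.Basis {s : Multiset (AdmissibleIdx p n) // ∀ i, s.count i < p} 𝒦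
      (RestrictedEnv 𝒦 p n) :=
  Module.Basis.mk (restrictedEnv_words hp2).1 (restrictedEnv_words hp2).2.ge

open scoped Classical in
lemma resBasis_apply (hp2 : p ≠ 2)
    (s : {s : Multiset (AdmissibleIdx p n) // ∀ i, s.count i < p}) :
    resBasis 𝒦 n hp2 s =
      word (fun a : AdmissibleIdx p n => resι 𝒦 p n (contactElt 𝒦 p fun i => (a.1 i : ℕ))) s.1 := by
  rw [resBasis, Module.Basis.mk_apply]

lemma finite_restrictedEnv (hp2 : p ≠ 2) : Module.Finite 𝒦 (RestrictedEnv 𝒦 p n) := by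
  classical
  have : Finite {s : Multiset (AdmissibleIdx p n) // ∀ i, s.count i < p} :=
    Finite.of_equiv _ (boundedMultisetEquiv (AdmissibleIdx p n) p).symm
  exact Module.Finite.of_basis (resBasis 𝒦 n hp2)

lemma finrank_restrictedEnv (hp2 : p ≠ 2) :
    Module.finrank 𝒦 (RestrictedEnv 𝒦 p n) = p ^ Nat.card (AdmissibleIdx p n) := by
  classical
  rw [Module.finrank_eq_nat_card_basis (resBasis 𝒦 n hp2),
    Nat.card_congr (boundedMultisetEquiv (AdmissibleIdx p n) p), Nat.card_fun, Nat.card_fin]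

variable (n) in
lemma finite_qEnv (hp2 : p ≠ 2) (q : 𝒦) : Module.Finite 𝒦 (QEnv p n q) ∧
    Module.finrank 𝒦 (QEnv p n q) = p * p ^ Nat.card (AdmissibleIdx p n) := by
  have := finite_restrictedEnv (𝒦 := 𝒦) (n := n) hp2
  have hdeg : (Polynomial.X ^ p - Polynomial.C q * Polynomial.X : Polynomial 𝒦).natDegree = p := by
    rw [Polynomial.natDegree_sub_eq_left_of_natDegree_lt, Polynomial.natDegree_X_pow]
    rw [Polynomial.natDegree_X_pow]
    exact (Polynomial.natDegree_C_mul_le q _).trans_lt (Polynomial.natDegree_X (R := 𝒦) ▸ hp.out.one_lt)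
  have hne : (Polynomial.X ^ p - Polynomial.C q * Polynomial.X : Polynomial 𝒦) ≠ 0 := by
    intro h
    rw [h, Polynomial.natDegree_zero] at hdeg
    exact hp.out.ne_zero hdeg.symm
  have h1 : Module.Finite 𝒦 (TruncPoly p q) := (AdjoinRoot.powerBasis hne).finite
  have h2 : Module.finrank 𝒦 (TruncPoly p q) = p := by
    rw [(AdjoinRoot.powerBasis hne).finrank, AdjoinRoot.powerBasis_dim, hdeg]
  exact ⟨inferInstance, by rw [Module.finrank_tensorProduct, h2, finrank_restrictedEnv hp2]⟩

end RestrictedEnveloping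

/-! ### Rising factorials -/

section RisingFactorial

variable {A : Type*} [Ring A]

lemma risingFactorial_succ (x : A) (m : ℕ) :
    risingFactorial x (m + 1) = risingFactorial x m * (x + m) := rfl

lemma risingFactorial_succ_left (x : A) (m : ℕ) :
    risingFactorial x (m + 1) = x * risingFactorial (x + 1) m := by
  induction m with
  | zero => simp [risingFactorial]
  | succ m ih =>
    rw [risingFactorial_succ, ih, risingFactorial_succ, mul_assoc]
    push_cast
    rw [add_assoc x 1, add_comm (1 : A)]

lemma risingFactorial_reflect {A : Type*} [CommRing A] (x : A) (m : ℕ) :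
    risingFactorial (-(x + m)) m = (-1) ^ m * risingFactorial (x + 1) m := by
  induction m with
  | zero => simp [risingFactorial]
  | succ m ih =>
    rw [risingFactorial_succ_left, risingFactorial_succ]
    have h : -(x + ((m + 1 : ℕ) : A)) + 1 = -(x + m) := by push_cast; ring
    rw [h, ih]
    push_cast
    ring

lemma risingFactorial_commute_add (x : A) (m m' : ℕ) :
    Commute (risingFactorial x m) (x + m') := by
  induction m with
  | zero => exact Commute.one_left _
  | succ m ih =>
    refine ih.mul_left ?_
    exact ((Commute.refl x).add_right (Nat.cast_commute m' x).symm).add_left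
      ((Nat.cast_commute m x).add_right (Nat.cast_commute m _))

end RisingFactorial

/-! ### Eigenprojections of an element with `h ^ p = h` -/

section Spectral

variable {R A : Type*} [CommRing R] [Ring A] [Algebra R A] {p : ℕ} [hp : Fact p.Prime]
  (κ : ZMod p →+* R)

-- The homomorphism `κ` stands in for characteristic `p`: it supplies the scalars and forces the
-- characteristic of every nonzero `R`-algebra.
omit hp in
lemma charP_of_zmodHom {B : Type*} [Ring B] [Nontrivial B] [Fact p.Prime]
    [Algebra R B]
    (κ : ZMod p →+* R) : CharP B p :=
  charP_of_injective_ringHom ((algebraMap R B).comp κ).injective p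

include κ in
lemma one_sub_pow_char {z : A} (hz : z ^ p = 0) : (1 - z) ^ p = 1 := by
  rcases subsingleton_or_nontrivial A with h | h
  · exact Subsingleton.elim _ _
  have := charP_of_zmodHom (B := A) κ
  rw [sub_pow_char_of_commute p (Commute.one_left z), hz, one_pow, sub_zero]

/-- The base ring need not be a field; what makes eigenspaces separate is that differences of
eigenvalues come from the field `ZMod p`. -/
lemma zmodHom_smul_cancel {c : ZMod p} (hc : c ≠ 0) {x : A} (h : κ c • x = 0) : x = 0 := by
  rw [← one_smul R x, ← map_one κ, ← inv_mul_cancel₀ hc, map_mul, mul_smul, h, smul_zero]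

/-- The complete system of eigenprojections of an element `h` with eigenvalues in `ZMod p`. -/
structure IsSpectral (h : A) (P : ZMod p → A) : Prop where
  sum_eq : ∑ i, P i = 1
  mul_left : ∀ i, h * P i = κ i • P i
  mul_right : ∀ i, P i * h = κ i • P i

variable {κ}

namespace IsSpectral

variable {h : A} {P : ZMod p → A} (hP : IsSpectral κ h P)
include hP

lemma mul_of_ne_of {Q : ZMod p → A} (hQ : IsSpectral κ h Q) {i j : ZMod p} (hij : i ≠ j) :
    P i * Q j = 0 := by
  refine zmodHom_smul_cancel κ (sub_ne_zero.mpr hij) ?_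
  have h1 : P i * h * Q j = P i * (h * Q j) := mul_assoc _ _ _
  rw [hP.mul_right, hQ.mul_left, smul_mul_assoc, mul_smul_comm] at h1
  rw [map_sub, sub_smul, h1, sub_self]

lemma mul_of_ne {i j : ZMod p} (hij : i ≠ j) : P i * P j = 0 := hP.mul_of_ne_of hP hij

lemma sum_mul (x : A) : ∑ i, P i * x = x := by
  rw [← Finset.sum_mul, hP.sum_eq, one_mul]

lemma sum_mul' (x : A) : ∑ i, x * P i = x := by
  rw [← Finset.mul_sum, hP.sum_eq, mul_one]

lemma mul_self (i : ZMod p) : P i * P i = P i := by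
  rw [← Finset.sum_eq_single_of_mem (f := fun j => P i * P j) i (Finset.mem_univ i)
    (fun j _ hj => hP.mul_of_ne hj.symm), hP.sum_mul']

lemma mul_eq (i j : ZMod p) : P i * P j = if i = j then P j else 0 := by
  split_ifs with hij
  · rw [hij, hP.mul_self]
  · exact hP.mul_of_ne hij

/-- Both sides equal `P i * Q i`, as mixed products with different indices vanish. This uniqueness
determines the image of the projections under every homomorphism from the image of `h`. -/
lemma eq_of {Q : ZMod p → A} (hQ : IsSpectral κ h Q) (i : ZMod p) : P i = Q i := by
  have h1 : P i * Q i = P i := by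
    rw [← Finset.sum_eq_single_of_mem (f := fun j => P i * Q j) i (Finset.mem_univ i)
      (fun j _ hj => hP.mul_of_ne_of hQ hj.symm), hQ.sum_mul']
  have h2 : P i * Q i = Q i := by
    rw [← Finset.sum_eq_single_of_mem (f := fun j => P j * Q i) i (Finset.mem_univ i)
      (fun j _ hj => hP.mul_of_ne_of hQ hj), hP.sum_mul]
  rw [← h1, h2]

lemma map {B : Type*} [Ring B] [Algebra R B] (f : A →ₐ[R] B) :
    IsSpectral κ (f h) (fun i => f (P i)) where
  sum_eq := by rw [← map_sum, hP.sum_eq, map_one]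
  mul_left i := by rw [← map_mul, hP.mul_left, map_smul]
  mul_right i := by rw [← map_mul, hP.mul_right, map_smul]

lemma neg : IsSpectral κ (-h) (fun i => P (-i)) where
  sum_eq := by rw [← hP.sum_eq]; exact Fintype.sum_equiv (Equiv.neg _) _ _ fun _ => rfl
  mul_left i := by rw [neg_mul, hP.mul_left, map_neg, neg_smul, neg_neg]
  mul_right i := by rw [mul_neg, hP.mul_right, map_neg, neg_smul, neg_neg]

/-- An eigenvector of `ad h` of weight `a` raises `h`-weights by `a`: the entry `P i * x * P j`
vanishes unless `i - a = j`. -/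
lemma shift {x : A} {a : ZMod p} (hx : h * x - x * h = κ a • x) (i : ZMod p) :
    P i * x = x * P (i - a) := by
  have h0 (i j : ZMod p) (hij : i - a ≠ j) : P i * x * P j = 0 := by
    refine zmodHom_smul_cancel κ (sub_ne_zero.mpr hij) ?_
    have h1 : P i * h * x * P j - P i * x * (h * P j) = κ a • (P i * x * P j) := by
      rw [← smul_mul_assoc, ← mul_smul_comm, ← hx]
      noncomm_ring
    rw [hP.mul_right, hP.mul_left, smul_mul_assoc, smul_mul_assoc, mul_smul_comm] at h1
    rw [map_sub, map_sub, sub_smul, sub_smul, ← h1]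
    abel
  rw [← hP.sum_mul' (P i * x), Finset.sum_eq_single_of_mem (i - a) (Finset.mem_univ _)
    (fun j _ hj => h0 i j hj.symm), ← hP.sum_mul (x * P (i - a)),
    Finset.sum_eq_single_of_mem i (Finset.mem_univ _), mul_assoc]
  intro j _ hj
  rw [← mul_assoc]
  exact h0 j _ fun hc => hj (sub_left_injective hc)

lemma ext_of {x y : A} (hxy : ∀ i j, P i * x * P j = P i * y * P j) : x = y := by
  rw [← hP.sum_mul x, ← hP.sum_mul y]
  refine Finset.sum_congr rfl fun i _ => ?_
  rw [← hP.sum_mul' (P i * x), ← hP.sum_mul' (P i * y)]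
  exact Finset.sum_congr rfl fun j _ => hxy i j

lemma risingFactorial_mul (m : ℕ) (i : ZMod p) :
    risingFactorial h m * P i = κ (risingFactorial i m) • P i := by
  induction m with
  | zero => simp [risingFactorial]
  | succ m ih =>
    have h1 : (h + (m : A)) * P i = κ (i + m) • P i := by
      rw [add_mul, hP.mul_left, map_add, add_smul, map_natCast, Nat.cast_smul_eq_nsmul,
        nsmul_eq_mul]
    rw [risingFactorial_succ, mul_assoc, h1, mul_smul_comm, ih, smul_smul, ← map_mul, mul_comm,
      risingFactorial_succ]

lemma risingFactorial_eq (m : ℕ) :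
    risingFactorial h m = ∑ i, κ (risingFactorial i m) • P i := by
  rw [← hP.sum_mul' (risingFactorial h m)]
  exact Finset.sum_congr rfl fun i _ => hP.risingFactorial_mul m i

/-- Weights add on tensor products. -/
lemma tensor : IsSpectral κ (h ⊗ₜ[R] (1 : A) + 1 ⊗ₜ[R] h)
    (fun j => ∑ a, P a ⊗ₜ[R] P (j - a)) where
  sum_eq := by
    rw [Finset.sum_comm, Algebra.TensorProduct.one_def]
    have h1 (a : ZMod p) : ∑ j, P (j - a) = 1 := by
      rw [← hP.sum_eq]
      exact Fintype.sum_equiv (Equiv.subRight a) _ _ fun _ => rfl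
    simp_rw [← TensorProduct.tmul_sum, h1, ← TensorProduct.sum_tmul, hP.sum_eq]
  mul_left j := by
    rw [Finset.mul_sum, Finset.smul_sum]
    refine Finset.sum_congr rfl fun a _ => ?_
    rw [add_mul, Algebra.TensorProduct.tmul_mul_tmul, Algebra.TensorProduct.tmul_mul_tmul,
      one_mul, one_mul, hP.mul_left, hP.mul_left, TensorProduct.tmul_smul,
      ← TensorProduct.smul_tmul', ← add_smul, ← map_add, add_sub_cancel]
  mul_right j := by
    rw [Finset.sum_mul, Finset.smul_sum]
    refine Finset.sum_congr rfl fun a _ => ?_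
    rw [mul_add, Algebra.TensorProduct.tmul_mul_tmul, Algebra.TensorProduct.tmul_mul_tmul,
      mul_one, mul_one, hP.mul_right, hP.mul_right, TensorProduct.tmul_smul,
      ← TensorProduct.smul_tmul', ← add_smul, ← map_add, add_sub_cancel]

end IsSpectral

lemma isSpectral_zero : IsSpectral κ (0 : A) (fun i => if i = 0 then 1 else 0) where
  sum_eq := by simp
  mul_left i := by split_ifs with hi <;> simp [hi]
  mul_right i := by split_ifs with hi <;> simp [hi]

variable (κ) in
/-- An element with `h ^ p = h` has a complete system of eigenprojections. -/
lemma exists_isSpectral {h : A} (hh : h ^ p = h) : ∃ P, IsSpectral κ h P := by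
  let _ : Algebra (ZMod p) R := κ.toAlgebra
  let _ : Algebra (ZMod p) A := ((algebraMap R A).comp κ).toAlgebra' fun c x => by
    rw [RingHom.comp_apply]
    exact Algebra.commutes _ _
  have hsmul (c : ZMod p) (x : A) : κ c • x = algebraMap (ZMod p) A c * x := Algebra.smul_def _ _
  -- A polynomial vanishing on all of `ZMod p` is divisible by `X ^ p - X`, which kills `h`.
  have hvanish (f : Polynomial (ZMod p)) (hf : ∀ i, f.eval i = 0) : Polynomial.aeval h f = 0 := by
    have hdvd : (∏ a : ZMod p, (Polynomial.X - Polynomial.C a)) ∣ f := by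
      refine Finset.prod_dvd_of_coprime (fun i _ j _ hij => ?_) fun i _ => ?_
      · exact Polynomial.isCoprime_X_sub_C_of_isUnit_sub (sub_ne_zero.mpr hij).isUnit
      · exact Polynomial.dvd_iff_isRoot.mpr (hf i)
    have hmonic : (Polynomial.X ^ p - Polynomial.X : Polynomial (ZMod p)).Monic :=
      Polynomial.monic_X_pow_sub (by simpa using hp.out.one_lt)
    have hroots := FiniteField.roots_X_pow_card_sub_X (ZMod p)
    rw [ZMod.card] at hroots
    have hprod := Polynomial.prod_multiset_X_sub_C_of_monic_of_roots_card_eq hmonic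
      (by rw [FiniteField.X_pow_card_sub_X_natDegree_eq _ hp.out.one_lt, hroots,
        Finset.card_val, Finset.card_univ, ZMod.card])
    rw [hroots] at hprod
    rw [Finset.prod, hprod] at hdvd
    obtain ⟨c, rfl⟩ := hdvd
    simp [hh]
  -- Lagrange interpolation: by Fermat this is the indicator function of `i` on `ZMod p`.
  let L : ZMod p → Polynomial (ZMod p) := fun i => 1 - (Polynomial.X - Polynomial.C i) ^ (p - 1)
  have hL (i j : ZMod p) : (L i).eval j = if i = j then 1 else 0 := by
    simp only [L, Polynomial.eval_sub, Polynomial.eval_one, Polynomial.eval_pow, Polynomial.eval_X,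
      Polynomial.eval_C]
    split_ifs with hij
    · rw [hij, sub_self, zero_pow (Nat.sub_ne_zero_of_lt hp.out.one_lt), sub_zero]
    · rw [ZMod.pow_card_sub_one_eq_one (sub_ne_zero.mpr (Ne.symm hij)), sub_self]
  have h1 (i : ZMod p) : h * Polynomial.aeval h (L i) = κ i • Polynomial.aeval h (L i) := by
    have h2 := hvanish ((Polynomial.X - Polynomial.C i) * L i) fun j => by
      rw [Polynomial.eval_mul, hL]
      split_ifs with hij <;> simp [hij]
    rw [map_mul, map_sub, Polynomial.aeval_X, Polynomial.aeval_C, sub_mul, sub_eq_zero] at h2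
    rw [h2, hsmul]
  refine ⟨fun i => Polynomial.aeval h (L i), ?_, h1, fun i => ?_⟩
  · have h2 := hvanish (∑ i, L i - 1) fun j => by simp [Polynomial.eval_finsetSum, hL]
    rw [map_sub, map_sum, map_one, sub_eq_zero] at h2
    exact h2
  · have h2 : Polynomial.aeval h (L i) * h = h * Polynomial.aeval h (L i) := by
      have h3 : Polynomial.aeval h (L i * Polynomial.X) = Polynomial.aeval h (Polynomial.X * L i) := by
        rw [mul_comm]
      simpa using h3
    rw [h2, h1]

end Spectral

/-! ### Powers with exponents in `ZMod p` -/

section ZModPowers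

variable {A : Type*} [Ring A] {p : ℕ} [hp : Fact p.Prime] {g : A}

/-- The power `g ^ i` of an element of order `p` with exponent `i` in `ZMod p`. -/
def zpow' (g : A) (i : ZMod p) : A := g ^ i.val

lemma zpow'_zero : zpow' g (0 : ZMod p) = 1 := by simp [zpow']

lemma zpow'_one : zpow' g (1 : ZMod p) = g := by
  have : Fact (1 < p) := ⟨hp.out.one_lt⟩
  simp [zpow', ZMod.val_one]

omit hp in
lemma map_zpow' {B F : Type*} [Ring B] [FunLike F A B] [MonoidHomClass F A B] (f : F)
    (i : ZMod p) : f (zpow' g i) = zpow' (f g) i := by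
  rw [zpow', map_pow, zpow']

lemma zpow'_natCast (hg : g ^ p = 1) (m : ℕ) : zpow' g (m : ZMod p) = g ^ m := by
  rw [zpow', ZMod.val_natCast, ← pow_eq_pow_mod m hg]

lemma zpow'_add (hg : g ^ p = 1) (i j : ZMod p) :
    zpow' g (i + j) = zpow' g i * zpow' g j := by
  rw [zpow', ZMod.val_add, ← pow_eq_pow_mod _ hg, pow_add, zpow', zpow']

lemma zpow'_mul_neg (hg : g ^ p = 1) (i : ZMod p) : zpow' g i * zpow' g (-i) = 1 := by
  rw [← zpow'_add hg, add_neg_cancel, zpow'_zero]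

lemma zpow'_neg_mul (hg : g ^ p = 1) (i : ZMod p) : zpow' g (-i) * zpow' g i = 1 := by
  rw [← zpow'_add hg, neg_add_cancel, zpow'_zero]

lemma zpow'_eq_of_mul_eq_one (hg : g ^ p = 1) {i : ZMod p} {x : A} (h : zpow' g i * x = 1) :
    zpow' g (-i) = x := by
  rw [← mul_one (zpow' g (-i)), ← h, ← mul_assoc, zpow'_neg_mul hg, one_mul]

omit hp in
lemma Commute.zpow'_right' {x : A} (h : Commute x g) (i : ZMod p) : Commute x (zpow' g i) :=
  h.pow_right _

lemma units_zpow_eq (v : Aˣ) (hv : (v : A) = g) (hg : g ^ p = 1) (z : ℤ) :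
    ((v ^ z : Aˣ) : A) = zpow' g (z : ZMod p) := by
  subst hv
  rcases Int.eq_nat_or_neg z with ⟨m, rfl | rfl⟩
  · rw [zpow_natCast, Units.val_pow_eq_pow_val, Int.cast_natCast, zpow'_natCast hg]
  · rw [Int.cast_neg, Int.cast_natCast]
    refine (zpow'_eq_of_mul_eq_one hg ?_).symm
    rw [zpow'_natCast hg, ← Units.val_pow_eq_pow_val, ← Units.val_mul, zpow_neg, zpow_natCast,
      mul_inv_cancel, Units.val_one]

end ZModPowers

/-! ### The binomial series truncated at `z ^ p = 0` -/

section BinomialExpansion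

variable {R A : Type*} [CommRing R] [Ring A] [Algebra R A] {p : ℕ} [hp : Fact p.Prime]
  (κ : ZMod p →+* R)

/-- The coefficient of `z ^ r` in `(1 - z) ^ (-m)`. -/
def negBinom (m : ZMod p) (r : ℕ) : ZMod p := risingFactorial m r * (r.factorial : ZMod p)⁻¹

lemma negBinom_zero_right (m : ZMod p) : negBinom m 0 = 1 := by
  simp [negBinom, risingFactorial]

lemma negBinom_zero_left (r : ℕ) : negBinom (0 : ZMod p) (r + 1) = 0 := by
  rw [negBinom, risingFactorial_succ_left, zero_mul, zero_mul]

/-- Pascal's rule, the coefficient form of `(1 - z) (1 - z) ^ (-(m + 1)) = (1 - z) ^ (-m)`. The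
bound makes `r + 1` invertible. -/
lemma negBinom_add_one_succ (m : ZMod p) {r : ℕ} (hr : r + 1 < p) :
    negBinom (m + 1) (r + 1) - negBinom (m + 1) r = negBinom m (r + 1) := by
  have h1 : ((r + 1).factorial : ZMod p) ≠ 0 := factorial_cast_ne_zero hr
  have h2 : (r.factorial : ZMod p) ≠ 0 := factorial_cast_ne_zero (by omega)
  rw [negBinom, negBinom, negBinom, risingFactorial_succ_left m, risingFactorial_succ]
  rw [Nat.factorial_succ] at h1 ⊢
  push_cast at h1 ⊢
  have h3 : (r + 1 : ZMod p) ≠ 0 := left_ne_zero_of_mul h1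
  field_simp
  ring

lemma negBinom_reflect (m : ZMod p) (r : ℕ) :
    negBinom (-(m + (r : ZMod p))) r = (-1) ^ r * negBinom (m + 1) r := by
  rw [negBinom, risingFactorial_reflect, negBinom, mul_assoc]

lemma negBinom_one_sub {r : ℕ} (hr : r ≠ 0) : negBinom (1 - (r : ZMod p)) r = 0 := by
  obtain ⟨m, rfl⟩ := Nat.exists_eq_succ_of_ne_zero hr
  rw [negBinom, Nat.succ_eq_add_one, risingFactorial_succ]
  push_cast
  ring

variable {z : A} (hz : z ^ p = 0)
include hz

/-- The binomial expansion of `(1 - z) ^ (-m)` for `z ^ p = 0`, `m` in `ZMod p`. -/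
lemma zpow'_one_sub_neg (m : ZMod p) :
    zpow' (1 - z) (-m) = ∑ r ∈ range p, κ (negBinom m r) • z ^ r := by
  have hg := one_sub_pow_char κ hz
  set E : ZMod p → A := fun m => ∑ r ∈ range p, κ (negBinom m r) • z ^ r with hE
  obtain ⟨P, hP⟩ := Nat.exists_eq_succ_of_ne_zero hp.out.ne_zero
  have hrange : range p = range (P + 1) := congrArg range hP
  have hE' (m : ZMod p) : E m = (∑ r ∈ range P, κ (negBinom m (r + 1)) • z ^ (r + 1)) + 1 := by
    rw [hE]
    simp only
    rw [hrange, Finset.sum_range_succ', negBinom_zero_right]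
    simp
  -- Truncation is harmless: the one term beyond the range carries `z ^ p = 0`.
  have hstep (m : ZMod p) : (1 - z) * E (m + 1) = E m := by
    have h1 : z * E (m + 1) = ∑ r ∈ range P, κ (negBinom (m + 1) r) • z ^ (r + 1) := by
      rw [hE]
      simp only
      rw [hrange, Finset.mul_sum, Finset.sum_range_succ, mul_smul_comm,
        ← pow_succ', ← Nat.succ_eq_add_one, ← hP, hz, smul_zero, add_zero]
      exact Finset.sum_congr rfl fun r _ => by rw [mul_smul_comm, ← pow_succ']
    rw [sub_mul, one_mul, h1, hE', hE', add_sub_right_comm, ← Finset.sum_sub_distrib]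
    congr 1
    refine Finset.sum_congr rfl fun r hr => ?_
    rw [← sub_smul, ← map_sub, negBinom_add_one_succ m (by rw [Finset.mem_range] at hr; omega)]
  have hnat (m : ℕ) : (1 - z) ^ m * E m = 1 := by
    induction m with
    | zero =>
      rw [hE']
      simp [negBinom_zero_left]
    | succ m ih => rw [pow_succ, mul_assoc, Nat.cast_succ, hstep, ih]
  refine zpow'_eq_of_mul_eq_one hg ?_
  have h2 := hnat m.val
  rwa [ZMod.natCast_zmod_val] at h2

end BinomialExpansion

/-! ### Conjugation by powers of `1 - z` -/

section Conjugation

variable {R A : Type*} [CommRing R] [Ring A] [Algebra R A] {p : ℕ} [hp : Fact p.Prime]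
  (κ : ZMod p →+* R)

/-- The inner derivation of `z`. -/
def innerDer (R : Type*) {A : Type*} [CommRing R] [Ring A] [Algebra R A] (z : A) :
    Module.End R A := LinearMap.mulLeft R z - LinearMap.mulRight R z

lemma innerDer_apply (z x : A) : innerDer R z x = z * x - x * z := rfl

include κ in
lemma innerDer_pow_char {z : A} (hz : z ^ p = 0) : innerDer R z ^ p = 0 := by
  rcases subsingleton_or_nontrivial A with h | h
  · exact Subsingleton.elim _ _
  have := charP_of_zmodHom (B := Module.End R A) κ
  rw [innerDer, sub_pow_char_of_commute p (LinearMap.commute_mulLeft_right z z),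
    LinearMap.pow_mulLeft, LinearMap.pow_mulRight, hz]
  simp

variable {z : A} (hz : z ^ p = 0)
include hz

/-- Conjugation is a power of one operator: `x ↦ g⁻¹ x g` equals `1 - Y` with `Y = -g⁻¹ ad z`. Since
`Y ^ p = 0`, the binomial expansion applies to `(1 - Y) ^ (-m)`, which is `x ↦ g ^ m x g ^ (-m)`. -/
lemma zpow'_conj_left (m : ZMod p) (x : A) :
    zpow' (1 - z) m * x * zpow' (1 - z) (-m) =
      ∑ r ∈ range p, κ (negBinom m r) •
        ((-1) ^ r * (zpow' (1 - z) (-r : ZMod p) * (innerDer R z ^ r) x)) := by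
  have hg := one_sub_pow_char κ hz
  set g := 1 - z with hgdef
  set g' := zpow' g (-1 : ZMod p) with hg'
  have hgg' : g * g' = 1 := by
    have := zpow'_mul_neg hg 1
    rwa [zpow'_one] at this
  have hg'g : g' * g = 1 := by
    have := zpow'_neg_mul hg 1
    rwa [zpow'_one] at this
  have hzg : Commute z g := (Commute.one_right z).sub_right (Commute.refl z)
  have hzg' : Commute z g' := Commute.zpow'_right' hzg _
  set Y : Module.End R A := LinearMap.mulLeft R (-g') * innerDer R z with hY
  have hcomm : Commute (LinearMap.mulLeft R (-g')) (innerDer R z) := by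
    refine LinearMap.ext fun x => ?_
    simp only [Module.End.mul_apply, LinearMap.mulLeft_apply, innerDer_apply, mul_sub]
    rw [← mul_assoc, ← hzg'.neg_right.eq, mul_assoc, mul_assoc]
  have hYp (r : ℕ) (x : A) :
      (Y ^ r) x = (-1) ^ r * (zpow' g (-r : ZMod p) * (innerDer R z ^ r) x) := by
    rw [hY, hcomm.mul_pow, Module.End.mul_apply, LinearMap.pow_mulLeft, LinearMap.mulLeft_apply,
      neg_pow, mul_assoc]
    congr 2
    refine (zpow'_eq_of_mul_eq_one hg ?_).symm
    rw [zpow'_natCast hg, ← (show Commute g g' from hgg'.trans hg'g.symm).mul_pow, hgg', one_pow]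
  have hY0 : Y ^ p = 0 := by
    rw [hY, hcomm.mul_pow, innerDer_pow_char κ hz, mul_zero]
  have h1 : 1 - Y = LinearMap.mulLeft R g' * LinearMap.mulRight R g := by
    refine LinearMap.ext fun x => ?_
    simp only [hY, LinearMap.sub_apply, Module.End.one_apply, Module.End.mul_apply,
      LinearMap.mulLeft_apply, innerDer_apply, LinearMap.mulRight_apply]
    have h2 : x - -g' * (z * x - x * z) = g' * (g * x + (z * x - x * z)) := by
      rw [mul_add, ← mul_assoc, hg'g, one_mul, neg_mul, sub_neg_eq_add]
    rw [h2, hgdef]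
    noncomm_ring
  have h4 := zpow'_one_sub_neg κ hY0 m
  have h5 : zpow' (1 - Y) (-m) = LinearMap.mulLeft R (zpow' g m) *
      LinearMap.mulRight R (zpow' g (-m)) := by
    refine zpow'_eq_of_mul_eq_one (one_sub_pow_char κ hY0) ?_
    rw [h1, zpow', (LinearMap.commute_mulLeft_right g' g).mul_pow, LinearMap.pow_mulLeft,
      LinearMap.pow_mulRight]
    refine LinearMap.ext fun x => ?_
    simp only [Module.End.mul_apply, LinearMap.mulLeft_apply, LinearMap.mulRight_apply,
      Module.End.one_apply]
    change g' ^ m.val * (zpow' g m * (x * zpow' g (-m)) * zpow' g m) = x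
    rw [mul_assoc (zpow' g m), mul_assoc x, zpow'_neg_mul hg, mul_one, ← mul_assoc, zpow',
      ← (show Commute g' g from hg'g.trans hgg'.symm).mul_pow, hg'g, one_pow, one_mul]
  rw [h5] at h4
  have h6 := LinearMap.congr_fun h4 x
  rw [Module.End.mul_apply, LinearMap.mulLeft_apply, LinearMap.mulRight_apply, ← mul_assoc,
    LinearMap.sum_apply] at h6
  rw [h6]
  refine Finset.sum_congr rfl fun r _ => ?_
  rw [LinearMap.smul_apply, hYp]

/-- The mirror argument with `x ↦ g x g⁻¹` and `Y = (ad z) · g⁻¹`; it moves a power of `g` from the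
left of `x` to the right. -/
lemma zpow'_conj_right (m : ZMod p) (x : A) :
    zpow' (1 - z) (-m) * x =
      ∑ r ∈ range p, κ (negBinom m r) •
        ((innerDer R z ^ r) x * (zpow' (1 - z) (-r : ZMod p) * zpow' (1 - z) (-m))) := by
  have hg := one_sub_pow_char κ hz
  set g := 1 - z with hgdef
  set g' := zpow' g (-1 : ZMod p) with hg'
  have hgg' : g * g' = 1 := by
    have := zpow'_mul_neg hg 1
    rwa [zpow'_one] at this
  have hg'g : g' * g = 1 := by
    have := zpow'_neg_mul hg 1
    rwa [zpow'_one] at this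
  have hzg : Commute z g := (Commute.one_right z).sub_right (Commute.refl z)
  have hzg' : Commute z g' := Commute.zpow'_right' hzg _
  set Y : Module.End R A := LinearMap.mulRight R g' * innerDer R z with hY
  have hcomm : Commute (LinearMap.mulRight R g') (innerDer R z) := by
    refine LinearMap.ext fun x => ?_
    simp only [Module.End.mul_apply, LinearMap.mulRight_apply, innerDer_apply, sub_mul]
    rw [mul_assoc x z, hzg'.eq, mul_assoc, mul_assoc]
  have hYp (r : ℕ) (x : A) : (Y ^ r) x = (innerDer R z ^ r) x * zpow' g (-r : ZMod p) := by
    rw [hY, hcomm.mul_pow, Module.End.mul_apply, LinearMap.pow_mulRight, LinearMap.mulRight_apply]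
    congr 1
    refine (zpow'_eq_of_mul_eq_one hg ?_).symm
    rw [zpow'_natCast hg, ← (show Commute g g' from hgg'.trans hg'g.symm).mul_pow, hgg', one_pow]
  have hY0 : Y ^ p = 0 := by
    rw [hY, hcomm.mul_pow, innerDer_pow_char κ hz, mul_zero]
  have h1 : 1 - Y = LinearMap.mulLeft R g * LinearMap.mulRight R g' := by
    refine LinearMap.ext fun x => ?_
    simp only [hY, LinearMap.sub_apply, Module.End.one_apply, Module.End.mul_apply,
      LinearMap.mulLeft_apply, innerDer_apply, LinearMap.mulRight_apply]
    have h2 : x - (z * x - x * z) * g' = (x * g - (z * x - x * z)) * g' := by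
      rw [sub_mul (x * g), mul_assoc x g, hgg', mul_one]
    rw [h2, hgdef]
    noncomm_ring
  have h4 := zpow'_one_sub_neg κ hY0 m
  have h5 : zpow' (1 - Y) (-m) = LinearMap.mulLeft R (zpow' g (-m)) *
      LinearMap.mulRight R (zpow' g m) := by
    refine zpow'_eq_of_mul_eq_one (one_sub_pow_char κ hY0) ?_
    rw [h1, zpow', (LinearMap.commute_mulLeft_right g g').mul_pow, LinearMap.pow_mulLeft,
      LinearMap.pow_mulRight]
    refine LinearMap.ext fun x => ?_
    simp only [Module.End.mul_apply, LinearMap.mulLeft_apply, LinearMap.mulRight_apply,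
      Module.End.one_apply]
    change zpow' g m * (zpow' g (-m) * (x * zpow' g m) * g' ^ m.val) = x
    rw [mul_assoc (zpow' g (-m)), mul_assoc x, ← mul_assoc, zpow'_mul_neg hg, one_mul, zpow',
      ← (show Commute g g' from hgg'.trans hg'g.symm).mul_pow, hgg', one_pow, mul_one]
  rw [h5] at h4
  have h6 := congrArg (· * zpow' g (-m)) (LinearMap.congr_fun h4 x)
  simp only [Module.End.mul_apply, LinearMap.mulLeft_apply, LinearMap.mulRight_apply,
    LinearMap.sum_apply] at h6
  rw [mul_assoc, mul_assoc x, zpow'_mul_neg hg, mul_one, Finset.sum_mul] at h6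
  rw [h6]
  refine Finset.sum_congr rfl fun r _ => ?_
  rw [LinearMap.smul_apply, hYp, smul_mul_assoc, mul_assoc]

end Conjugation

/-! ### The element `∑ P i (1 - z) ^ i`, its inverse and conjugation by it -/

section TwistElement

variable {R A : Type*} [CommRing R] [Ring A] [Algebra R A] {p : ℕ} [hp : Fact p.Prime]
  {κ : ZMod p →+* R} {h z : A} {P : ZMod p → A}

lemma IsSpectral.mul_pow (hP : IsSpectral κ h P) (hhz : h * z - z * h = z) (i : ZMod p) (s : ℕ) :
    P i * z ^ s = z ^ s * P (i - s) := by
  induction s generalizing i with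
  | zero => simp
  | succ s ih =>
    have h1 := hP.shift (a := 1) (by rw [hhz, map_one, one_smul]) i
    rw [pow_succ', ← mul_assoc, h1, mul_assoc, ih, ← mul_assoc]
    push_cast
    rw [sub_sub, add_comm (1 : ZMod p)]

/-- Since `z` raises weights by one, only the term `z ^ r` with `r ≡ i - j` of the binomial
expansion survives, and there is one such `r` below `p`. -/
lemma IsSpectral.sandwich (hP : IsSpectral κ h P) (hhz : h * z - z * h = z) (hz : z ^ p = 0)
    (m i j : ZMod p) : P i * zpow' (1 - z) m * P j =
      κ (negBinom (-m) (i - j).val) • (z ^ (i - j).val * P j) := by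
  have h1 := zpow'_one_sub_neg κ hz (-m)
  rw [neg_neg] at h1
  rw [h1, Finset.mul_sum, Finset.sum_mul, Finset.sum_eq_single_of_mem (i - j).val
    (Finset.mem_range.mpr (ZMod.val_lt _))]
  · rw [mul_smul_comm, hP.mul_pow hhz, ZMod.natCast_zmod_val, sub_sub_cancel, smul_mul_assoc,
      mul_assoc, hP.mul_self]
  · intro r hr hne
    rw [mul_smul_comm, hP.mul_pow hhz, smul_mul_assoc, mul_assoc, hP.mul_of_ne, mul_zero, smul_zero]
    intro hc
    refine hne ?_
    have h2 : i - j = (r : ZMod p) := by rw [← hc]; ring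
    rw [h2, ZMod.val_natCast, Nat.mod_eq_of_lt (Finset.mem_range.mp hr)]

/-- The element `∑ i, P i * (1 - z) ^ i`. -/
def twistElt (P : ZMod p → A) (z : A) : A := ∑ i, P i * zpow' (1 - z) i

lemma IsSpectral.mul_twistElt (hP : IsSpectral κ h P) (i : ZMod p) :
    P i * twistElt P z = P i * zpow' (1 - z) i := by
  rw [twistElt, Finset.mul_sum, Finset.sum_eq_single_of_mem i (Finset.mem_univ i), ← mul_assoc,
    hP.mul_self]
  intro j _ hj
  rw [← mul_assoc, hP.mul_of_ne hj.symm, zero_mul]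

/-- Rewrites the element with the projections on the right. Entrywise both sides are multiples of `z
^ r`, and the coefficients agree by the reflection formula for rising factorials. -/
lemma IsSpectral.twistElt_neg_eq (hP : IsSpectral κ h P) (hhz : h * z - z * h = z)
    (hz : z ^ p = 0) : twistElt P (-z) = ∑ j, zpow' (1 - z) (-(j + 1)) * P j := by
  have hz' : (-z) ^ p = 0 := by rw [neg_pow, hz, mul_zero]
  have hhz' : h * -z - -z * h = -z := by
    conv_rhs => rw [← hhz]
    noncomm_ring
  refine hP.ext_of fun i j => ?_
  have h1 : (∑ j, zpow' (1 - z) (-(j + 1)) * P j) * P j = zpow' (1 - z) (-(j + 1)) * P j := by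
    rw [Finset.sum_mul, Finset.sum_eq_single_of_mem j (Finset.mem_univ j), mul_assoc, hP.mul_self]
    intro l _ hl
    rw [mul_assoc, hP.mul_of_ne hl, mul_zero]
  rw [hP.mul_twistElt, mul_assoc (P i) (∑ j, _), h1, ← mul_assoc, hP.sandwich hhz' hz',
    hP.sandwich hhz hz, neg_neg, neg_pow, mul_assoc]
  set r := (i - j).val with hr
  have h2 : -i = -(j + (r : ZMod p)) := by
    rw [hr, ZMod.natCast_zmod_val]; ring
  rw [h2, negBinom_reflect, map_mul, map_pow, map_neg, map_one, mul_smul]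
  rcases Nat.even_or_odd r with hr | hr <;> simp [hr.neg_one_pow]

/-- The entry of weight difference `r` of the product is the coefficient of `z ^ r` in `(1 - z) ^ (r
- 1)`, which is zero for `0 < r < p`. -/
lemma IsSpectral.twistElt_mul (hP : IsSpectral κ h P) (hhz : h * z - z * h = z)
    (hz : z ^ p = 0) : twistElt P z * twistElt P (-z) = 1 := by
  refine hP.ext_of fun i j => ?_
  have h1 : (∑ j, zpow' (1 - z) (-(j + 1)) * P j) * P j = zpow' (1 - z) (-(j + 1)) * P j := by
    rw [Finset.sum_mul, Finset.sum_eq_single_of_mem j (Finset.mem_univ j), mul_assoc, hP.mul_self]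
    intro l _ hl
    rw [mul_assoc, hP.mul_of_ne hl, mul_zero]
  rw [hP.twistElt_neg_eq hhz hz, ← mul_assoc, hP.mul_twistElt, mul_assoc, h1, mul_assoc,
    ← mul_assoc (zpow' _ _), ← zpow'_add (one_sub_pow_char κ hz), ← mul_assoc,
    hP.sandwich hhz hz, mul_one, hP.mul_eq]
  split_ifs with hij
  · subst hij
    simp [negBinom_zero_right]
  · set r := (i - j).val with hr
    have h2 : -(i + -(j + 1)) = 1 - (r : ZMod p) := by
      rw [hr, ZMod.natCast_zmod_val]; ring
    have h3 : r ≠ 0 := by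
      rw [hr, Ne, ZMod.val_eq_zero]
      exact sub_ne_zero.mpr hij
    rw [h2, negBinom_one_sub h3, map_zero, zero_smul]

-- As `[h, g] = g - 1` commutes with `g`, the commutator of `h` with `g ^ m` is computed as for a
-- derivation.
variable (κ) in
lemma mul_zpow'_eq (hhz : h * z - z * h = z) (hz : z ^ p = 0) (m : ZMod p) :
    h * zpow' (1 - z) m = zpow' (1 - z) m * h +
      κ m • (zpow' (1 - z) m - zpow' (1 - z) (m - 1)) := by
  have hg := one_sub_pow_char κ hz
  set g := 1 - z with hgdef
  have hhg : h * g = g * h + (g - 1) := by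
    have h1 : h * z = z + z * h := sub_eq_iff_eq_add.mp hhz
    rw [hgdef, mul_sub, h1]
    noncomm_ring
  clear_value g
  have hnat (m : ℕ) : h * zpow' g (m : ZMod p) = zpow' g (m : ZMod p) * h +
      (m : A) * (zpow' g (m : ZMod p) - zpow' g ((m : ZMod p) - 1)) := by
    induction m with
    | zero => simp [zpow'_zero]
    | succ m ih =>
      have h1 : zpow' g ((m + 1 : ℕ) : ZMod p) = zpow' g (m : ZMod p) * g := by
        rw [Nat.cast_succ, zpow'_add hg, zpow'_one]
      have h2 : zpow' g ((m : ZMod p) - 1) * g = zpow' g (m : ZMod p) := by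
        have h3 := zpow'_add hg ((m : ZMod p) - 1) 1
        rw [sub_add_cancel, zpow'_one] at h3
        exact h3.symm
      have h4 : ((m + 1 : ℕ) : ZMod p) - 1 = m := by push_cast; ring
      rw [h1, ← mul_assoc, ih, h4, add_mul, mul_assoc _ h g, hhg, mul_assoc, sub_mul, h2]
      push_cast
      noncomm_ring
  have h5 := hnat m.val
  rw [ZMod.natCast_zmod_val] at h5
  rw [h5, ← nsmul_eq_mul]
  conv_rhs => rw [← ZMod.natCast_zmod_val m, map_natCast, Nat.cast_smul_eq_nsmul,
    ZMod.natCast_zmod_val]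

/-- Turns the scalars `(j + 1) ^ ⟨m⟩` attached to the weights into the element `(h + 1) ^ ⟨m⟩`, at
the price of `g ^ (-m)`; each new factor lowers the exponent of `g` by one. -/
lemma IsSpectral.risingFactorial_mul_sum (hP : IsSpectral κ h P) (hhz : h * z - z * h = z)
    (hz : z ^ p = 0) (m : ℕ) :
    risingFactorial (h + 1) m * ∑ j, zpow' (1 - z) (-(j + 1)) * P j =
      ∑ j, κ (risingFactorial (j + 1) m) •
        (zpow' (1 - z) (-m : ZMod p) * zpow' (1 - z) (-(j + 1)) * P j) := by
  have hg := one_sub_pow_char κ hz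
  induction m with
  | zero => simp [risingFactorial, zpow'_zero]
  | succ m ih =>
    rw [risingFactorial_succ, (risingFactorial_commute_add _ _ _).eq, mul_assoc, ih, Finset.mul_sum]
    refine Finset.sum_congr rfl fun j _ => ?_
    rw [risingFactorial_succ, map_mul, mul_smul, mul_smul_comm]
    congr 1
    rw [← zpow'_add hg, ← zpow'_add hg, ← mul_assoc, add_assoc, add_mul,
      mul_zpow'_eq κ hhz hz, add_mul, add_mul, mul_assoc _ h, hP.mul_left, mul_smul_comm]
    have h1 : (-(m : ZMod p) + -(j + 1)) = -(j + 1 + m) := by ring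
    have h2 : (-((m + 1 : ℕ) : ZMod p) + -(j + 1)) = -(j + 1 + m) - 1 := by push_cast; ring
    have h3 (x : A) : ((1 : A) + m) * x = κ (1 + m) • x := by
      rw [map_add, map_one, map_natCast, add_smul, one_smul, Nat.cast_smul_eq_nsmul, add_mul,
        one_mul, nsmul_eq_mul]
    rw [h1, h2, mul_assoc (1 + (m : A)), h3, smul_mul_assoc, sub_mul, smul_sub]
    simp only [map_neg, map_add, map_one, map_natCast]
    module

/-- The antipode of the twisted structure, evaluated on an eigenvector `x` of `ad h`. -/
lemma IsSpectral.twistElt_conj (hP : IsSpectral κ h P) (hhz : h * z - z * h = z)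
    (hz : z ^ p = 0) {x : A} {a : ZMod p} (hx : h * x - x * h = κ a • x) :
    twistElt P (-z) * x * twistElt P z = zpow' (1 - z) (-a) *
      ∑ r ∈ range p, κ ((r.factorial : ZMod p)⁻¹) •
        ((innerDer R z ^ r) x * risingFactorial (h + 1) r) := by
  have hg := one_sub_pow_char κ hz
  have hz' : (-z) ^ p = 0 := by rw [neg_pow, hz, mul_zero]
  have hhz' : h * -z - -z * h = -z := by
    conv_rhs => rw [← hhz]
    noncomm_ring
  have h1 : twistElt P (-z) * x = zpow' (1 - z) (-a) * ∑ i, zpow' (1 - z) (-(i + 1)) * x * P i := by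
    rw [hP.twistElt_neg_eq hhz hz, Finset.sum_mul, Finset.mul_sum]
    refine Fintype.sum_equiv (Equiv.subRight a) _ _ fun j => ?_
    rw [mul_assoc, hP.shift hx, Equiv.subRight_apply, ← mul_assoc, ← mul_assoc, ← mul_assoc,
      ← zpow'_add hg]
    congr 3
    ring
  -- Moving the powers of `g` to the right of `x` reproduces exactly the sums of the preceding
  -- lemma, so `twistElt P (-z)` splits off on the right and cancels against `twistElt P z`.
  have h2 : ∑ i, zpow' (1 - z) (-(i + 1)) * x * P i =
      (∑ r ∈ range p, κ ((r.factorial : ZMod p)⁻¹) •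
        ((innerDer R z ^ r) x * risingFactorial (h + 1) r)) * twistElt P (-z) := by
    have h0 (i : ZMod p) : zpow' (1 - z) (-(i + 1)) * x * P i = ∑ r ∈ range p,
        κ (negBinom (i + 1) r) • ((innerDer R z ^ r) x *
          (zpow' (1 - z) (-r : ZMod p) * zpow' (1 - z) (-(i + 1)))) * P i := by
      rw [zpow'_conj_right κ hz (i + 1) x, Finset.sum_mul]
    rw [Finset.sum_congr rfl fun i _ => h0 i, Finset.sum_comm, Finset.sum_mul]
    refine Finset.sum_congr rfl fun r _ => ?_
    rw [smul_mul_assoc, mul_assoc, hP.twistElt_neg_eq hhz hz, hP.risingFactorial_mul_sum hhz hz,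
      Finset.mul_sum, Finset.smul_sum]
    refine Finset.sum_congr rfl fun i _ => ?_
    rw [smul_mul_assoc, negBinom, mul_comm, map_mul, mul_smul, mul_smul_comm, ← mul_assoc,
      ← mul_assoc, ← mul_assoc]
  have h3 : twistElt P (-z) * twistElt P z = 1 := by
    have := hP.twistElt_mul hhz' hz'
    rwa [neg_neg] at this
  rw [h1, h2, mul_assoc, mul_assoc, h3, mul_one]

end TwistElement

/-! ### Conjugated homomorphisms -/

section ConjugateHom

variable {R A B : Type*} [CommRing R] [Ring A] [Algebra R A] [Ring B] [Algebra R B]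

/-- The algebra homomorphism `a ↦ u * f a * u⁻¹`. -/
def conjHom (f : A →ₐ[R] B) (u u' : B) (h : u * u' = 1) (h' : u' * u = 1) : A →ₐ[R] B where
  toFun a := u * f a * u'
  map_one' := by rw [map_one, mul_one, h]
  map_mul' a b := by
    have h1 : u * f a * u' * (u * f b * u') = u * f a * (u' * u) * f b * u' := by
      simp only [mul_assoc]
    rw [h1, h', mul_one, map_mul]
    simp only [mul_assoc]
  map_zero' := by rw [map_zero, mul_zero, zero_mul]
  map_add' a b := by rw [map_add, mul_add, add_mul]
  commutes' r := by rw [AlgHom.commutes, ← Algebra.commutes, mul_assoc, h, mul_one]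

end ConjugateHom

/-! ### The twisted coproduct and counit -/

/-- A bialgebra with antihomomorphism generated by primitive elements, together with the elements
`h` and `z` and the eigenprojections of `h` that define a twist. -/
structure TwistData (R A : Type*) [CommRing R] [Ring A] [Algebra R A] (p : ℕ)
    [Fact p.Prime] where
  /-- The prime field in the base ring. -/
  κ : ZMod p →+* R
  /-- The primitive generators. -/
  X : Set A
  adjoin_eq : Algebra.adjoin R X = ⊤
  /-- The primitive coproduct. -/
  comul : A →ₐ[R] A ⊗[R] A
  /-- The counit. -/
  counit : A →ₐ[R] R
  /-- The antipode of the primitive coproduct. -/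
  antipode : A →ₐ[R] Aᵐᵒᵖ
  comul_apply : ∀ x ∈ X, comul x = x ⊗ₜ[R] 1 + 1 ⊗ₜ[R] x
  counit_apply : ∀ x ∈ X, counit x = 0
  antipode_apply : ∀ x ∈ X, antipode x = MulOpposite.op (-x)
  /-- The toral element of the twist. -/
  h : A
  /-- The nilpotent element of the twist. -/
  z : A
  h_mem : h ∈ Submodule.span R X
  z_mem : z ∈ Submodule.span R X
  /-- The eigenprojections of `h`. -/
  P : ZMod p → A
  spectral : IsSpectral κ h P
  lie : h * z - z * h = z
  pow_z : z ^ p = 0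

namespace TwistData

variable {R A : Type*} [CommRing R] [Ring A] [Algebra R A] {p : ℕ} [hp : Fact p.Prime]
  (T : TwistData R A p)

/-- The group-like element of the twisted coproduct. -/
def g : A := 1 - T.z

lemma g_pow : T.g ^ p = 1 := one_sub_pow_char T.κ T.pow_z

/-- The twist. -/
def F : A ⊗[R] A := ∑ i, T.P i ⊗ₜ[R] zpow' T.g i

/-- The inverse of the twist. -/
def F' : A ⊗[R] A := ∑ i, T.P i ⊗ₜ[R] zpow' T.g (-i)

lemma F_mul_tmul_mul_F' (x y : A) : T.F * (x ⊗ₜ[R] y) * T.F' =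
    ∑ i, ∑ j, (T.P i * x * T.P j) ⊗ₜ[R] (zpow' T.g i * y * zpow' T.g (-j)) := by
  simp only [F, F', Finset.sum_mul, Finset.mul_sum, Algebra.TensorProduct.tmul_mul_tmul]
  rw [Finset.sum_comm]

lemma F_mul_one_tmul_mul_F' (y : A) : T.F * (1 ⊗ₜ[R] y) * T.F' =
    ∑ i, T.P i ⊗ₜ[R] (zpow' T.g i * y * zpow' T.g (-i)) := by
  rw [F_mul_tmul_mul_F']
  refine Finset.sum_congr rfl fun i _ => ?_
  rw [Finset.sum_eq_single_of_mem i (Finset.mem_univ i), mul_one, T.spectral.mul_self]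
  intro j _ hj
  rw [mul_one, T.spectral.mul_of_ne hj.symm, TensorProduct.zero_tmul]

lemma F_mul_F' : T.F * T.F' = 1 := by
  have h1 := T.F_mul_one_tmul_mul_F' 1
  rw [← Algebra.TensorProduct.one_def, mul_one] at h1
  simp_rw [mul_one, zpow'_mul_neg T.g_pow] at h1
  rw [h1, ← TensorProduct.sum_tmul, T.spectral.sum_eq, Algebra.TensorProduct.one_def]

lemma F'_mul_F : T.F' * T.F = 1 := by
  simp only [F, F', Finset.sum_mul, Finset.mul_sum, Algebra.TensorProduct.tmul_mul_tmul,
    T.spectral.mul_eq]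
  have h1 (i : ZMod p) : ∑ j, (if j = i then T.P i else 0) ⊗ₜ[R] (zpow' T.g (-j) * zpow' T.g i) =
      T.P i ⊗ₜ[R] (1 : A) := by
    rw [Finset.sum_eq_single_of_mem i (Finset.mem_univ i), if_pos rfl, zpow'_neg_mul T.g_pow]
    intro j _ hj
    rw [if_neg hj, TensorProduct.zero_tmul]
  simp_rw [h1]
  rw [← TensorProduct.sum_tmul, T.spectral.sum_eq, Algebra.TensorProduct.one_def]

/-- Passing `x` shifts the weight by `a`, so the second factors are always `g ^ i g ^ (-(i - a)) = g
^ a`. -/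
lemma F_mul_tmul_one_mul_F' {x : A} {a : ZMod p} (hx : T.h * x - x * T.h = T.κ a • x) :
    T.F * (x ⊗ₜ[R] 1) * T.F' = x ⊗ₜ[R] zpow' T.g a := by
  rw [F_mul_tmul_mul_F']
  have h1 (i : ZMod p) : ∑ j, (T.P i * x * T.P j) ⊗ₜ[R] (zpow' T.g i * 1 * zpow' T.g (-j)) =
      (T.P i * x) ⊗ₜ[R] zpow' T.g a := by
    rw [Finset.sum_eq_single_of_mem (i - a) (Finset.mem_univ _)]
    · rw [T.spectral.shift hx, mul_assoc, T.spectral.mul_self, mul_one, ← zpow'_add T.g_pow]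
      congr 2
      ring
    · intro j _ hj
      rw [T.spectral.shift hx, mul_assoc, T.spectral.mul_of_ne hj.symm, mul_zero,
        TensorProduct.zero_tmul]
  simp_rw [h1]
  rw [← TensorProduct.sum_tmul, T.spectral.sum_mul]

lemma comul_of_mem_span {x : A} (hx : x ∈ Submodule.span R T.X) :
    T.comul x = x ⊗ₜ[R] 1 + 1 ⊗ₜ[R] x := by
  induction hx using Submodule.span_induction with
  | mem x hx => exact T.comul_apply x hx
  | zero => simp
  | add x y _ _ hx hy => rw [map_add, hx, hy, TensorProduct.add_tmul, TensorProduct.tmul_add]; abel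
  | smul r x _ hx =>
    rw [map_smul, hx, smul_add, TensorProduct.smul_tmul', TensorProduct.tmul_smul]

lemma counit_of_mem_span {x : A} (hx : x ∈ Submodule.span R T.X) : T.counit x = 0 := by
  induction hx using Submodule.span_induction with
  | mem x hx => exact T.counit_apply x hx
  | zero => simp
  | add x y _ _ hx hy => rw [map_add, hx, hy, add_zero]
  | smul r x _ hx => rw [map_smul, hx, smul_zero]

lemma antipode_of_mem_span {x : A} (hx : x ∈ Submodule.span R T.X) :
    T.antipode x = MulOpposite.op (-x) := by
  induction hx using Submodule.span_induction with
  | mem x hx => exact T.antipode_apply x hx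
  | zero => simp
  | add x y _ _ hx hy => rw [map_add, hx, hy, neg_add, MulOpposite.op_add]
  | smul r x _ hx => rw [map_smul, hx, ← MulOpposite.op_smul, smul_neg]

/-- The twisted coproduct. -/
def twistedComul : A →ₐ[R] A ⊗[R] A := conjHom T.comul T.F T.F' T.F_mul_F' T.F'_mul_F

lemma twistedComul_apply (a : A) : T.twistedComul a = T.F * T.comul a * T.F' := rfl

lemma twistedComul_of_mem_span {x : A} (hx : x ∈ Submodule.span R T.X) {a : ZMod p}
    (ha : T.h * x - x * T.h = T.κ a • x) :
    T.twistedComul x = x ⊗ₜ[R] zpow' T.g a +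
      ∑ i, T.P i ⊗ₜ[R] (zpow' T.g i * x * zpow' T.g (-i)) := by
  rw [twistedComul_apply, T.comul_of_mem_span hx, mul_add, add_mul, T.F_mul_tmul_one_mul_F' ha,
    F_mul_one_tmul_mul_F']

lemma commute_z_g : Commute T.z T.g := (Commute.one_right _).sub_right (Commute.refl _)

lemma lie_z : T.h * T.z - T.z * T.h = T.κ 1 • T.z := by rw [T.lie, map_one, one_smul]

/-- As `z` has weight one and commutes with `g`, its twisted coproduct is `z ⊗ g + 1 ⊗ z`. -/
lemma twistedComul_g : T.twistedComul T.g = T.g ⊗ₜ[R] T.g := by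
  have h1 : T.twistedComul T.z = T.z ⊗ₜ[R] T.g + 1 ⊗ₜ[R] T.z := by
    rw [T.twistedComul_of_mem_span T.z_mem T.lie_z, zpow'_one]
    have h2 (i : ZMod p) : zpow' T.g i * T.z * zpow' T.g (-i) = T.z := by
      rw [← (Commute.zpow'_right' T.commute_z_g i).eq, mul_assoc, zpow'_mul_neg T.g_pow, mul_one]
    simp_rw [h2]
    rw [← TensorProduct.sum_tmul, T.spectral.sum_eq]
  have h3 : T.twistedComul T.g = 1 - T.twistedComul T.z := by rw [g, map_sub, map_one]
  rw [h3, h1, Algebra.TensorProduct.one_def, add_comm, ← sub_sub, ← TensorProduct.tmul_sub,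
    ← g, ← TensorProduct.sub_tmul, ← g]

lemma twistedComul_zpow' (i : ZMod p) :
    T.twistedComul (zpow' T.g i) = zpow' T.g i ⊗ₜ[R] zpow' T.g i := by
  rw [map_zpow', twistedComul_g, zpow', Algebra.TensorProduct.tmul_pow]
  rfl

/-- Both sides are eigenprojections of `h ⊗ 1 + 1 ⊗ h`, which are unique. -/
lemma comul_P (j : ZMod p) : T.comul (T.P j) = ∑ a, T.P a ⊗ₜ[R] T.P (j - a) := by
  have h1 := T.spectral.map T.comul
  rw [T.comul_of_mem_span T.h_mem] at h1
  exact h1.eq_of T.spectral.tensor j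

lemma counit_P (j : ZMod p) : T.counit (T.P j) = if j = 0 then 1 else 0 := by
  have h1 := T.spectral.map T.counit
  rw [T.counit_of_mem_span T.h_mem] at h1
  exact h1.eq_of isSpectral_zero j

lemma antipode_P (j : ZMod p) : T.antipode (T.P j) = MulOpposite.op (T.P (-j)) := by
  have h1 := T.spectral.map T.antipode
  rw [T.antipode_of_mem_span T.h_mem] at h1
  have h2 : IsSpectral T.κ (MulOpposite.op (-T.h)) fun i => MulOpposite.op (T.P (-i)) :=
    { sum_eq := by
        have h3 := congrArg MulOpposite.op T.spectral.neg.sum_eq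
        rwa [Finset.op_sum, MulOpposite.op_one] at h3
      mul_left := fun i => by
        rw [← MulOpposite.op_mul, T.spectral.neg.mul_right, MulOpposite.op_smul]
      mul_right := fun i => by
        rw [← MulOpposite.op_mul, T.spectral.neg.mul_left, MulOpposite.op_smul] }
  exact h1.eq_of h2 j

/-! The coassociativity of the twisted coproduct. -/

/-- `Δ ⊗ id` followed by the associator. -/
def comulLeft (f : A →ₐ[R] A ⊗[R] A) : A ⊗[R] A →ₐ[R] A ⊗[R] (A ⊗[R] A) :=
  (Algebra.TensorProduct.assoc R R R A A A).toAlgHom.comp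
    (Algebra.TensorProduct.map f (AlgHom.id R A))

/-- `id ⊗ Δ`. -/
def comulRight (f : A →ₐ[R] A ⊗[R] A) : A ⊗[R] A →ₐ[R] A ⊗[R] (A ⊗[R] A) :=
  Algebra.TensorProduct.map (AlgHom.id R A) f

lemma comulLeft_tmul (f : A →ₐ[R] A ⊗[R] A) (a b : A) : comulLeft f (a ⊗ₜ[R] b) =
    Algebra.TensorProduct.assoc R R R A A A (f a ⊗ₜ[R] b) := rfl

lemma comulRight_tmul (f : A →ₐ[R] A ⊗[R] A) (a b : A) :
    comulRight f (a ⊗ₜ[R] b) = a ⊗ₜ[R] f b := rfl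

lemma comul_coassoc (a : A) :
    comulLeft T.comul (T.comul a) = comulRight T.comul (T.comul a) := by
  have h1 : (comulLeft T.comul).comp T.comul = (comulRight T.comul).comp T.comul := by
    refine AlgHom.ext_of_adjoin_eq_top T.adjoin_eq fun x hx => ?_
    rw [AlgHom.comp_apply, AlgHom.comp_apply, T.comul_apply x hx, map_add, map_add,
      comulLeft_tmul, comulLeft_tmul, comulRight_tmul, comulRight_tmul, T.comul_apply x hx,
      map_one, Algebra.TensorProduct.one_def, TensorProduct.add_tmul, TensorProduct.tmul_add,
      map_add]
    simp only [Algebra.TensorProduct.assoc_tmul]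
    abel
  exact AlgHom.congr_fun h1 a

/-- `F ⊗ 1`. -/
def F12 : A ⊗[R] (A ⊗[R] A) := Algebra.TensorProduct.assoc R R R A A A (T.F ⊗ₜ[R] 1)

/-- `F⁻¹ ⊗ 1`. -/
def F12' : A ⊗[R] (A ⊗[R] A) := Algebra.TensorProduct.assoc R R R A A A (T.F' ⊗ₜ[R] 1)

lemma F12'_mul_F12 : T.F12' * T.F12 = 1 := by
  rw [F12, F12', ← map_mul, Algebra.TensorProduct.tmul_mul_tmul, F'_mul_F, mul_one,
    ← Algebra.TensorProduct.one_def, map_one]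

lemma comulLeft_twistedComul (x : A ⊗[R] A) :
    comulLeft T.twistedComul x = T.F12 * comulLeft T.comul x * T.F12' := by
  induction x using TensorProduct.induction_on with
  | zero => simp
  | tmul a b =>
    rw [comulLeft_tmul, comulLeft_tmul, F12, F12', ← map_mul, ← map_mul,
      Algebra.TensorProduct.tmul_mul_tmul, Algebra.TensorProduct.tmul_mul_tmul, one_mul, mul_one]
    rfl
  | add x y hx hy => rw [map_add, map_add, hx, hy, mul_add, add_mul]

lemma comulRight_twistedComul (x : A ⊗[R] A) :
    comulRight T.twistedComul x = (1 ⊗ₜ[R] T.F) * comulRight T.comul x * (1 ⊗ₜ[R] T.F') := by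
  induction x using TensorProduct.induction_on with
  | zero => simp
  | tmul a b =>
    rw [comulRight_tmul, comulRight_tmul, Algebra.TensorProduct.tmul_mul_tmul,
      Algebra.TensorProduct.tmul_mul_tmul, one_mul, mul_one]
    rfl
  | add x y hx hy => rw [map_add, map_add, hx, hy, mul_add, add_mul]

/-- One half of the cocycle identity: the two sides are brought to a common normal form. Here the
coproduct of the projections is used. -/
lemma comulLeft_comul_F : T.F12 * comulLeft T.comul T.F =
    ∑ a, ∑ b, T.P a ⊗ₜ[R] ((zpow' T.g a * T.P b) ⊗ₜ[R] zpow' T.g (a + b)) := by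
  have h1 : comulLeft T.comul T.F =
      ∑ a, ∑ b, T.P a ⊗ₜ[R] (T.P b ⊗ₜ[R] zpow' T.g (a + b)) := by
    simp only [F, map_sum, comulLeft_tmul, comul_P, TensorProduct.sum_tmul,
      Algebra.TensorProduct.assoc_tmul]
    rw [Finset.sum_comm]
    refine Finset.sum_congr rfl fun a _ => ?_
    refine Fintype.sum_equiv (Equiv.subRight a) _ _ fun j => ?_
    rw [Equiv.subRight_apply, add_sub_cancel]
  rw [h1, Finset.mul_sum]
  refine Finset.sum_congr rfl fun a _ => ?_
  rw [Finset.mul_sum]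
  refine Finset.sum_congr rfl fun b _ => ?_
  simp only [F12, F, map_sum, TensorProduct.sum_tmul, Algebra.TensorProduct.assoc_tmul,
    Finset.sum_mul, Algebra.TensorProduct.tmul_mul_tmul, one_mul]
  rw [Finset.sum_eq_single_of_mem a (Finset.mem_univ a), T.spectral.mul_self]
  intro i _ hi
  rw [T.spectral.mul_of_ne hi, TensorProduct.zero_tmul]

/-- The other half, where group-likeness of `g` enters as `F Δ₀(g ^ a) = (g ^ a ⊗ g ^ a) F`. -/
lemma comulRight_comul_F : (1 ⊗ₜ[R] T.F) * comulRight T.comul T.F =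
    ∑ a, ∑ b, T.P a ⊗ₜ[R] ((zpow' T.g a * T.P b) ⊗ₜ[R] zpow' T.g (a + b)) := by
  conv_lhs => rw [show comulRight T.comul T.F =
    ∑ a, T.P a ⊗ₜ[R] T.comul (zpow' T.g a) by simp only [F, map_sum, comulRight_tmul]]
  rw [Finset.mul_sum]
  refine Finset.sum_congr rfl fun a _ => ?_
  have h1 : T.F * T.comul (zpow' T.g a) = (zpow' T.g a ⊗ₜ[R] zpow' T.g a) * T.F := by
    rw [← twistedComul_zpow', twistedComul_apply, mul_assoc _ T.F' T.F, F'_mul_F, mul_one]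
  rw [Algebra.TensorProduct.tmul_mul_tmul, one_mul, h1, F, Finset.mul_sum, TensorProduct.tmul_sum]
  refine Finset.sum_congr rfl fun b _ => ?_
  rw [Algebra.TensorProduct.tmul_mul_tmul, ← zpow'_add T.g_pow]

/-- Both sides conjugate the iterated primitive coproduct, on the left by the same element `C` by
the cocycle identity, and on the right by `D` and `D2`, which are both its inverse. -/
lemma twistedComul_coassoc (a : A) : comulLeft T.twistedComul (T.twistedComul a) =
    comulRight T.twistedComul (T.twistedComul a) := by
  set C := T.F12 * comulLeft T.comul T.F with hC
  have hC2 : C = (1 ⊗ₜ[R] T.F) * comulRight T.comul T.F := by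
    rw [hC, comulLeft_comul_F, comulRight_comul_F]
  set D := comulLeft T.comul T.F' * T.F12' with hD
  set D2 := comulRight T.comul T.F' * (1 ⊗ₜ[R] T.F') with hD2
  have h1 : D * C = 1 := by
    rw [hD, hC, mul_assoc, ← mul_assoc T.F12', F12'_mul_F12, one_mul, ← map_mul, F'_mul_F, map_one]
  have h2 : C * D2 = 1 := by
    rw [hC2, hD2, mul_assoc, ← mul_assoc (comulRight T.comul T.F), ← map_mul, F_mul_F', map_one,
      one_mul, Algebra.TensorProduct.tmul_mul_tmul, F_mul_F', mul_one,
      ← Algebra.TensorProduct.one_def]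
  have h3 : D = D2 := left_inv_eq_right_inv h1 h2
  rw [comulLeft_twistedComul, comulRight_twistedComul, twistedComul_apply, map_mul, map_mul,
    map_mul, map_mul, comul_coassoc]
  have h4 (M : A ⊗[R] (A ⊗[R] A)) : T.F12 * (comulLeft T.comul T.F * M * comulLeft T.comul T.F') *
      T.F12' = C * M * D := by
    rw [hC, hD]; simp only [mul_assoc]
  have h5 (M : A ⊗[R] (A ⊗[R] A)) : (1 ⊗ₜ[R] T.F) *
      (comulRight T.comul T.F * M * comulRight T.comul T.F') * (1 ⊗ₜ[R] T.F') = C * M * D2 := by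
    rw [hC2, hD2]; simp only [mul_assoc]
  rw [h4, h5, h3]

lemma counit_g : T.counit T.g = 1 := by
  rw [g, map_sub, T.counit_of_mem_span T.z_mem, map_one, sub_zero]

lemma counit_zpow' (i : ZMod p) : T.counit (zpow' T.g i) = 1 := by
  rw [map_zpow', counit_g, zpow', one_pow]

lemma map_counit_left_F :
    Algebra.TensorProduct.map T.counit (AlgHom.id R A) T.F = 1 := by
  rw [F, map_sum]
  simp only [Algebra.TensorProduct.map_tmul, counit_P]
  rw [Finset.sum_eq_single_of_mem 0 (Finset.mem_univ 0), if_pos rfl, zpow'_zero, map_one,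
    Algebra.TensorProduct.one_def]
  intro i _ hi
  rw [if_neg hi, TensorProduct.zero_tmul]

lemma map_counit_right_F :
    Algebra.TensorProduct.map (AlgHom.id R A) T.counit T.F = 1 := by
  rw [F, map_sum]
  simp only [Algebra.TensorProduct.map_tmul, counit_zpow', ← TensorProduct.sum_tmul,
    AlgHom.id_apply, T.spectral.sum_eq, Algebra.TensorProduct.one_def]

lemma map_eq_one_of_F {B : Type*} [Ring B] [Algebra R B] (f : A ⊗[R] A →ₐ[R] B)
    (hf : f T.F = 1) : f T.F' = 1 := by
  have h1 := congrArg f T.F_mul_F'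
  rwa [map_mul, hf, one_mul, map_one] at h1

lemma twistedComul_counit_left :
    (Algebra.TensorProduct.map T.counit (AlgHom.id R A)).comp T.twistedComul =
      (Algebra.TensorProduct.lid R A).symm := by
  refine AlgHom.ext_of_adjoin_eq_top T.adjoin_eq fun x hx => ?_
  rw [AlgHom.comp_apply, twistedComul_apply, map_mul, map_mul, map_counit_left_F,
    T.map_eq_one_of_F _ T.map_counit_left_F, one_mul, mul_one, T.comul_apply x hx, map_add,
    Algebra.TensorProduct.map_tmul, Algebra.TensorProduct.map_tmul, T.counit_apply x hx]
  simp

lemma twistedComul_counit_right :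
    (Algebra.TensorProduct.map (AlgHom.id R A) T.counit).comp T.twistedComul =
      (Algebra.TensorProduct.rid R R A).symm := by
  refine AlgHom.ext_of_adjoin_eq_top T.adjoin_eq fun x hx => ?_
  rw [AlgHom.comp_apply, twistedComul_apply, map_mul, map_mul, map_counit_right_F,
    T.map_eq_one_of_F _ T.map_counit_right_F, one_mul, mul_one, T.comul_apply x hx, map_add,
    Algebra.TensorProduct.map_tmul, Algebra.TensorProduct.map_tmul, T.counit_apply x hx]
  simp

end TwistData

/-! ### The twisted antipode and the explicit formulas -/

namespace TwistData

variable {R A : Type*} [CommRing R] [Ring A] [Algebra R A] {p : ℕ} [hp : Fact p.Prime]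
  (T : TwistData R A p)

/-- The element that conjugates the antipode. -/
def w : A := twistElt T.P (-T.z)

/-- The inverse of `w`. -/
def v : A := twistElt T.P T.z

lemma v_mul_w : T.v * T.w = 1 := T.spectral.twistElt_mul T.lie T.pow_z

lemma pow_neg_z : (-T.z) ^ p = 0 := by rw [neg_pow, T.pow_z, mul_zero]

lemma w_mul_v : T.w * T.v = 1 := by
  have h1 : T.h * -T.z - -T.z * T.h = -T.z := by
    conv_rhs => rw [← T.lie]
    noncomm_ring
  have h2 := T.spectral.twistElt_mul h1 T.pow_neg_z
  rwa [neg_neg] at h2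

/-- The twisted antipode. -/
def twistedAntipode : A →ₗ[R] A :=
  LinearMap.mulLeft R T.w ∘ₗ LinearMap.mulRight R T.v ∘ₗ
    (MulOpposite.opLinearEquiv R).symm.toLinearMap ∘ₗ T.antipode.toLinearMap

lemma twistedAntipode_apply (y : A) :
    T.twistedAntipode y = T.w * ((T.antipode y).unop * T.v) := rfl

lemma twistedAntipode_mul (a b : A) :
    T.twistedAntipode (a * b) = T.twistedAntipode b * T.twistedAntipode a := by
  have h1 (x y : A) : T.w * (x * T.v) * (T.w * (y * T.v)) = T.w * (x * (T.v * T.w) * y * T.v) := by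
    simp only [mul_assoc]
  rw [twistedAntipode_apply, twistedAntipode_apply, twistedAntipode_apply, h1, v_mul_w, mul_one,
    map_mul, MulOpposite.unop_mul]

lemma twistedAntipode_one : T.twistedAntipode 1 = 1 := by
  rw [twistedAntipode_apply, map_one, MulOpposite.unop_one, one_mul, w_mul_v]

lemma antipode_zpow' (i : ZMod p) :
    T.antipode (zpow' T.g i) = MulOpposite.op (zpow' (1 - -T.z) i) := by
  rw [map_zpow', g, map_sub, map_one, T.antipode_of_mem_span T.z_mem, ← MulOpposite.op_one,
    ← MulOpposite.op_sub, zpow', ← MulOpposite.op_pow, zpow']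

lemma P_mul_v (i : ZMod p) (x : A) : T.P i * (T.v * x) = T.P i * (zpow' T.g i * x) := by
  rw [← mul_assoc, v, T.spectral.mul_twistElt, mul_assoc, g]

lemma P_mul_w (i : ZMod p) (x : A) : T.P i * (T.w * x) = T.P i * (zpow' (1 - -T.z) i * x) := by
  rw [← mul_assoc, w, T.spectral.mul_twistElt, mul_assoc]

/-- The left convolution `a ⊗ b ↦ S a * b`. -/
def convLeft : A ⊗[R] A →ₗ[R] A := LinearMap.mul' R A ∘ₗ T.twistedAntipode.rTensor A

/-- The right convolution `a ⊗ b ↦ a * S b`. -/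
def convRight : A ⊗[R] A →ₗ[R] A := LinearMap.mul' R A ∘ₗ T.twistedAntipode.lTensor A

lemma convLeft_tmul (a b : A) : T.convLeft (a ⊗ₜ[R] b) = T.twistedAntipode a * b := rfl

lemma convRight_tmul (a b : A) : T.convRight (a ⊗ₜ[R] b) = a * T.twistedAntipode b := rfl

lemma convLeft_mul_tmul (X : A ⊗[R] A) (a b : A) :
    T.convLeft (X * (a ⊗ₜ[R] b)) = T.twistedAntipode a * T.convLeft X * b := by
  induction X using TensorProduct.induction_on with
  | zero => simp
  | tmul x y =>
    rw [Algebra.TensorProduct.tmul_mul_tmul, convLeft_tmul, convLeft_tmul, twistedAntipode_mul]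
    simp only [mul_assoc]
  | add X Y hX hY => rw [add_mul, map_add, hX, hY, map_add, mul_add, add_mul]

lemma convRight_tmul_mul (X : A ⊗[R] A) (a b : A) :
    T.convRight ((a ⊗ₜ[R] b) * X) = a * T.convRight X * T.twistedAntipode b := by
  induction X using TensorProduct.induction_on with
  | zero => simp
  | tmul x y =>
    rw [Algebra.TensorProduct.tmul_mul_tmul, convRight_tmul, convRight_tmul, twistedAntipode_mul]
    simp only [mul_assoc]
  | add X Y hX hY => rw [mul_add, map_add, hX, hY, map_add, mul_add, add_mul]

/-- The powers of `g` coming from `v` cancel those of `F`, so `x` and `y` enter only through `S₀(x)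
y`; adding the terms `x ⊗ 1` and `1 ⊗ x` therefore gives zero. -/
lemma convLeft_twist (x y : A) : T.convLeft (T.F * (x ⊗ₜ[R] y) * T.F') =
    ∑ j, T.w * (T.P (-j) * ((T.antipode x).unop * (y * zpow' T.g (-j)))) := by
  rw [F_mul_tmul_mul_F', Finset.sum_comm, map_sum]
  refine Finset.sum_congr rfl fun j _ => ?_
  rw [map_sum]
  have h1 (i : ZMod p) : T.convLeft ((T.P i * x * T.P j) ⊗ₜ[R]
      (zpow' T.g i * y * zpow' T.g (-j))) =
      T.w * (T.P (-j) * ((T.antipode x).unop * (T.P (-i) * (y * zpow' T.g (-j))))) := by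
    rw [convLeft_tmul, twistedAntipode_apply, map_mul, map_mul, antipode_P, antipode_P]
    simp only [MulOpposite.unop_mul, MulOpposite.unop_op, mul_assoc, P_mul_v]
    rw [← mul_assoc (zpow' T.g (-i)), zpow'_neg_mul T.g_pow, one_mul]
  simp_rw [h1]
  rw [← Finset.mul_sum, ← Finset.mul_sum, ← Finset.mul_sum, T.spectral.neg.sum_mul]

lemma convRight_twist (x y : A) : T.convRight (T.F * (x ⊗ₜ[R] y) * T.F') =
    ∑ i, T.P i * (x * ((T.antipode y).unop * (zpow' (1 - -T.z) i * T.v))) := by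
  rw [F_mul_tmul_mul_F', map_sum]
  refine Finset.sum_congr rfl fun i _ => ?_
  rw [map_sum]
  have h1 (j : ZMod p) : T.convRight ((T.P i * x * T.P j) ⊗ₜ[R]
      (zpow' T.g i * y * zpow' T.g (-j))) =
      T.P i * (x * (T.P j * ((T.antipode y).unop * (zpow' (1 - -T.z) i * T.v)))) := by
    rw [convRight_tmul, twistedAntipode_apply, map_mul, map_mul, antipode_zpow', antipode_zpow']
    simp only [MulOpposite.unop_mul, MulOpposite.unop_op, mul_assoc, P_mul_w]
    rw [← mul_assoc (zpow' _ j), zpow'_mul_neg (one_sub_pow_char T.κ T.pow_neg_z), one_mul]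
  simp_rw [h1]
  rw [← Finset.mul_sum, ← Finset.mul_sum, T.spectral.sum_mul]

/-- The extra factor `Y` makes the antipode identity multiplicative in `a`, so that it can be
checked on primitive generators. -/
lemma convLeft_twistedComul_mul (a : A) (Y : A ⊗[R] A) :
    T.convLeft (T.twistedComul a * Y) = T.counit a • T.convLeft Y := by
  have ha : a ∈ Algebra.adjoin R T.X := T.adjoin_eq ▸ Algebra.mem_top
  induction ha using Algebra.adjoin_induction generalizing Y with
  | mem x hx =>
    have h1 : T.convLeft (T.twistedComul x) = 0 := by
      rw [twistedComul_apply, T.comul_apply x hx, mul_add, add_mul, map_add, convLeft_twist,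
        convLeft_twist, T.antipode_apply x hx, map_one, ← Finset.sum_add_distrib]
      refine Finset.sum_eq_zero fun j _ => ?_
      simp
    rw [T.counit_apply x hx, zero_smul]
    induction Y using TensorProduct.induction_on with
    | zero => simp
    | tmul a b => rw [convLeft_mul_tmul, h1, mul_zero, zero_mul]
    | add X Y hX hY => rw [mul_add, map_add, hX, hY, add_zero]
  | algebraMap r =>
    rw [AlgHom.commutes, AlgHom.commutes, ← Algebra.smul_def, map_smul, Algebra.algebraMap_self_apply]
  | add a b _ _ iha ihb => rw [map_add, add_mul, map_add, iha, ihb, map_add, add_smul]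
  | mul a b _ _ iha ihb =>
    rw [map_mul T.twistedComul, mul_assoc, iha, ihb, map_mul T.counit, mul_smul]

lemma convRight_mul_twistedComul (a : A) (Y : A ⊗[R] A) :
    T.convRight (Y * T.twistedComul a) = T.counit a • T.convRight Y := by
  have ha : a ∈ Algebra.adjoin R T.X := T.adjoin_eq ▸ Algebra.mem_top
  induction ha using Algebra.adjoin_induction generalizing Y with
  | mem x hx =>
    have h1 : T.convRight (T.twistedComul x) = 0 := by
      rw [twistedComul_apply, T.comul_apply x hx, mul_add, add_mul, map_add, convRight_twist,
        convRight_twist, T.antipode_apply x hx, map_one, ← Finset.sum_add_distrib]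
      refine Finset.sum_eq_zero fun j _ => ?_
      simp
    rw [T.counit_apply x hx, zero_smul]
    induction Y using TensorProduct.induction_on with
    | zero => simp
    | tmul a b => rw [convRight_tmul_mul, h1, mul_zero, zero_mul]
    | add X Y hX hY => rw [add_mul, map_add, hX, hY, add_zero]
  | algebraMap r =>
    rw [AlgHom.commutes, AlgHom.commutes, ← Algebra.commutes, ← Algebra.smul_def, map_smul,
      Algebra.algebraMap_self_apply]
  | add a b _ _ iha ihb => rw [map_add, mul_add, map_add, iha, ihb, map_add, add_smul]
  | mul a b _ _ iha ihb =>
    rw [map_mul T.twistedComul, ← mul_assoc, ihb, iha, map_mul T.counit, mul_comm, mul_smul]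

/-- The twisted Hopf algebra structure. -/
def hopfStructure : HopfStructure R A where
  comul := T.twistedComul
  counit := T.counit
  antipode := T.twistedAntipode
  coassoc := AlgHom.ext fun a => T.twistedComul_coassoc a
  counit_left := T.twistedComul_counit_left
  counit_right := T.twistedComul_counit_right
  antipode_left := LinearMap.ext fun a => by
    have h1 := T.convLeft_twistedComul_mul a 1
    rw [mul_one, Algebra.TensorProduct.one_def, convLeft_tmul, twistedAntipode_one, mul_one,
      ← Algebra.algebraMap_eq_smul_one] at h1
    exact h1
  antipode_right := LinearMap.ext fun a => by
    have h1 := T.convRight_mul_twistedComul a 1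
    rw [one_mul, Algebra.TensorProduct.one_def, convRight_tmul, twistedAntipode_one, mul_one,
      ← Algebra.algebraMap_eq_smul_one] at h1
    exact h1

/-- The twisted coproduct of a primitive eigenvector of `ad h`. -/
lemma twistedComul_of_mem_span_eq_sum {x : A} (hx : x ∈ Submodule.span R T.X) {a : ZMod p}
    (ha : T.h * x - x * T.h = T.κ a • x) :
    T.twistedComul x = x ⊗ₜ[R] zpow' T.g a +
      ∑ r ∈ range p, (-1 : R) ^ r • (risingFactorial T.h r ⊗ₜ[R] (zpow' T.g (-r : ZMod p) *
        (T.κ ((r.factorial : ZMod p)⁻¹) • (innerDer R T.z ^ r) x))) := by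
  rw [T.twistedComul_of_mem_span hx ha]
  congr 1
  have h1 (i : ZMod p) : T.P i ⊗ₜ[R] (zpow' T.g i * x * zpow' T.g (-i)) =
      ∑ r ∈ range p, (-1 : R) ^ r • ((T.κ (risingFactorial i r) • T.P i) ⊗ₜ[R]
        (zpow' T.g (-r : ZMod p) *
          (T.κ ((r.factorial : ZMod p)⁻¹) • (innerDer R T.z ^ r) x))) := by
    rw [g, zpow'_conj_left T.κ T.pow_z, TensorProduct.tmul_sum]
    refine Finset.sum_congr rfl fun r _ => ?_
    have h2 : ((-1 : A)) ^ r * (zpow' (1 - T.z) (-r : ZMod p) * (innerDer R T.z ^ r) x) =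
        (-1 : R) ^ r • (zpow' (1 - T.z) (-r : ZMod p) * (innerDer R T.z ^ r) x) := by
      rcases neg_one_pow_eq_or R r with h | h <;>
        rcases Nat.even_or_odd r with hr | hr <;> simp [hr.neg_one_pow]
    rw [h2, negBinom, map_mul, mul_smul, TensorProduct.tmul_smul, TensorProduct.tmul_smul,
      TensorProduct.tmul_smul, mul_smul_comm, TensorProduct.tmul_smul, ← TensorProduct.smul_tmul']
    module
  simp_rw [h1]
  rw [Finset.sum_comm]
  refine Finset.sum_congr rfl fun r _ => ?_
  rw [← Finset.smul_sum, ← TensorProduct.sum_tmul, ← T.spectral.risingFactorial_eq]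

/-- The twisted antipode of a primitive eigenvector of `ad h`. -/
lemma twistedAntipode_of_mem_span {x : A} (hx : x ∈ Submodule.span R T.X) {a : ZMod p}
    (ha : T.h * x - x * T.h = T.κ a • x) :
    T.twistedAntipode x = -(zpow' T.g (-a) *
      ∑ r ∈ range p, (T.κ ((r.factorial : ZMod p)⁻¹) • (innerDer R T.z ^ r) x) *
        risingFactorial (T.h + 1) r) := by
  rw [twistedAntipode_apply, T.antipode_of_mem_span hx, MulOpposite.unop_op, neg_mul, mul_neg,
    ← mul_assoc, w, v, T.spectral.twistElt_conj T.lie T.pow_z ha, g]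
  simp only [smul_mul_assoc]

end TwistData

/-! ### Weights of the contact algebra under `D_K(x_k x_{-k})` -/

section Admissible

variable {𝒦 : Type*} [Field 𝒦] {p n : ℕ} [hp : Fact p.Prime] [CharP 𝒦 p]

lemma admissible_of_le_one (hp2 : p ≠ 2) {α : Idx n → ℕ} (hα : ∀ i, α i ≤ 1) :
    Admissible p α := by
  have h1 := hp.out.two_le
  refine ⟨fun i => (hα i).trans (by omega), fun _ h => ?_⟩
  have h2 : p - 1 ≤ 1 := (congrFun h .zero).symm.trans_le (hα .zero)
  omega

lemma eps_add_eps_le_one {i j : Idx n} (hij : i ≠ j) (l : Idx n) : (eps i + eps j) l ≤ 1 := by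
  rw [Pi.add_apply, eps, eps, Pi.single_apply, Pi.single_apply]
  split_ifs with h1 h2
  · exact absurd (h1.symm.trans h2) hij
  all_goals simp

lemma admissible_eps_add_eps (hp2 : p ≠ 2) {i j : Idx n} (hij : i ≠ j) :
    Admissible p (eps i + eps j) :=
  admissible_of_le_one hp2 (eps_add_eps_le_one hij)

lemma not_isToral_eps_pos_add_eps_zero (k : Fin n) :
    ¬ IsToral (eps (.pos k) + eps .zero : Idx n → ℕ) := by
  rintro (h | ⟨i, h⟩)
  · have h1 := congrFun h (.pos k)
    simp at h1
  · have h1 := congrFun h .zero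
    simp at h1

omit hp [CharP 𝒦 p] in
lemma dpMon_eps_pos_add_eps_neg (k : Fin n) :
    dpMon 𝒦 p (eps (.pos k) + eps (.neg k)) = gen 𝒦 p (.pos k) * gen 𝒦 p (.neg k) := by
  rw [eps_pos_add_eps_neg_eq, dpMon_eq_prod_gen, Finset.prod_pair (by simp)]

/-- For `f = x_k x_{-k}` both `2 f - E f` and `D_0 f` vanish, so `D_K(f)` is `x_k D_k - x_{-k}
D_{-k}`, for which monomials are eigenvectors. -/
lemma contactElt_pair_lie (hp2 : p ≠ 2) (k : Fin n) {α : Idx n → ℕ} (hα : Admissible p α) :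
    ⁅contactElt 𝒦 p (eps (.pos k) + eps (.neg k)), contactElt 𝒦 p α⁆ =
      ((α (.pos k) : 𝒦) - (α (.neg k) : 𝒦)) • contactElt 𝒦 p α := by
  apply contactIncl_injective
  rw [contactIncl_lie, map_smul, contactIncl_contactElt hp2 hα,
    contactIncl_contactElt hp2 (admissible_eps_add_eps hp2 (by simp)), contactD_lie, ← map_smul,
    dpMon_eps_pos_add_eps_neg]
  congr 1
  have h0 : partialD 𝒦 p .zero (gen 𝒦 p (.pos k) * gen 𝒦 p (.neg k)) = 0 := by
    rw [Derivation.leibniz, partialD_gen, partialD_gen]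
    simp
  have h1 : eulerD 𝒦 p (gen 𝒦 p (.pos k) * gen 𝒦 p (.neg k)) =
      2 * (gen 𝒦 p (.pos k) * gen 𝒦 p (.neg k)) := by
    rw [Derivation.leibniz, eulerD_pos, eulerD_neg, smul_eq_mul, smul_eq_mul]
    ring
  have h2 : hamD 𝒦 p (gen 𝒦 p (.pos k) * gen 𝒦 p (.neg k)) (dpMon 𝒦 p α) =
      gen 𝒦 p (.pos k) * partialD 𝒦 p (.pos k) (dpMon 𝒦 p α) -
        gen 𝒦 p (.neg k) * partialD 𝒦 p (.neg k) (dpMon 𝒦 p α) := by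
    rw [hamD_antisymm, Derivation.leibniz, hamD_pos, hamD_neg, smul_eq_mul, smul_eq_mul]
    ring
  rw [contactD_apply, h0, h1, h2, gen_mul_partialD_dpMon, gen_mul_partialD_dpMon, sub_smul]
  simp

end Admissible

/-! ### The scalar `t` -/

section TruncatedPolynomials

variable {𝒦 : Type*} [Field 𝒦] (p : ℕ) [hp : Fact p.Prime] (q : 𝒦)

lemma tVar_ne_zero : tVar p q ≠ 0 := by
  have hdeg : (Polynomial.C q * Polynomial.X : Polynomial 𝒦).natDegree < p :=
    (Polynomial.natDegree_C_mul_le q _).trans_lt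
      (Polynomial.natDegree_X (R := 𝒦) ▸ hp.out.one_lt)
  have hmonic : (Polynomial.X ^ p - Polynomial.C q * Polynomial.X : Polynomial 𝒦).Monic :=
    Polynomial.monic_X_pow_sub (Polynomial.degree_le_natDegree.trans_lt (Nat.cast_lt.mpr hdeg))
  refine AdjoinRoot.mk_ne_zero_of_natDegree_lt hmonic Polynomial.X_ne_zero ?_
  rw [Polynomial.natDegree_sub_eq_left_of_natDegree_lt, Polynomial.natDegree_X_pow,
    Polynomial.natDegree_X]
  · exact hp.out.one_lt
  · rwa [Polynomial.natDegree_X_pow]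

end TruncatedPolynomials

/-! ### The universal property after extension of scalars -/

/-- The relations that define the restricted enveloping algebra, for a map to an algebra over an
extension of the base field. -/
structure IsRestrictedMap {𝒦 : Type*} [Field 𝒦] {p n : ℕ} [CharP 𝒦 p] (R : Type*) {B : Type*}
    [CommRing R] [Algebra 𝒦 R] [Ring B] [Algebra R B] (f : ContactAlg 𝒦 p n → B) : Prop where
  map_add : ∀ x y, f (x + y) = f x + f y
  map_smul : ∀ (c : 𝒦) x, f (c • x) = algebraMap 𝒦 R c • f x
  map_lie : ∀ x y, f ⁅x, y⁆ = f x * f y - f y * f x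
  pow_of_isToral : ∀ α, Admissible p α → IsToral α →
    f (contactElt 𝒦 p α) ^ p = f (contactElt 𝒦 p α)
  pow_of_not_isToral : ∀ α, Admissible p α → ¬ IsToral α → f (contactElt 𝒦 p α) ^ p = 0

universe u

/-- The universal property of the restricted enveloping algebra with extended scalars. -/
structure IsRestrictedEnv {𝒦 : Type*} [Field 𝒦] {p n : ℕ} [CharP 𝒦 p] (R : Type u) {A : Type u}
    [CommRing R] [Algebra 𝒦 R] [Ring A] [Algebra R A] (j : ContactAlg 𝒦 p n → A) : Prop
    extends IsRestrictedMap R j where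
  adjoin_eq : Algebra.adjoin R (Set.range j) = ⊤
  exists_lift : ∀ {B : Type u} [Ring B] [Algebra R B] (f : ContactAlg 𝒦 p n → B),
    IsRestrictedMap R f → ∃ Φ : A →ₐ[R] B, ∀ x, Φ (j x) = f x

section QEnv

variable {𝒦 : Type*} [Field 𝒦] {p n : ℕ} [CharP 𝒦 p] (q : 𝒦)

lemma toQEnv_apply (y : ContactAlg 𝒦 p n) : toQEnv p q y = 1 ⊗ₜ[𝒦] resι 𝒦 p n y := rfl

lemma isRestrictedMap_toQEnv :
    IsRestrictedMap (TruncPoly p q) (toQEnv p q : ContactAlg 𝒦 p n → QEnv p n q) where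
  map_add x y := by rw [toQEnv_apply, map_add, TensorProduct.tmul_add]; rfl
  map_smul c x := by
    rw [toQEnv_apply, map_smul, ← TensorProduct.smul_tmul, toQEnv_apply,
      TensorProduct.smul_tmul', Algebra.algebraMap_eq_smul_one, smul_eq_mul, mul_one]
  map_lie x y := by
    simp only [toQEnv_apply, resι_lie, Algebra.TensorProduct.tmul_mul_tmul, mul_one,
      TensorProduct.tmul_sub]
  pow_of_isToral α hα h := by
    rw [toQEnv_apply, Algebra.TensorProduct.tmul_pow, one_pow, resι_pow_of_isToral hα h]
  pow_of_not_isToral α hα h := by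
    rw [toQEnv_apply, Algebra.TensorProduct.tmul_pow, resι_pow_of_not_isToral hα h,
      TensorProduct.tmul_zero]

lemma adjoin_range_toQEnv : Algebra.adjoin (TruncPoly p q)
    (Set.range (toQEnv p q : ContactAlg 𝒦 p n → QEnv p n q)) = ⊤ := by
  set S := Algebra.adjoin (TruncPoly p q)
    (Set.range (toQEnv p q : ContactAlg 𝒦 p n → QEnv p n q))
  have h1 (u : RestrictedEnv 𝒦 p n) : (1 : TruncPoly p q) ⊗ₜ[𝒦] u ∈ S := by
    have hu : u ∈ Algebra.adjoin 𝒦 (Set.range (resι 𝒦 p n)) :=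
      adjoin_range_resι (𝒦 := 𝒦) (p := p) (n := n) ▸ Algebra.mem_top
    induction hu using Algebra.adjoin_induction with
    | mem x hx =>
      obtain ⟨y, rfl⟩ := hx
      exact Algebra.subset_adjoin ⟨y, rfl⟩
    | algebraMap r =>
      have h2 : (1 : TruncPoly p q) ⊗ₜ[𝒦] algebraMap 𝒦 (RestrictedEnv 𝒦 p n) r =
          algebraMap (TruncPoly p q) (QEnv p n q) (algebraMap 𝒦 (TruncPoly p q) r) := by
        rw [Algebra.algebraMap_eq_smul_one, ← TensorProduct.smul_tmul,
          ← Algebra.algebraMap_eq_smul_one]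
        rfl
      rw [h2]
      exact S.algebraMap_mem _
    | add a b _ _ iha ihb =>
      rw [TensorProduct.tmul_add]
      exact S.add_mem iha ihb
    | mul a b _ _ iha ihb =>
      have h2 := S.mul_mem iha ihb
      rwa [Algebra.TensorProduct.tmul_mul_tmul, mul_one] at h2
  rw [eq_top_iff]
  intro x _
  induction x using TensorProduct.induction_on with
  | zero => exact S.zero_mem
  | tmul r u =>
    have h2 : r ⊗ₜ[𝒦] u = r • ((1 : TruncPoly p q) ⊗ₜ[𝒦] u) := by
      rw [TensorProduct.smul_tmul', smul_eq_mul, mul_one]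
    rw [h2]
    exact S.smul_mem (h1 u) r
  | add x y hx hy => exact S.add_mem (hx trivial) (hy trivial)

/-- The target is made a `𝒦`-algebra by restriction of scalars; the lift from the restricted
enveloping algebra then commutes with the scalars from the other tensor factor. -/
lemma exists_qEnv_lift {B : Type*} [Ring B] [Algebra (TruncPoly p q) B]
    (f : ContactAlg 𝒦 p n → B) (hf : IsRestrictedMap (TruncPoly p q) f) :
    ∃ Φ : QEnv p n q →ₐ[TruncPoly p q] B, ∀ x, Φ (toQEnv p q x) = f x := by
  let _ : Algebra 𝒦 B := Algebra.compHom B (algebraMap 𝒦 (TruncPoly p q))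
  have : IsScalarTower 𝒦 (TruncPoly p q) B := IsScalarTower.of_algebraMap_eq' rfl
  obtain ⟨Ψ, hΨ⟩ := exists_restrictedEnv_lift (𝒦 := 𝒦)
    { toFun := f
      map_add' := hf.map_add
      map_smul' := hf.map_smul } hf.map_lie hf.pow_of_isToral hf.pow_of_not_isToral
  have hcomm (r : TruncPoly p q) (u : RestrictedEnv 𝒦 p n) :
      Commute (Algebra.ofId (TruncPoly p q) B r) (Ψ u) := Algebra.commutes r (Ψ u)
  refine ⟨Algebra.TensorProduct.lift (Algebra.ofId (TruncPoly p q) B) Ψ hcomm, fun x => ?_⟩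
  rw [toQEnv_apply, Algebra.TensorProduct.lift_tmul, map_one, one_mul, hΨ]
  rfl

lemma isRestrictedEnv_toQEnv :
    IsRestrictedEnv (TruncPoly p q) (toQEnv p q : ContactAlg 𝒦 p n → QEnv p n q) where
  toIsRestrictedMap := isRestrictedMap_toQEnv q
  adjoin_eq := adjoin_range_toQEnv q
  exists_lift := exists_qEnv_lift q

end QEnv

/-! ### The primitive structure on the restricted enveloping algebra -/

lemma add_pow_char_of_zmodHom {p : ℕ} [hp : Fact p.Prime] {R B : Type*} [CommRing R] [Ring B]
    [Algebra R B] (κ : ZMod p →+* R) {a b : B} (hab : Commute a b) :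
    (a + b) ^ p = a ^ p + b ^ p := by
  rcases subsingleton_or_nontrivial B with h | h
  · exact Subsingleton.elim _ _
  have := charP_of_zmodHom (B := B) κ
  exact add_pow_char_of_commute p hab

/-- This is why the primitive coproduct respects the `p`-power relations: the two summands commute.
-/
lemma add_pow_char_tmul {p : ℕ} [hp : Fact p.Prime] {R A : Type*} [CommRing R] [Ring A]
    [Algebra R A] (κ : ZMod p →+* R) (x : A) : (x ⊗ₜ[R] (1 : A) + 1 ⊗ₜ[R] x) ^ p =
      (x ^ p) ⊗ₜ[R] (1 : A) + 1 ⊗ₜ[R] (x ^ p) := by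
  rw [add_pow_char_of_zmodHom κ, Algebra.TensorProduct.tmul_pow,
    Algebra.TensorProduct.tmul_pow, one_pow]
  rw [commute_iff_eq, Algebra.TensorProduct.tmul_mul_tmul, Algebra.TensorProduct.tmul_mul_tmul,
    one_mul, mul_one]

/-- The prime field in an algebra over a field of characteristic `p`. -/
def zmodHom (𝒦 : Type*) [Field 𝒦] (p : ℕ) [CharP 𝒦 p] (R : Type*) [CommRing R] [Algebra 𝒦 R] :
    ZMod p →+* R :=
  (algebraMap 𝒦 R).comp (ZMod.castHom (dvd_refl p) 𝒦)

/-- The twisted coproduct of the toral element. -/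
lemma TwistData.twistedComul_h {p : ℕ} [hp : Fact p.Prime] {R A : Type*} [CommRing R] [Ring A]
    [Algebra R A] (T : TwistData R A p) :
    T.twistedComul T.h = T.h ⊗ₜ[R] zpow' (1 - T.z) (-1 : ZMod p) + 1 ⊗ₜ[R] T.h := by
  have h0 : T.h * T.h - T.h * T.h = T.κ 0 • T.h := by rw [sub_self, map_zero, zero_smul]
  have h1 (i : ZMod p) : zpow' T.g i * T.h * zpow' T.g (-i) =
      T.h - T.κ i • (1 - zpow' T.g (-1 : ZMod p)) := by
    have h2 : zpow' T.g i * T.h = T.h * zpow' T.g i -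
        T.κ i • (zpow' T.g i - zpow' T.g (i - 1)) := by
      rw [eq_sub_iff_add_eq]
      exact (mul_zpow'_eq T.κ T.lie T.pow_z i).symm
    rw [h2, sub_mul, smul_mul_assoc, sub_mul, mul_assoc, zpow'_mul_neg T.g_pow, mul_one,
      ← zpow'_add T.g_pow, sub_add_eq_add_sub, add_neg_cancel, zero_sub]
  rw [T.twistedComul_of_mem_span T.h_mem h0, zpow'_zero]
  simp_rw [h1, TensorProduct.tmul_sub, TensorProduct.tmul_smul, TensorProduct.smul_tmul',
    ← T.spectral.mul_left, Finset.sum_sub_distrib, ← TensorProduct.sum_tmul,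
    T.spectral.sum_mul', T.spectral.sum_eq, TensorProduct.tmul_sub]
  rw [g]
  abel

namespace IsRestrictedMap

variable {𝒦 : Type*} [Field 𝒦] {p n : ℕ} [hp : Fact p.Prime] [CharP 𝒦 p] {R A : Type*}
  [CommRing R] [Algebra 𝒦 R] [Ring A] [Algebra R A] {j : ContactAlg 𝒦 p n → A}
  (hj : IsRestrictedMap R j)
include hj

lemma tmul_one_add : IsRestrictedMap R fun x => j x ⊗ₜ[R] (1 : A) + 1 ⊗ₜ[R] j x where
  map_add x y := by
    rw [hj.map_add, TensorProduct.add_tmul, TensorProduct.tmul_add]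
    abel
  map_smul c x := by
    rw [hj.map_smul, smul_add, TensorProduct.smul_tmul', TensorProduct.tmul_smul]
  map_lie x y := by
    simp only [hj.map_lie, mul_add, add_mul, Algebra.TensorProduct.tmul_mul_tmul, mul_one,
      one_mul, TensorProduct.sub_tmul, TensorProduct.tmul_sub]
    abel
  pow_of_isToral α hα h := by rw [add_pow_char_tmul (zmodHom 𝒦 p R), hj.pow_of_isToral α hα h]
  pow_of_not_isToral α hα h := by
    rw [add_pow_char_tmul (zmodHom 𝒦 p R), hj.pow_of_not_isToral α hα h, TensorProduct.zero_tmul,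
      TensorProduct.tmul_zero, add_zero]

omit hj in
lemma zero : IsRestrictedMap R (0 : ContactAlg 𝒦 p n → A) where
  map_add x y := by simp
  map_smul c x := by simp
  map_lie x y := by simp
  pow_of_isToral α _ _ := zero_pow hp.out.ne_zero
  pow_of_not_isToral α _ _ := zero_pow hp.out.ne_zero

/-- Odd `p` makes negation compatible with `p`-th powers. -/
lemma op_neg (hp2 : p ≠ 2) : IsRestrictedMap R fun x => MulOpposite.op (-j x) where
  map_add x y := by rw [hj.map_add, neg_add, MulOpposite.op_add]
  map_smul c x := by rw [hj.map_smul, ← smul_neg, MulOpposite.op_smul]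
  map_lie x y := by
    rw [hj.map_lie, ← MulOpposite.op_mul, ← MulOpposite.op_mul, ← MulOpposite.op_sub, neg_mul_neg,
      neg_mul_neg, neg_sub]
  pow_of_isToral α hα h := by
    rw [← MulOpposite.op_pow, (hp.out.odd_of_ne_two hp2).neg_pow, hj.pow_of_isToral α hα h]
  pow_of_not_isToral α hα h := by
    rw [← MulOpposite.op_pow, (hp.out.odd_of_ne_two hp2).neg_pow, hj.pow_of_not_isToral α hα h,
      neg_zero, MulOpposite.op_zero]

lemma pair_lie (hp2 : p ≠ 2) (k : Fin n) {α : Idx n → ℕ} (hα : Admissible p α) :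
    j (contactElt 𝒦 p (eps (.pos k) + eps (.neg k))) * j (contactElt 𝒦 p α) -
      j (contactElt 𝒦 p α) * j (contactElt 𝒦 p (eps (.pos k) + eps (.neg k))) =
      zmodHom 𝒦 p R (((α (.pos k) : ℤ) - (α (.neg k) : ℤ) : ℤ) : ZMod p) •
        j (contactElt 𝒦 p α) := by
  rw [← hj.map_lie, contactElt_pair_lie hp2 k hα, hj.map_smul, zmodHom, RingHom.comp_apply]
  simp

lemma pair_lie_self (hp2 : p ≠ 2) (k : Fin n) :
    j (contactElt 𝒦 p (eps (.pos k) + eps (.neg k))) *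
        j (contactElt 𝒦 p (eps (.pos k) + eps .zero)) -
      j (contactElt 𝒦 p (eps (.pos k) + eps .zero)) *
        j (contactElt 𝒦 p (eps (.pos k) + eps (.neg k))) =
      j (contactElt 𝒦 p (eps (.pos k) + eps .zero)) := by
  rw [hj.pair_lie hp2 k (admissible_eps_add_eps hp2 (by simp))]
  simp

omit hp in
lemma innerDer_smul_pow (t : R) (x y : ContactAlg 𝒦 p n) (r : ℕ) :
    (innerDer R (t • j x) ^ r) (j y) =
      t ^ r • j ((LieAlgebra.ad 𝒦 (ContactAlg 𝒦 p n) x ^ r) y) := by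
  induction r with
  | zero => simp
  | succ r ih =>
    rw [pow_succ', Module.End.mul_apply, ih, pow_succ' (LieAlgebra.ad 𝒦 _ x), Module.End.mul_apply,
      LieAlgebra.ad_apply, hj.map_lie, innerDer_apply, smul_mul_smul_comm, smul_mul_smul_comm,
      ← pow_succ', ← pow_succ, smul_sub]

/-- Identifies the terms `(ad z) ^ r / r!` of the abstract formulas, for `z = t e`, with `t ^ r
d^{(r)}`. -/
lemma zmodHom_smul_innerDer_pow (t : R) (x y : ContactAlg 𝒦 p n) (r : ℕ) :
    zmodHom 𝒦 p R ((r.factorial : ZMod p)⁻¹) • (innerDer R (t • j x) ^ r) (j y) =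
      t ^ r • j (divAd x r y) := by
  rw [hj.innerDer_smul_pow, divAd, hj.map_smul, zmodHom, RingHom.comp_apply, smul_comm, map_inv₀,
    map_natCast]

end IsRestrictedMap

/-! ### The twist of vertical type -/

namespace IsRestrictedEnv

variable {𝒦 : Type*} [Field 𝒦] {p n : ℕ} [hp : Fact p.Prime] [CharP 𝒦 p] {R A : Type u}
  [CommRing R] [Algebra 𝒦 R] [Ring A] [Algebra R A] {j : ContactAlg 𝒦 p n → A}
  (hj : IsRestrictedEnv R j)

/-- The twist of vertical type. -/
def verticalTwist (hp2 : p ≠ 2) (k : Fin n) (t : R) : TwistData R A p where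
  κ := zmodHom 𝒦 p R
  X := Set.range j
  adjoin_eq := hj.adjoin_eq
  comul := (hj.exists_lift _ hj.tmul_one_add).choose
  counit := (hj.exists_lift _ IsRestrictedMap.zero).choose
  antipode := (hj.exists_lift _ (hj.op_neg hp2)).choose
  comul_apply := by
    rintro _ ⟨x, rfl⟩
    exact (hj.exists_lift _ hj.tmul_one_add).choose_spec x
  counit_apply := by
    rintro _ ⟨x, rfl⟩
    exact (hj.exists_lift _ IsRestrictedMap.zero).choose_spec x
  antipode_apply := by
    rintro _ ⟨x, rfl⟩
    exact (hj.exists_lift _ (hj.op_neg hp2)).choose_spec x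
  h := j (contactElt 𝒦 p (eps (.pos k) + eps (.neg k)))
  z := t • j (contactElt 𝒦 p (eps (.pos k) + eps .zero))
  h_mem := Submodule.subset_span ⟨_, rfl⟩
  z_mem := Submodule.smul_mem _ _ (Submodule.subset_span ⟨_, rfl⟩)
  P := (exists_isSpectral (zmodHom 𝒦 p R) (hj.pow_of_isToral _
    (admissible_eps_add_eps hp2 (by simp)) (Or.inr ⟨k, rfl⟩))).choose
  spectral := (exists_isSpectral (zmodHom 𝒦 p R) (hj.pow_of_isToral _
    (admissible_eps_add_eps hp2 (by simp)) (Or.inr ⟨k, rfl⟩))).choose_spec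
  lie := by
    rw [mul_smul_comm, smul_mul_assoc, ← smul_sub, hj.pair_lie_self hp2]
  pow_z := by
    rw [smul_pow, hj.pow_of_not_isToral _ (admissible_eps_add_eps hp2 (by simp))
      (not_isToral_eps_pos_add_eps_zero k), smul_zero]

include hj in
/-- The Hopf algebra structure of vertical type. -/
theorem hopfStructure_verticalTwist (hp2 : p ≠ 2) (k : Fin n) (t : R) :
    let h : A := j (contactElt 𝒦 p (eps (.pos k) + eps (.neg k)))
    let e₀ : ContactAlg 𝒦 p n := contactElt 𝒦 p (eps (.pos k) + eps .zero)
    let e : A := j e₀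
    ∃ v : Aˣ, (v : A) = 1 - t • e ∧
      (∀ α : Idx n → ℕ, Admissible p α →
        (hj.verticalTwist hp2 k t).hopfStructure.comul (j (contactElt 𝒦 p α)) =
            j (contactElt 𝒦 p α) ⊗ₜ[R]
                ((v ^ ((α (.pos k) : ℤ) - (α (.neg k) : ℤ)) : Aˣ) : A) +
              ∑ ℓ ∈ Finset.range p, (-1 : R) ^ ℓ •
                (risingFactorial h ℓ ⊗ₜ[R]
                  (((v ^ (-(ℓ : ℤ)) : Aˣ) : A) *
                    (t ^ ℓ • j (divAd e₀ ℓ (contactElt 𝒦 p α))))) ∧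
        (hj.verticalTwist hp2 k t).hopfStructure.antipode (j (contactElt 𝒦 p α)) =
            -(((v ^ ((α (.neg k) : ℤ) - (α (.pos k) : ℤ)) : Aˣ) : A) *
              ∑ ℓ ∈ Finset.range p, t ^ ℓ •
                (j (divAd e₀ ℓ (contactElt 𝒦 p α)) * risingFactorial (h + 1) ℓ)) ∧
        (hj.verticalTwist hp2 k t).hopfStructure.counit (j (contactElt 𝒦 p α)) = 0) := by
  intro h e₀ e
  set T := hj.verticalTwist hp2 k t with hT
  have hg : T.g = 1 - t • e := rfl
  have hgpow := T.g_pow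
  have hinv : T.g * zpow' T.g (-1 : ZMod p) = 1 := by
    have h1 := zpow'_mul_neg hgpow 1
    rwa [zpow'_one] at h1
  have hinv' : zpow' T.g (-1 : ZMod p) * T.g = 1 := by
    have h1 := zpow'_neg_mul hgpow 1
    rwa [zpow'_one] at h1
  let v : Aˣ := ⟨T.g, zpow' T.g (-1 : ZMod p), hinv, hinv'⟩
  refine ⟨v, hg, fun α hα => ?_⟩
  have hmem : j (contactElt 𝒦 p α) ∈ Submodule.span R T.X := Submodule.subset_span ⟨_, rfl⟩
  have hlie := hj.pair_lie hp2 k hα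
  have hz (r : ℕ) : T.κ ((r.factorial : ZMod p)⁻¹) •
      (innerDer R T.z ^ r) (j (contactElt 𝒦 p α)) = t ^ r • j (divAd e₀ r (contactElt 𝒦 p α)) :=
    hj.zmodHom_smul_innerDer_pow t e₀ _ r
  refine ⟨?_, ?_, ?_⟩
  · have h1 := T.twistedComul_of_mem_span_eq_sum hmem hlie
    simp only [hz] at h1
    rw [units_zpow_eq v rfl hgpow]
    refine h1.trans (congrArg _ (Finset.sum_congr rfl fun r _ => ?_))
    rw [units_zpow_eq v rfl hgpow, Int.cast_neg, Int.cast_natCast]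
    rfl
  · have h1 := T.twistedAntipode_of_mem_span hmem hlie
    simp only [hz, smul_mul_assoc] at h1
    rw [units_zpow_eq v rfl hgpow]
    refine h1.trans ?_
    rw [← Int.cast_neg, neg_sub]
    rfl
  · exact T.counit_of_mem_span hmem

/-- A criterion for the twisted coproduct not to be cocommutative. -/
lemma not_isCocommutative (hp2 : p ≠ 2) (k : Fin n) {t : R} (ht : t ≠ 0) (φ ψ : A →ₗ[R] R)
    (hφ : φ (j (contactElt 𝒦 p (eps (.pos k) + eps (.neg k)))) = 1)
    (hψ : ψ (j (contactElt 𝒦 p (eps (.pos k) + eps (.neg k)))) = 0)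
    (hφ1 : φ 1 = 0)
    (hψe : ∀ r < p, ψ (j (contactElt 𝒦 p (eps (.pos k) + eps .zero)) ^ r) =
      if r = 1 then 1 else 0) :
    ¬ (hj.verticalTwist hp2 k t).hopfStructure.IsCocommutative := by
  intro hcomm
  set T := hj.verticalTwist hp2 k t with hT
  refine ht ?_
  have hp3 : 1 < p := hp.out.one_lt
  have hgpow := T.g_pow
  have hh : T.h = j (contactElt 𝒦 p (eps (.pos k) + eps (.neg k))) := rfl
  have hz : T.z = t • j (contactElt 𝒦 p (eps (.pos k) + eps .zero)) := rfl
  have hinv := zpow'_one_sub_neg T.κ T.pow_z 1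
  -- The inverse of `1 - t e` is the geometric sum of the `t ^ r e ^ r`, of which `ψ` sees only `r =
  -- 1`.
  have hψg : ψ (zpow' (1 - T.z) (-1 : ZMod p)) = t := by
    rw [hinv, map_sum, Finset.sum_eq_single_of_mem 1 (Finset.mem_range.mpr hp3)]
    · rw [map_smul, hz, smul_pow, map_smul, hψe 1 hp3]
      simp [negBinom, risingFactorial]
    · intro r hr hr1
      rw [map_smul, hz, smul_pow, map_smul, hψe r (Finset.mem_range.mp hr), if_neg hr1, smul_zero,
        smul_zero]
  have hψ1 : ψ 1 = 0 := by simpa using hψe 0 hp.out.pos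
  have hcop := T.twistedComul_h
  have h2 := hcomm T.h
  change TensorProduct.comm R A A (T.twistedComul T.h) = T.twistedComul T.h at h2
  -- On `Δ h = h ⊗ g⁻¹ + 1 ⊗ h` the functional `φ ⊗ ψ` takes the value `t`, on its flip the value
  -- zero.
  have h3 := congrArg (LinearMap.mul' R R ∘ₗ TensorProduct.map φ ψ) h2
  rw [hcop] at h3
  simp only [map_add, TensorProduct.comm_tmul, LinearMap.comp_apply, TensorProduct.map_tmul,
    LinearMap.mul'_apply, hh, hφ, hψ, hφ1, hψ1] at h3
  exact hψg.symm.trans (by simpa using h3.symm)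

include hj in
/-- The Hopf algebra structure of vertical type is neither commutative nor cocommutative. -/
theorem exists_verticalHopfStructure (hp2 : p ≠ 2) (k : Fin n) {t : R} (ht : t ≠ 0)
    (hfun : ∃ φ ψ : A →ₗ[R] R,
      φ (j (contactElt 𝒦 p (eps (.pos k) + eps (.neg k)))) = 1 ∧
      ψ (j (contactElt 𝒦 p (eps (.pos k) + eps (.neg k)))) = 0 ∧
      φ 1 = 0 ∧
      ∀ r < p, ψ (j (contactElt 𝒦 p (eps (.pos k) + eps .zero)) ^ r) = if r = 1 then 1 else 0) :
    let h : A := j (contactElt 𝒦 p (eps (.pos k) + eps (.neg k)))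
    let e₀ : ContactAlg 𝒦 p n := contactElt 𝒦 p (eps (.pos k) + eps .zero)
    let e : A := j e₀
    ∃ (H : HopfStructure R A) (v : Aˣ), (v : A) = 1 - t • e ∧
      (∀ α : Idx n → ℕ, Admissible p α →
        H.comul (j (contactElt 𝒦 p α)) =
            j (contactElt 𝒦 p α) ⊗ₜ[R]
                ((v ^ ((α (.pos k) : ℤ) - (α (.neg k) : ℤ)) : Aˣ) : A) +
              ∑ ℓ ∈ Finset.range p, (-1 : R) ^ ℓ •
                (risingFactorial h ℓ ⊗ₜ[R]
                  (((v ^ (-(ℓ : ℤ)) : Aˣ) : A) *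
                    (t ^ ℓ • j (divAd e₀ ℓ (contactElt 𝒦 p α))))) ∧
        H.antipode (j (contactElt 𝒦 p α)) =
            -(((v ^ ((α (.neg k) : ℤ) - (α (.pos k) : ℤ)) : Aˣ) : A) *
              ∑ ℓ ∈ Finset.range p, t ^ ℓ •
                (j (divAd e₀ ℓ (contactElt 𝒦 p α)) * risingFactorial (h + 1) ℓ)) ∧
        H.counit (j (contactElt 𝒦 p α)) = 0) ∧
      (∃ a b : A, a * b ≠ b * a) ∧ ¬ H.IsCocommutative := by
  intro h e₀ e
  obtain ⟨φ, ψ, hφ, hψ, hφ1, hψe⟩ := hfun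
  obtain ⟨v, hv, hformula⟩ := hj.hopfStructure_verticalTwist hp2 k t
  refine ⟨(hj.verticalTwist hp2 k t).hopfStructure, v, hv, hformula, ⟨h, e, fun hc => ht ?_⟩,
    hj.not_isCocommutative hp2 k ht φ ψ hφ hψ hφ1 hψe⟩
  -- Commuting `h` and `e` would force `e = [h, e] = 0`, whereas `ψ e = 1`.
  have h1 : e = 0 := (hj.pair_lie_self hp2 k).symm.trans (sub_eq_zero.mpr hc)
  have h2 := hψe 1 hp.out.one_lt
  rw [pow_one, show j _ = 0 from h1, map_zero, if_pos rfl] at h2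
  rw [← mul_one t, ← h2, mul_zero]

end IsRestrictedEnv

/-! ### PBW coordinates over `𝒦[t]_p^{(q)}` -/

section Coordinates

variable {𝒦 : Type*} [Field 𝒦] {p : ℕ} [hp : Fact p.Prime] [CharP 𝒦 p]

lemma word_replicate {ι A : Type*} [Ring A] (x : ι → A) (r : ℕ) (i : ι) :
    word x (Multiset.replicate r i) = x i ^ r := by
  rw [word, List.prod_eq_pow_card _ (x i), List.length_map, Multiset.length_toList,
    Multiset.card_replicate]
  intro y hy
  obtain ⟨l, hl, rfl⟩ := List.mem_map.mp hy
  rw [Multiset.mem_toList] at hl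
  rw [Multiset.eq_of_mem_replicate hl]

open scoped Classical in
/-- A power of a basis element of `K`, as an exponent of the Poincaré–Birkhoff–Witt basis. -/
def powExponent {n : ℕ} (a : AdmissibleIdx p n) {r : ℕ} (hr : r < p) :
    {s : Multiset (AdmissibleIdx p n) // ∀ i, s.count i < p} :=
  ⟨Multiset.replicate r a, fun i => by
    rw [Multiset.count_replicate]
    split_ifs
    exacts [hr, hp.out.pos]⟩

variable (n : ℕ) (q : 𝒦)

open scoped Classical in
/-- The Poincaré–Birkhoff–Witt basis of `u_{t,q}(K)` over `𝒦[t]_p^{(q)}`. -/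
def qBasis (hp2 : p ≠ 2) :
    Module.Basis {s : Multiset (AdmissibleIdx p n) // ∀ i, s.count i < p} (TruncPoly p q)
      (QEnv p n q) :=
  Algebra.TensorProduct.basis (TruncPoly p q) (resBasis 𝒦 n hp2)

variable {n}

lemma qBasis_powExponent (hp2 : p ≠ 2) (a : AdmissibleIdx p n) {r : ℕ} (hr : r < p) :
    qBasis n q hp2 (powExponent a hr) = toQEnv p q (contactElt 𝒦 p fun i => (a.1 i : ℕ)) ^ r := by
  rw [qBasis, Algebra.TensorProduct.basis_apply, resBasis_apply, powExponent, word_replicate,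
    toQEnv_apply, Algebra.TensorProduct.tmul_pow, one_pow]

/-- Powers below `p` of a single letter are PBW basis elements, so the coordinate functionals of `h`
and `e` serve as `φ` and `ψ`. -/
lemma exists_pair_functionals (hp2 : p ≠ 2) (k : Fin n) :
    ∃ φ ψ : QEnv p n q →ₗ[TruncPoly p q] TruncPoly p q,
      φ (toQEnv p q (contactElt 𝒦 p (eps (.pos k) + eps (.neg k)))) = 1 ∧
      ψ (toQEnv p q (contactElt 𝒦 p (eps (.pos k) + eps (.neg k)))) = 0 ∧
      φ 1 = 0 ∧
      ∀ r < p, ψ (toQEnv p q (contactElt 𝒦 p (eps (.pos k) + eps .zero)) ^ r) =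
        if r = 1 then 1 else 0 := by
  obtain ⟨a, ha⟩ := (admissible_eps_add_eps (p := p) hp2 (i := .pos k) (j := .neg k)
    (by simp)).exists_idx
  obtain ⟨b, hb⟩ := (admissible_eps_add_eps (p := p) hp2 (i := .pos k) (j := .zero)
    (by simp)).exists_idx
  have hab : a ≠ b := by
    rintro rfl
    have h1 := congrFun (ha.symm.trans hb) .zero
    simp at h1
  have hp1 : 1 < p := hp.out.one_lt
  have hBa := qBasis_powExponent q hp2 a hp1
  have hB0 := qBasis_powExponent q hp2 a hp.out.pos
  rw [pow_one, ha] at hBa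
  rw [pow_zero] at hB0
  have hBb (r : ℕ) (hr : r < p) := qBasis_powExponent q hp2 b hr
  rw [hb] at hBb
  refine ⟨(qBasis n q hp2).coord (powExponent a hp1), (qBasis n q hp2).coord (powExponent b hp1),
    ?_, ?_, ?_, fun r hr => ?_⟩
  · rw [← hBa, Module.Basis.coord_apply, Module.Basis.repr_self, Finsupp.single_eq_same]
  · rw [← hBa, Module.Basis.coord_apply, Module.Basis.repr_self, Finsupp.single_eq_of_ne]
    intro h
    exact hab (Multiset.replicate_right_injective one_ne_zero (congrArg Subtype.val h)).symm
  · rw [← hB0, Module.Basis.coord_apply, Module.Basis.repr_self, Finsupp.single_eq_of_ne]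
    intro h
    exact one_ne_zero (Multiset.replicate_left_injective a (congrArg Subtype.val h))
  · rw [← hBb r hr, Module.Basis.coord_apply, Module.Basis.repr_self]
    split_ifs with hr1
    · subst hr1
      rw [Finsupp.single_eq_same]
    · refine Finsupp.single_eq_of_ne fun h => hr1 ?_
      exact (Multiset.replicate_left_injective b (congrArg Subtype.val h)).symm

end Coordinates

end ContactHopf

end

/-! ### The main theorem -/

open ContactHopf in
theorem mainTheorem8 {𝒦 : Type*} [Field 𝒦] (p : ℕ) [Fact p.Prime] [CharP 𝒦 p] (hp2 : p ≠ 2)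
    (n : ℕ) (k : Fin n) (q : 𝒦) :
    let h : QEnv p n q := toQEnv p q (contactElt 𝒦 p (eps (.pos k) + eps (.neg k)))
    let e₀ : ContactAlg 𝒦 p n := contactElt 𝒦 p (eps (.pos k) + eps .zero)
    let e : QEnv p n q := toQEnv p q e₀
    let t : TruncPoly p q := tVar p q
    (∃ (H : HopfStructure (TruncPoly p q) (QEnv p n q)) (v : (QEnv p n q)ˣ),
      (v : QEnv p n q) = 1 - t • e ∧
      (∀ α : Idx n → ℕ, Admissible p α →
        H.comul (toQEnv p q (contactElt 𝒦 p α)) =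
            toQEnv p q (contactElt 𝒦 p α) ⊗ₜ[TruncPoly p q]
                ((v ^ ((α (.pos k) : ℤ) - (α (.neg k) : ℤ)) : (QEnv p n q)ˣ) : QEnv p n q) +
              ∑ ℓ ∈ Finset.range p, (-1 : TruncPoly p q) ^ ℓ •
                (risingFactorial h ℓ ⊗ₜ[TruncPoly p q]
                  (((v ^ (-(ℓ : ℤ)) : (QEnv p n q)ˣ) : QEnv p n q) *
                    (t ^ ℓ • toQEnv p q (divAd e₀ ℓ (contactElt 𝒦 p α))))) ∧
        H.antipode (toQEnv p q (contactElt 𝒦 p α)) =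
            -(((v ^ ((α (.neg k) : ℤ) - (α (.pos k) : ℤ)) : (QEnv p n q)ˣ) : QEnv p n q) *
              ∑ ℓ ∈ Finset.range p, t ^ ℓ •
                (toQEnv p q (divAd e₀ ℓ (contactElt 𝒦 p α)) * risingFactorial (h + 1) ℓ)) ∧
        H.counit (toQEnv p q (contactElt 𝒦 p α)) = 0) ∧
      (∃ a b : QEnv p n q, a * b ≠ b * a) ∧
      ¬ H.IsCocommutative) ∧
    Module.Finite 𝒦 (QEnv p n q) ∧
    (¬ p ∣ 2 * n + 4 → Module.finrank 𝒦 (QEnv p n q) = p ^ (p ^ (2 * n + 1) + 1)) ∧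
    (p ∣ 2 * n + 4 → Module.finrank 𝒦 (QEnv p n q) = p ^ p ^ (2 * n + 1)) := by
  intro h e₀ e t
  have hfin := finite_qEnv n hp2 q
  refine ⟨(isRestrictedEnv_toQEnv q).exists_verticalHopfStructure hp2 k (tVar_ne_zero p q)
    (exists_pair_functionals q hp2 k), hfin.1, fun hd => ?_, fun hd => ?_⟩
  · rw [hfin.2, natCard_admissibleIdx_of_not_dvd hd]
    exact (pow_succ' p _).symm
  -- The factor `p` from the scalars makes up for the missing top monomial.
  · rw [hfin.2, natCard_admissibleIdx_of_dvd hd, ← pow_succ',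
      Nat.sub_add_cancel (Nat.one_le_pow _ _ (Fact.out : p.Prime).pos)]
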